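/- Let $\theta=2\pi/3$ and $\delta=\pi/3$. **Integrals.** For real $a,b\neq0$ and an integer $m\ge 0$ put $$f_1(m)=\int_0^\infty\frac{t\log^m t}{(t^2+at+a^2)(t^2+bt+b^2)}\,dt,\qquad f_2(m)=\int_0^\infty\frac{t\log^m t}{(t^2-at+a^2)(t^2-bt+b^2)}\,dt,$$ $$g_1(m)=\int_0^\infty\frac{t(t+a)\log^m t}{(t^3-a^3)(t^2+bt+b^2)}\,dt,\qquad g_2(m)=\int_0^\infty\frac{t(t-a)\log^m t}{(t^3+a^3)(t^2-bt+b^2)}\,dt,$$ where $g_1,g_2$ are Cauchy principal values at the point $t=|a|$ (for $a>0$ the integral $g_2$ converges absolutely). **First family.** Polynomials with rational coefficients are defined recursively for $k\ge0$ by $$H_k(x)=\frac1{k+1}\sum_{1<j\le k+1,\ j\text{ odd}}(-1)^{\frac{j+1}2}\binom{k+1}{j}q^{\,j-1}H_{k+1-j}(x)+h_k(x),$$ where $q$ and $h_k$ are: - $H=R$: $q=3$, $h_k=\frac1{2(k+1)}\sum_{0\le j\le k+1,\ j\text{ even}}(-1)^{j/2}\binom{k+1}j(2^j+1)x^{k+1-j}$;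 - $H=S$: $q=3$, $h_k=\frac1{2(k+1)}\sum_{1\le j\le k+1,\ j\text{ odd}}(-1)^{(j+1)/2}\binom{k+1}j(2^j-1)x^{k+1-j}$; - $H=P$: $q=6$, $h_k=\frac1{2(k+1)}\sum_{0\le j\le k+1,\ j\text{ even}}(-1)^{j/2}\binom{k+1}j(5^j+1)x^{k+1-j}$; - $H=Q$: $q=6$, $h_k=\frac1{2(k+1)}\sum_{1\le j\le k+1,\ j\text{ odd}}(-1)^{(j-1)/2}\binom{k+1}j(5^j-1)x^{k+1-j}$; - $H=Y$: $q=3$, $h_k=-\frac1{k+1}\Big[x^{k+1}+\sum_{0\le j\le k+1,\ j\text{ even}}(-1)^{j/2}\binom{k+1}j3^jx^{k+1-j}\Big]$; - $H=Z$: $q=6$, $h_k=-\frac2{k+1}\sum_{0\le j\le k+1,\ j\text{ even}}(-1)^{j/2}\binom{k+1}j3^jx^{k+1-j}$. **Second family.** The expansions at $T=0$ (for each real $x$ and all small $T\neq0$), each of the form $\sum_{m\ge-1}c_m(x)\,T^m/m!$ with $(-1)!$ read as $1$, define polynomials $c_m$ in $x$: - $\csc(\frac T2-\frac\theta2)\csc(\frac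 T2)\sinh(xT)$ and $\csc(\frac T2-\frac\theta2)\csc(\frac T2)\cosh(xT)$ define $A_m$ and $B_m$; - $\sin(2T-\theta)\csc(3T)\sinh(xT)$ and $\sin(2T-\theta)\csc(3T)\cosh(xT)$ define $C_m$ and $D_m$; - $\csc(\frac{3T}2)\cos(\frac T2+\theta)\sinh(xT)$ and $\csc(\frac{3T}2)\cos(\frac T2+\theta)\cosh(xT)$ define $E_m$ and $F_m$; - $\cot(\frac{3T}2)e^{xT}$ defines $G_m$; - $\csc(\frac{3T}2)\sin(\frac T2+\frac\theta2)\sinh(xT)$ and $\csc(\frac{3T}2)\sin(\frac T2+\frac\theta2)\cosh(xT)$ define $K_m$ and $L_m$; - $\csc(3T)\cos(2T-2\delta)\sinh(xT)$ and $\csc(3T)\cos(2T-2\delta)\cosh(xT)$ define $U_m$ and $V_m$; - $\csc(3T)e^{xT}$ defines $W_m$; - $\csc(3T)\sin(2T-2\delta)\sinh(xT)$ and $\csc(3T)\sin(2T-2\delta)\cosh(xT)$ define $N_m$ and $O_m$. **Statement.** Write $x_a=\frac{\log|a|}\theta$, $x_b=\frac{\log|b|}\theta$, $y_a=\frac{\log|a|}\delta$,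 $y_b=\frac{\log|b|}\delta$, $s=a^2+ab+b^2$ and $d=a^3-b^3$. (1) Let $a,b>0$, $a\ne b$, $m\ge0$. The integrals $f_1(m),f_2(m),g_2(m)$ converge absolutely, the principal value $g_1(m)$ exists, and $$f_1(m)=\tfrac{\theta^{m+1}(a+b)}{d}[R_m(x_a)-R_m(x_b)]+\tfrac{\theta^{m+1}}{\sqrt3\,s}[S_m(x_a)+S_m(x_b)],$$ $$f_2(m)=\tfrac{\delta^{m+1}(a+b)}{d}[P_m(y_a)-P_m(y_b)]+\tfrac{\delta^{m+1}}{\sqrt3\,s}[Q_m(y_a)+Q_m(y_b)],$$ $$g_1(m)=\tfrac{\theta^{m+1}}{3s}[-R_m(x_a)+3R_m(x_b)+Y_m(x_a)]+\tfrac{\theta^{m+1}(a+b)}{\sqrt3\,d}[S_m(x_a)-S_m(x_b)],$$ $$g_2(m)=\tfrac{\delta^{m+1}}{3s}[-P_m(y_a)+3P_m(y_b)+Z_m(y_a)]+\tfrac{\delta^{m+1}(a+b)}{\sqrt3\,d}[Q_m(y_a)-Q_m(y_b)].$$ Also, if $m$ is even, $$f_1(m)=\tfrac{\theta^{m+1}(a+b)}{d}\tfrac{\sqrt3}4[-A_m(x_a)+A_m(x_b)]+\tfrac{\theta^{m+1}}{\sqrt3\,s}\tfrac34[B_m(x_b)+B_m(x_a)],$$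 $$f_2(m)=\tfrac{\delta^{m+1}(a+b)}{d}2\sqrt3[-C_m(y_a)+C_m(y_b)]+\tfrac{\delta^{m+1}}{\sqrt3\,s}6[-D_m(y_a)-D_m(y_b)],$$ $$g_1(m)=\tfrac{\theta^{m+1}}{s}[E_m(x_a)+\sqrt3K_m(x_b)-G_m(x_a)]+\tfrac{\theta^{m+1}(a+b)}{d}[F_m(x_a)+\sqrt3L_m(x_b)],$$ $$g_2(m)=\tfrac{2\delta^{m+1}}{s}[-\sqrt3N_m(y_b)+U_m(y_a)-W_m(y_a)]+\tfrac{2\delta^{m+1}(a+b)}{d}[\sqrt3O_m(y_b)+V_m(y_a)],$$ and if $m$ is odd the same four formulas hold after interchanging $A_m\leftrightarrow B_m$, $C_m\leftrightarrow D_m$, $E_m\leftrightarrow F_m$, $K_m\leftrightarrow L_m$, $U_m\leftrightarrow V_m$, $N_m\leftrightarrow O_m$. (2) For all real $a,b\ne0$ with $a\neq b$ and all $m\ge 0$, the integrals $f_1(m),f_2(m)$ converge absolutely and the principal values $g_1(m),g_2(m)$ exist; $f_1(m)+f_2(m)$ equals the sum of the right-hand sides given in (1) for $f_1(m)$ and $f_2(m)$,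 and $g_1(m)+g_2(m)$ equals the sum of those for $g_1(m)$ and $g_2(m)$, with either family of polynomials. (3) For $m\ge0$, $$A_m(x)=m!\sum_{j=0}^{\lfloor m/2\rfloor}\Big(\sum_{k=0}^{\lfloor (m+1)/2\rfloor}\beta_k\frac{\mu_{m-2j-2k}}{(m-2j-2k)!}\Big)\frac{x^{2j+1}}{(2j+1)!},\quad B_m(x)=m!\sum_{j=0}^{\lfloor (m+1)/2\rfloor}\Big(\sum_{k=0}^{\lfloor (m+1)/2\rfloor}\beta_k\frac{\mu_{m-2j-2k+1}}{(m-2j-2k+1)!}\Big)\frac{x^{2j}}{(2j)!},$$ where terms with a negative index of $\mu$ are $0$, $\beta_k=(-1)^{k-1}2\big(1-\frac1{2^{2k-1}}\big)\frac{\mathscr B_{2k}}{(2k)!}$ with $\mathscr B_{2k}$ the Bernoulli numbers, and $$\mu_n=-\frac1{2^{n-1}\sqrt3}\sum\frac{n!\,k!}{k_1!\cdots k_n!}\cdot\frac{(-1)^{\xi}}{(\sqrt3)^{\epsilon}}\cdot\frac1{(1!)^{k_1}\cdots(n!)^{k_n}},$$ the sum running over the partitions of $n$ with $k_j$ parts equal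 to $j$, $k=\sum_j k_j$, $\epsilon=\sum_{j\text{ odd}}k_j$, $\xi=\sum_{j\equiv0,3\ (4)}k_j$. (4) Write $p\approx q$ if $p-q$ is constant. For even $m$: $R_m\approx-\frac{\sqrt3}4A_m$, $S_m=\frac34B_m$, $P_m\approx-2\sqrt3\,C_m$, $Q_m=-6D_m$. For odd $m$: $R_m\approx-\frac{\sqrt3}4B_m$, $S_m=\frac34A_m$, $P_m\approx-2\sqrt3\,D_m$, $Q_m=-6C_m$. For all $m\ge0$: $Y_m\approx-3G_m$ and $Z_m\approx-6W_m$. (5) All coefficients of all the polynomials of both families lie in $\mathbb Q\cup\sqrt3\,\mathbb Q$. -/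

import Mathlib

open Polynomial

namespace LogIntegrals

noncomputable section

/-! ### Angles -/

/-- `θ = 2π/3`. -/
def θ : ℝ := 2 * Real.pi / 3

/-- `δ = π/3`. -/
def δ : ℝ := Real.pi / 3

/-! ### The four integrands and the Cauchy principal value -/

def f1Integrand (a b : ℝ) (m : ℕ) (t : ℝ) : ℝ :=
  t * Real.log t ^ m / ((t ^ 2 + a * t + a ^ 2) * (t ^ 2 + b * t + b ^ 2))

def f2Integrand (a b : ℝ) (m : ℕ) (t : ℝ) : ℝ :=
  t * Real.log t ^ m / ((t ^ 2 - a * t + a ^ 2) * (t ^ 2 - b * t + b ^ 2))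

def g1Integrand (a b : ℝ) (m : ℕ) (t : ℝ) : ℝ :=
  t * (t + a) * Real.log t ^ m / ((t ^ 3 - a ^ 3) * (t ^ 2 + b * t + b ^ 2))

def g2Integrand (a b : ℝ) (m : ℕ) (t : ℝ) : ℝ :=
  t * (t - a) * Real.log t ^ m / ((t ^ 3 + a ^ 3) * (t ^ 2 - b * t + b ^ 2))

/-- `f` is (absolutely) integrable on `(0, ∞)` with integral `v`. -/
def HasIntegral (f : ℝ → ℝ) (v : ℝ) : Prop :=
  MeasureTheory.IntegrableOn f (Set.Ioi 0) ∧ ∫ t in Set.Ioi (0 : ℝ), f t = v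

/-- The Cauchy principal value of `∫_0^∞ f` with respect to the point `c` exists and equals `v`:
`f` is integrable away from `c`, and the integrals over `{t > 0 : |t - c| ≥ ε}` tend to `v`
as `ε → 0⁺`. -/
def HasPVIntegral (f : ℝ → ℝ) (c v : ℝ) : Prop :=
  (∀ ε > 0, MeasureTheory.IntegrableOn f {t : ℝ | 0 < t ∧ ε ≤ |t - c|}) ∧
  Filter.Tendsto (fun ε : ℝ => ∫ t in {t : ℝ | 0 < t ∧ ε ≤ |t - c|}, f t)
    (nhdsWithin 0 (Set.Ioi 0)) (nhds v)

/-! ### The recursively defined polynomials, with rational coefficients -/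

/-- The family `H_k` with
`H_k = (1/(k+1)) ∑_{1 < j ≤ k+1, j odd} (-1)^((j+1)/2) binom(k+1, j) q^(j-1) H_{k+1-j} + h_k`. -/
def recPoly (q : ℚ) (h : ℕ → ℚ[X]) (k : ℕ) : ℚ[X] :=
  C (1 / ((k : ℚ) + 1)) *
      (∑ j ∈ ((Finset.Icc 2 (k + 1)).filter Odd).attach,
        C ((-1) ^ ((j.1 + 1) / 2) * ((k + 1).choose j.1 : ℚ) * q ^ (j.1 - 1)) *
          recPoly q h (k + 1 - j.1))
    + h k
termination_by k
decreasing_by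
  have := Finset.mem_Icc.1 (Finset.mem_filter.1 j.2).1
  omega

theorem recPoly_eq (q : ℚ) (h : ℕ → ℚ[X]) (k : ℕ) :
    recPoly q h k = C (1 / ((k : ℚ) + 1)) *
      (∑ j ∈ (Finset.Icc 2 (k + 1)).filter Odd,
        C ((-1) ^ ((j + 1) / 2) * ((k + 1).choose j : ℚ) * q ^ (j - 1)) *
          recPoly q h (k + 1 - j))
    + h k := by
  rw [recPoly]
  congr 2
  exact Finset.sum_attach ((Finset.Icc 2 (k + 1)).filter Odd) (fun j =>
    C ((-1) ^ ((j + 1) / 2) * ((k + 1).choose j : ℚ) * q ^ (j - 1)) * recPoly q h (k + 1 - j))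

def polyR : ℕ → ℚ[X] := recPoly 3 fun k =>
  C (1 / (2 * ((k : ℚ) + 1))) * ∑ j ∈ (Finset.Icc 0 (k + 1)).filter Even,
    C ((-1) ^ (j / 2) * ((k + 1).choose j : ℚ) * (2 ^ j + 1)) * X ^ (k + 1 - j)

def polyS : ℕ → ℚ[X] := recPoly 3 fun k =>
  C (1 / (2 * ((k : ℚ) + 1))) * ∑ j ∈ (Finset.Icc 1 (k + 1)).filter Odd,
    C ((-1) ^ ((j + 1) / 2) * ((k + 1).choose j : ℚ) * (2 ^ j - 1)) * X ^ (k + 1 - j)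

def polyP : ℕ → ℚ[X] := recPoly 6 fun k =>
  C (1 / (2 * ((k : ℚ) + 1))) * ∑ j ∈ (Finset.Icc 0 (k + 1)).filter Even,
    C ((-1) ^ (j / 2) * ((k + 1).choose j : ℚ) * (5 ^ j + 1)) * X ^ (k + 1 - j)

def polyQ : ℕ → ℚ[X] := recPoly 6 fun k =>
  C (1 / (2 * ((k : ℚ) + 1))) * ∑ j ∈ (Finset.Icc 1 (k + 1)).filter Odd,
    C ((-1) ^ ((j - 1) / 2) * ((k + 1).choose j : ℚ) * (5 ^ j - 1)) * X ^ (k + 1 - j)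

def polyY : ℕ → ℚ[X] := recPoly 3 fun k =>
  - C (1 / ((k : ℚ) + 1)) * (X ^ (k + 1) + ∑ j ∈ (Finset.Icc 0 (k + 1)).filter Even,
    C ((-1) ^ (j / 2) * ((k + 1).choose j : ℚ) * 3 ^ j) * X ^ (k + 1 - j))

def polyZ : ℕ → ℚ[X] := recPoly 6 fun k =>
  - C (2 / ((k : ℚ) + 1)) * ∑ j ∈ (Finset.Icc 0 (k + 1)).filter Even,
    C ((-1) ^ (j / 2) * ((k + 1).choose j : ℚ) * 3 ^ j) * X ^ (k + 1 - j)

/-! ### The polynomials given by coefficients of Laurent series in `T` -/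

/-- The Taylor series in `T` of `sin (c T + d)`. -/
def sinSeries (c d : ℝ) : PowerSeries ℝ :=
  PowerSeries.C (Real.sin d) * PowerSeries.rescale c (PowerSeries.cos ℝ)
    + PowerSeries.C (Real.cos d) * PowerSeries.rescale c (PowerSeries.sin ℝ)

/-- The Taylor series in `T` of `cos (c T + d)`. -/
def cosSeries (c d : ℝ) : PowerSeries ℝ :=
  PowerSeries.C (Real.cos d) * PowerSeries.rescale c (PowerSeries.cos ℝ)
    - PowerSeries.C (Real.sin d) * PowerSeries.rescale c (PowerSeries.sin ℝ)

/-- The Laurent series in `T` of `csc (c T + d)`. -/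
def cscSeries (c d : ℝ) : LaurentSeries ℝ := (sinSeries c d : LaurentSeries ℝ)⁻¹

/-- `sinh (x T)` as a power series in `T` over the polynomials in `x`. -/
def sinhXT : PowerSeries ℝ[X] :=
  PowerSeries.mk fun n => if Odd n then C (1 / (n.factorial : ℝ)) * X ^ n else 0

/-- `cosh (x T)` as a power series in `T` over the polynomials in `x`. -/
def coshXT : PowerSeries ℝ[X] :=
  PowerSeries.mk fun n => if Even n then C (1 / (n.factorial : ℝ)) * X ^ n else 0

/-- `exp (x T)` as a power series in `T` over the polynomials in `x`. -/
def expXT : PowerSeries ℝ[X] :=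
  PowerSeries.mk fun n => C (1 / (n.factorial : ℝ)) * X ^ n

/-- The polynomials `c_m(x)` in `κ(T) h(x, T) = ∑_m c_m(x) T^m / m!`, where the polar term
`m = -1` is taken without a factorial. -/
def laurentPoly (κ : LaurentSeries ℝ) (h : PowerSeries ℝ[X]) (m : ℤ) : ℝ[X] :=
  C (m.toNat.factorial : ℝ) *
    ((HahnSeries.map κ (C : ℝ →+* ℝ[X]) : LaurentSeries ℝ[X]) * (h : LaurentSeries ℝ[X])).coeff m

def polyA : ℤ → ℝ[X] := laurentPoly (cscSeries (1 / 2) (-θ / 2) * cscSeries (1 / 2) 0) sinhXT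

def polyB : ℤ → ℝ[X] := laurentPoly (cscSeries (1 / 2) (-θ / 2) * cscSeries (1 / 2) 0) coshXT

def polyC : ℤ → ℝ[X] := laurentPoly (sinSeries 2 (-θ) * cscSeries 3 0) sinhXT

def polyD : ℤ → ℝ[X] := laurentPoly (sinSeries 2 (-θ) * cscSeries 3 0) coshXT

def polyE : ℤ → ℝ[X] := laurentPoly (cscSeries (3 / 2) 0 * cosSeries (1 / 2) θ) sinhXT

def polyF : ℤ → ℝ[X] := laurentPoly (cscSeries (3 / 2) 0 * cosSeries (1 / 2) θ) coshXT

def polyG : ℤ → ℝ[X] := laurentPoly (cosSeries (3 / 2) 0 * cscSeries (3 / 2) 0) expXT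

def polyK : ℤ → ℝ[X] := laurentPoly (cscSeries (3 / 2) 0 * sinSeries (1 / 2) (θ / 2)) sinhXT

def polyL : ℤ → ℝ[X] := laurentPoly (cscSeries (3 / 2) 0 * sinSeries (1 / 2) (θ / 2)) coshXT

def polyU : ℤ → ℝ[X] := laurentPoly (cscSeries 3 0 * cosSeries 2 (-2 * δ)) sinhXT

def polyV : ℤ → ℝ[X] := laurentPoly (cscSeries 3 0 * cosSeries 2 (-2 * δ)) coshXT

def polyW : ℤ → ℝ[X] := laurentPoly (cscSeries 3 0) expXT

def polyN : ℤ → ℝ[X] := laurentPoly (cscSeries 3 0 * sinSeries 2 (-2 * δ)) sinhXT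

def polyO : ℤ → ℝ[X] := laurentPoly (cscSeries 3 0 * sinSeries 2 (-2 * δ)) coshXT

/-- For every real `x`, the expansion `Φ(x, T) = ∑_{m ≥ -1} c_m(x) T^m / m!` holds (with a
convergent series) for all `T ≠ 0` near `0`. The summation index is `n = m + 1`; the polar
term `m = -1` carries no factorial. -/
def HasExpansion (Φ : ℝ → ℝ → ℝ) (c : ℤ → ℝ[X]) : Prop :=
  ∀ x : ℝ, ∀ᶠ T : ℝ in nhdsWithin 0 {0}ᶜ,
    HasSum (fun n : ℕ => (c ((n : ℤ) - 1)).eval x * T ^ ((n : ℤ) - 1) / ((n - 1).factorial : ℝ))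
      (Φ x T)

/-- Cosecant. -/
def csc (y : ℝ) : ℝ := (Real.sin y)⁻¹

/-! ### The explicit formulas for `A_m` and `B_m` -/

/-- `μ_n`, a sum over the partitions of `n`, where `k_j` is the number of parts equal to `j`. -/
def mu (n : ℕ) : ℝ :=
  -(1 / ((2 : ℝ) ^ ((n : ℤ) - 1) * √3)) *
    ∑ p : n.Partition,
      ((n.factorial * p.parts.card.factorial : ℕ) : ℝ)
          / ((∏ j ∈ Finset.Icc 1 n, (p.parts.count j).factorial : ℕ) : ℝ)
        * ((-1) ^ (∑ j ∈ (Finset.Icc 1 n).filter (fun j => j % 4 = 0 ∨ j % 4 = 3), p.parts.count j)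
          / √3 ^ (∑ j ∈ (Finset.Icc 1 n).filter Odd, p.parts.count j))
        * (1 / ((∏ j ∈ Finset.Icc 1 n, j.factorial ^ p.parts.count j : ℕ) : ℝ))

/-- `μ_i / i!`, read as `0` for `i < 0`. -/
def muDiv (i : ℤ) : ℝ := if 0 ≤ i then mu i.toNat / (i.toNat.factorial : ℝ) else 0

/-- The coefficient `(-1)^(k-1) 2 (1 - 1/2^(2k-1)) 𝓑_{2k} / (2k)!` with Bernoulli numbers `𝓑`. -/
def bernCoeff (k : ℕ) : ℝ :=
  (-1) ^ ((k : ℤ) - 1) * 2 * (1 - 1 / (2 : ℝ) ^ (2 * (k : ℤ) - 1))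
    * ((bernoulli (2 * k) : ℚ) : ℝ) / ((2 * k).factorial : ℝ)

def explicitA (m : ℕ) : ℝ[X] :=
  C (m.factorial : ℝ) * ∑ j ∈ Finset.range (m / 2 + 1),
    C ((∑ k ∈ Finset.range ((m + 1) / 2 + 1), bernCoeff k * muDiv ((m : ℤ) - 2 * j - 2 * k))
        * (1 / ((2 * j + 1).factorial : ℝ))) * X ^ (2 * j + 1)

def explicitB (m : ℕ) : ℝ[X] :=
  C (m.factorial : ℝ) * ∑ j ∈ Finset.range ((m + 1) / 2 + 1),
    C ((∑ k ∈ Finset.range ((m + 1) / 2 + 1), bernCoeff k * muDiv ((m : ℤ) - 2 * j - 2 * k + 1))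
        * (1 / ((2 * j).factorial : ℝ))) * X ^ (2 * j)

/-! ### The closed formulas

The formulas are written with `log |a|` and `log |b|`, which are `log a` and `log b` when
`a, b > 0`. -/

/-- `log |a| / θ`. -/
def xθ (a : ℝ) : ℝ := Real.log |a| / θ

/-- `log |a| / δ`. -/
def xδ (a : ℝ) : ℝ := Real.log |a| / δ

def f1Rec (a b : ℝ) (m : ℕ) : ℝ :=
  θ ^ (m + 1) * (a + b) / (a ^ 3 - b ^ 3) * (aeval (xθ a) (polyR m) - aeval (xθ b) (polyR m))
  + θ ^ (m + 1) / (√3 * (a ^ 2 + a * b + b ^ 2))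
    * (aeval (xθ a) (polyS m) + aeval (xθ b) (polyS m))

def f2Rec (a b : ℝ) (m : ℕ) : ℝ :=
  δ ^ (m + 1) * (a + b) / (a ^ 3 - b ^ 3) * (aeval (xδ a) (polyP m) - aeval (xδ b) (polyP m))
  + δ ^ (m + 1) / (√3 * (a ^ 2 + a * b + b ^ 2))
    * (aeval (xδ a) (polyQ m) + aeval (xδ b) (polyQ m))

def g1Rec (a b : ℝ) (m : ℕ) : ℝ :=
  θ ^ (m + 1) / (3 * (a ^ 2 + a * b + b ^ 2))
    * (-aeval (xθ a) (polyR m) + 3 * aeval (xθ b) (polyR m) + aeval (xθ a) (polyY m))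
  + θ ^ (m + 1) * (a + b) / (√3 * (a ^ 3 - b ^ 3))
    * (aeval (xθ a) (polyS m) - aeval (xθ b) (polyS m))

def g2Rec (a b : ℝ) (m : ℕ) : ℝ :=
  δ ^ (m + 1) / (3 * (a ^ 2 + a * b + b ^ 2))
    * (-aeval (xδ a) (polyP m) + 3 * aeval (xδ b) (polyP m) + aeval (xδ a) (polyZ m))
  + δ ^ (m + 1) * (a + b) / (√3 * (a ^ 3 - b ^ 3))
    * (aeval (xδ a) (polyQ m) - aeval (xδ b) (polyQ m))

def f1Alt (a b : ℝ) (m : ℕ) : ℝ :=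
  if Even m then
    θ ^ (m + 1) * (a + b) / (a ^ 3 - b ^ 3) * (√3 / 4)
      * (-(polyA m).eval (xθ a) + (polyA m).eval (xθ b))
    + θ ^ (m + 1) / (√3 * (a ^ 2 + a * b + b ^ 2)) * (3 / 4)
      * ((polyB m).eval (xθ b) + (polyB m).eval (xθ a))
  else
    θ ^ (m + 1) * (a + b) / (a ^ 3 - b ^ 3) * (√3 / 4)
      * (-(polyB m).eval (xθ a) + (polyB m).eval (xθ b))
    + θ ^ (m + 1) / (√3 * (a ^ 2 + a * b + b ^ 2)) * (3 / 4)
      * ((polyA m).eval (xθ b) + (polyA m).eval (xθ a))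

def f2Alt (a b : ℝ) (m : ℕ) : ℝ :=
  if Even m then
    δ ^ (m + 1) * (a + b) / (a ^ 3 - b ^ 3) * (2 * √3)
      * (-(polyC m).eval (xδ a) + (polyC m).eval (xδ b))
    + δ ^ (m + 1) / (√3 * (a ^ 2 + a * b + b ^ 2)) * 6
      * (-(polyD m).eval (xδ a) - (polyD m).eval (xδ b))
  else
    δ ^ (m + 1) * (a + b) / (a ^ 3 - b ^ 3) * (2 * √3)
      * (-(polyD m).eval (xδ a) + (polyD m).eval (xδ b))
    + δ ^ (m + 1) / (√3 * (a ^ 2 + a * b + b ^ 2)) * 6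
      * (-(polyC m).eval (xδ a) - (polyC m).eval (xδ b))

def g1Alt (a b : ℝ) (m : ℕ) : ℝ :=
  if Even m then
    θ ^ (m + 1) / (3 * (a ^ 2 + a * b + b ^ 2)) * 3
      * ((polyE m).eval (xθ a) + √3 * (polyK m).eval (xθ b) - (polyG m).eval (xθ a))
    + θ ^ (m + 1) * (a + b) / (√3 * (a ^ 3 - b ^ 3)) * √3
      * ((polyF m).eval (xθ a) + √3 * (polyL m).eval (xθ b))
  else
    θ ^ (m + 1) / (3 * (a ^ 2 + a * b + b ^ 2)) * 3
      * ((polyF m).eval (xθ a) + √3 * (polyL m).eval (xθ b) - (polyG m).eval (xθ a))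
    + θ ^ (m + 1) * (a + b) / (√3 * (a ^ 3 - b ^ 3)) * √3
      * ((polyE m).eval (xθ a) + √3 * (polyK m).eval (xθ b))

def g2Alt (a b : ℝ) (m : ℕ) : ℝ :=
  if Even m then
    δ ^ (m + 1) / (3 * (a ^ 2 + a * b + b ^ 2)) * 6
      * (-√3 * (polyN m).eval (xδ b) + (polyU m).eval (xδ a) - (polyW m).eval (xδ a))
    + δ ^ (m + 1) * (a + b) / (√3 * (a ^ 3 - b ^ 3)) * (2 * √3)
      * (√3 * (polyO m).eval (xδ b) + (polyV m).eval (xδ a))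
  else
    δ ^ (m + 1) / (3 * (a ^ 2 + a * b + b ^ 2)) * 6
      * (-√3 * (polyO m).eval (xδ b) + (polyV m).eval (xδ a) - (polyW m).eval (xδ a))
    + δ ^ (m + 1) * (a + b) / (√3 * (a ^ 3 - b ^ 3)) * (2 * √3)
      * (√3 * (polyN m).eval (xδ b) + (polyU m).eval (xδ a))

/-! ### Comparison of polynomials and their coefficients -/

/-- The rational polynomial `p`, as a real polynomial, equals `s • q`. -/
def EqMul (p : ℚ[X]) (s : ℝ) (q : ℝ[X]) : Prop :=
  p.map (algebraMap ℚ ℝ) = C s * q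

/-- The rational polynomial `p`, as a real polynomial, equals `s • q` up to the constant term. -/
def ApproxMul (p : ℚ[X]) (s : ℝ) (q : ℝ[X]) : Prop :=
  ∃ c : ℝ, p.map (algebraMap ℚ ℝ) = C s * q + C c

/-- All coefficients lie in `ℚ ∪ √3 ℚ`. -/
def CoeffsInQSqrt3 (p : ℝ[X]) : Prop :=
  ∀ i : ℕ, ∃ r : ℚ, p.coeff i = (r : ℝ) ∨ p.coeff i = √3 * (r : ℝ)

end

end LogIntegrals

open LogIntegrals

namespace LogIntegrals

open Filter Topology

theorem hasSum_of_eq {u v : ℕ → ℝ} {r : ℝ} (h : ∀ n, u n = v n) (hv : HasSum v r) : HasSum u r :=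
  funext h ▸ hv

/-- The power series `p` converges near `0`, with sum `f`. -/
def Represents (p : PowerSeries ℝ) (f : ℝ → ℝ) : Prop :=
  ∀ᶠ T in 𝓝 (0 : ℝ), HasSum (fun n => PowerSeries.coeff n p * T ^ n) (f T)

namespace Represents

variable {p q : PowerSeries ℝ} {f g : ℝ → ℝ}

theorem iff_hasFPowerSeriesAt :
    Represents p f ↔ HasFPowerSeriesAt f
      (FormalMultilinearSeries.ofScalars ℝ fun n => PowerSeries.coeff n p) 0 := by
  rw [hasFPowerSeriesAt_iff, Represents]
  simp [mul_comm]

theorem congr (hp : Represents p f) (h : f =ᶠ[𝓝 0] g) : Represents p g := by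
  filter_upwards [hp, h] with T h1 h2
  rwa [← h2]

theorem unique (hp : Represents p f) (hq : Represents q f) : p = q := by
  have := (iff_hasFPowerSeriesAt.1 hp).eq_formalMultilinearSeries (iff_hasFPowerSeriesAt.1 hq)
  ext n
  have h := congrArg (fun r => r.coeff n) this
  simpa using h

theorem add (hp : Represents p f) (hq : Represents q g) :
    Represents (p + q) (fun T => f T + g T) := by
  filter_upwards [hp, hq] with T h1 h2
  simpa [add_mul] using h1.add h2

theorem mul (hp : Represents p f) (hq : Represents q g) :
    Represents (p * q) (fun T => f T * g T) := by
  filter_upwards [hp, hq] with T h1 h2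
  have s1 := h1.summable.norm
  have s2 := h2.summable.norm
  have e := tsum_mul_tsum_eq_tsum_sum_antidiagonal_of_summable_norm s1 s2
  have s := (summable_norm_sum_mul_antidiagonal_of_summable_norm s1 s2).of_norm.hasSum
  rw [← e, h1.tsum_eq, h2.tsum_eq] at s
  refine hasSum_of_eq (fun n => ?_) s
  rw [PowerSeries.coeff_mul, Finset.sum_mul]
  refine Finset.sum_congr rfl fun x hx => ?_
  rw [← Finset.HasAntidiagonal.mem_antidiagonal.1 hx, pow_add]
  ring

theorem const (r : ℝ) : Represents (PowerSeries.C r) (fun _ => r) := by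
  refine Eventually.of_forall fun T => ?_
  convert hasSum_ite_eq (0 : ℕ) r using 2 with n
  by_cases h : n = 0 <;> simp [h, PowerSeries.coeff_C]

theorem one : Represents 1 (fun _ => 1) := by
  simpa using const 1

theorem neg (hp : Represents p f) : Represents (-p) (fun T => -f T) := by
  filter_upwards [hp] with T h1
  simpa using h1.neg

theorem sub (hp : Represents p f) (hq : Represents q g) :
    Represents (p - q) (fun T => f T - g T) := by
  simpa [sub_eq_add_neg] using hp.add hq.neg

theorem X : Represents PowerSeries.X (fun T => T) := by
  refine Eventually.of_forall fun T => ?_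
  convert hasSum_ite_eq (1 : ℕ) T using 2 with n
  by_cases h : n = 1 <;> simp [h, PowerSeries.coeff_X]

theorem eq_of_eventually_punctured (hp : Represents p f) (hq : Represents q g)
    (h : ∀ᶠ T in 𝓝[≠] (0 : ℝ), f T = g T) : p = q := by
  have : PowerSeries.X * p = PowerSeries.X * q := by
    refine unique (X.mul hp) ((X.mul hq).congr ?_)
    rw [eventually_nhdsWithin_iff] at h
    filter_upwards [h] with T hT
    by_cases h0 : T = 0
    · simp [h0]
    · rw [hT h0]
  exact mul_left_cancel₀ PowerSeries.X_ne_zero this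

theorem continuousAt (hp : Represents p f) : ContinuousAt f 0 :=
  (iff_hasFPowerSeriesAt.1 hp).continuousAt

theorem apply_zero (hp : Represents p f) : f 0 = PowerSeries.constantCoeff p := by
  have h := hp.self_of_nhds
  refine h.unique ?_
  convert hasSum_ite_eq (0 : ℕ) (PowerSeries.constantCoeff p) using 2 with n
  by_cases h : n = 0 <;> simp [h]

theorem inv (hp : Represents p f) (h0 : PowerSeries.constantCoeff p ≠ 0) :
    Represents p⁻¹ (fun T => (f T)⁻¹) := by
  have hf0 : f 0 ≠ 0 := by rwa [hp.apply_zero]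
  obtain ⟨r, hr⟩ : AnalyticAt ℝ (fun T => (f T)⁻¹) 0 :=
    (iff_hasFPowerSeriesAt.1 hp).analyticAt.fun_inv hf0
  have hr' : Represents (PowerSeries.mk r.coeff) (fun T => (f T)⁻¹) := by
    rw [hasFPowerSeriesAt_iff] at hr
    filter_upwards [hr] with T hT
    simpa [mul_comm] using hT
  have : p * PowerSeries.mk r.coeff = 1 := by
    refine unique (hp.mul hr') (one.congr ?_)
    filter_upwards [hp.continuousAt.eventually_ne hf0] with T hT
    exact (mul_inv_cancel₀ hT).symm
  rwa [← (PowerSeries.eq_inv_iff_mul_eq_one h0).2 ((mul_comm _ _).trans this)]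

theorem rescale (c : ℝ) (hp : Represents p f) :
    Represents (PowerSeries.rescale c p) (fun T => f (c * T)) := by
  have : Tendsto (fun T : ℝ => c * T) (𝓝 0) (𝓝 0) := by
    simpa using (continuous_const_mul c).tendsto (0 : ℝ)
  filter_upwards [this.eventually hp] with T h1
  convert h1 using 2 with n
  rw [PowerSeries.coeff_rescale]
  ring

theorem sin : Represents (PowerSeries.sin ℝ) Real.sin := by
  refine Eventually.of_forall fun T => ?_
  rw [← zero_add (Real.sin T)]
  refine HasSum.even_add_odd ?_ ?_
  · simp [PowerSeries.sin]
  · convert Real.hasSum_sin T using 2 with n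
    have : (2 * n + 1) / 2 = n := by omega
    simp [PowerSeries.sin, this]
    ring

theorem cos : Represents (PowerSeries.cos ℝ) Real.cos := by
  refine Eventually.of_forall fun T => ?_
  rw [← add_zero (Real.cos T)]
  refine HasSum.even_add_odd ?_ ?_
  · convert Real.hasSum_cos T using 2 with n
    have : (2 * n) / 2 = n := by omega
    simp [PowerSeries.cos]
    ring
  · simp [PowerSeries.cos]

theorem exp : Represents (PowerSeries.exp ℝ) Real.exp := by
  refine Eventually.of_forall fun T => ?_
  rw [Real.exp_eq_exp_ℝ]
  refine hasSum_of_eq (fun n => ?_) (NormedSpace.expSeries_div_hasSum_exp T)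
  simp [PowerSeries.coeff_exp]
  ring

theorem sinSeries (c d : ℝ) : Represents (sinSeries c d) (fun T => Real.sin (c * T + d)) := by
  refine (((const _).mul (cos.rescale c)).add ((const _).mul (sin.rescale c))).congr ?_
  refine Eventually.of_forall fun T => ?_
  simp only [Real.sin_add]
  ring

theorem cosSeries (c d : ℝ) : Represents (cosSeries c d) (fun T => Real.cos (c * T + d)) := by
  refine (((const _).mul (cos.rescale c)).sub ((const _).mul (sin.rescale c))).congr ?_
  refine Eventually.of_forall fun T => ?_
  simp only [Real.cos_add]
  ring

/-- Division by the variable. -/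
theorem of_X_mul (hp : Represents (PowerSeries.X * p) f) :
    Represents p (fun T => if T = 0 then PowerSeries.constantCoeff p else f T / T) := by
  filter_upwards [hp] with T hT
  split_ifs with h0
  · subst h0
    convert hasSum_ite_eq (0 : ℕ) (PowerSeries.constantCoeff p) using 2 with n
    by_cases h : n = 0 <;> simp [h]
  · have h1 := (hasSum_nat_add_iff' 1).2 hT
    simp only [PowerSeries.coeff_succ_X_mul, Finset.range_one, Finset.sum_singleton,
      PowerSeries.coeff_zero_X_mul, zero_mul, sub_zero] at h1
    refine hasSum_of_eq (fun n => ?_) (h1.div_const T)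
    rw [pow_succ]
    field_simp

end Represents

end LogIntegrals

namespace LogIntegrals

open Filter Topology

noncomputable section

/-- The power series of `T / sin (c T)`. -/
def cscT (c : ℝ) : PowerSeries ℝ :=
  (PowerSeries.mk fun n => PowerSeries.coeff (n + 1) (sinSeries c 0))⁻¹

theorem sinSeries_zero (c : ℝ) : sinSeries c 0 = PowerSeries.rescale c (PowerSeries.sin ℝ) := by
  simp [sinSeries]

theorem cosSeries_zero (c : ℝ) : cosSeries c 0 = PowerSeries.rescale c (PowerSeries.cos ℝ) := by
  simp [cosSeries]

theorem X_mul_sincSeries (c : ℝ) :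
    PowerSeries.X * (PowerSeries.mk fun n => PowerSeries.coeff (n + 1) (sinSeries c 0)) =
      sinSeries c 0 := by
  ext n
  cases n with
  | zero => simp [sinSeries_zero, PowerSeries.coeff_rescale, PowerSeries.sin]
  | succ n => simp [PowerSeries.coeff_succ_X_mul]

theorem constantCoeff_sincSeries (c : ℝ) : PowerSeries.constantCoeff
    (PowerSeries.mk fun n => PowerSeries.coeff (n + 1) (sinSeries c 0)) = c := by
  rw [← PowerSeries.coeff_zero_eq_constantCoeff_apply]
  simp [sinSeries_zero, PowerSeries.coeff_rescale, PowerSeries.sin]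

theorem cscT_mul_sinSeries {c : ℝ} (hc : c ≠ 0) : cscT c * sinSeries c 0 = PowerSeries.X := by
  rw [← X_mul_sincSeries, cscT, mul_left_comm, PowerSeries.inv_mul_cancel, mul_one]
  rwa [constantCoeff_sincSeries]

theorem sinSeries_zero_ne_zero {c : ℝ} (hc : c ≠ 0) : sinSeries c 0 ≠ 0 := by
  intro h
  have := cscT_mul_sinSeries hc
  rw [h, mul_zero] at this
  exact PowerSeries.X_ne_zero this.symm

theorem Represents.cscT {c : ℝ} (hc : c ≠ 0) :
    Represents (cscT c) (fun T => if T = 0 then c⁻¹ else T / Real.sin (c * T)) := by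
  have h := ((X_mul_sincSeries c).symm ▸ Represents.sinSeries c 0).of_X_mul.inv
    (by rwa [constantCoeff_sincSeries])
  refine h.congr (Eventually.of_forall fun T => ?_)
  dsimp only
  split_ifs with h0
  · rw [constantCoeff_sincSeries]
  · rw [inv_div, add_zero]

/-- The Laurent series `T⁻¹ k(T)`. -/
def divT {R : Type*} [CommRing R] (k : PowerSeries R) : LaurentSeries R :=
  HahnSeries.single (-1) 1 * (k : LaurentSeries R)

theorem coeff_divT {R : Type*} [CommRing R] (k : PowerSeries R) (i : ℤ) :
    (divT k).coeff i = if i + 1 < 0 then 0 else PowerSeries.coeff (i + 1).toNat k := by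
  have := HahnSeries.coeff_single_mul_add (r := (1 : R)) (x := (k : LaurentSeries R))
    (a := i + 1) (b := -1)
  rw [add_neg_cancel_right, one_mul] at this
  rw [divT, this, PowerSeries.coeff_coe]
  split_ifs with h
  · rfl
  · congr 1
    congr 1
    omega

theorem coe_mul_divT (p k : PowerSeries ℝ) : (p : LaurentSeries ℝ) * divT k = divT (p * k) := by
  rw [divT, divT, PowerSeries.coe_mul, mul_left_comm]

theorem divT_mul_coe {R : Type*} [CommRing R] (p k : PowerSeries R) :
    divT k * (p : LaurentSeries R) = divT (k * p) := by
  rw [divT, divT, PowerSeries.coe_mul, mul_assoc]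

theorem cscSeries_zero {c : ℝ} (hc : c ≠ 0) : cscSeries c 0 = divT (cscT c) := by
  rw [cscSeries, inv_eq_iff_eq_inv]
  refine eq_inv_of_mul_eq_one_left ?_
  rw [coe_mul_divT, mul_comm, cscT_mul_sinSeries hc, divT, PowerSeries.coe_X,
    HahnSeries.single_mul_single]
  simp

theorem cscSeries_of_ne_zero {c d : ℝ} (hd : Real.sin d ≠ 0) :
    cscSeries c d = ((sinSeries c d)⁻¹ : PowerSeries ℝ) := by
  rw [cscSeries, inv_eq_iff_eq_inv]
  refine eq_inv_of_mul_eq_one_left ?_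
  rw [← PowerSeries.coe_mul, PowerSeries.mul_inv_cancel, PowerSeries.coe_one]
  rw [(Represents.sinSeries c d).apply_zero.symm]
  simpa

theorem map_divT (k : PowerSeries ℝ) :
    (HahnSeries.map (divT k) (C : ℝ →+* ℝ[X]) : LaurentSeries ℝ[X]) =
      divT (k.map (C : ℝ →+* ℝ[X])) := by
  ext i
  rw [HahnSeries.map_coeff, coeff_divT, coeff_divT]
  split_ifs <;> simp

theorem laurentPoly_divT (k : PowerSeries ℝ) (h : PowerSeries ℝ[X]) (m : ℤ) :
    laurentPoly (divT k) h m = if m + 1 < 0 then 0 else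
      C (m.toNat.factorial : ℝ) *
        PowerSeries.coeff (m + 1).toNat (k.map (C : ℝ →+* ℝ[X]) * h) := by
  rw [laurentPoly, map_divT, divT_mul_coe, coeff_divT]
  split_ifs <;> simp

theorem eval_coeff (k : PowerSeries ℝ) (h : PowerSeries ℝ[X]) (n : ℕ) (x : ℝ) :
    (PowerSeries.coeff n (k.map (C : ℝ →+* ℝ[X]) * h)).eval x =
      PowerSeries.coeff n (k * h.map (evalRingHom x)) := by
  have : k * h.map (evalRingHom x) = (k.map (C : ℝ →+* ℝ[X]) * h).map (evalRingHom x) := by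
    rw [map_mul]
    congr 1
    ext i
    simp
  rw [this, PowerSeries.coeff_map, coe_evalRingHom]

theorem eval_laurentPoly_nat (k : PowerSeries ℝ) (h : PowerSeries ℝ[X]) (m : ℕ) (x : ℝ) :
    (laurentPoly (divT k) h m).eval x =
      m.factorial * PowerSeries.coeff (m + 1) (k * h.map (evalRingHom x)) := by
  rw [laurentPoly_divT, if_neg (by omega), eval_mul, eval_C, eval_coeff, Int.toNat_natCast]
  rfl

theorem eval_laurentPoly_pred (k : PowerSeries ℝ) (h : PowerSeries ℝ[X]) (n : ℕ) (x : ℝ) :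
    (laurentPoly (divT k) h ((n : ℤ) - 1)).eval x =
      (n - 1).factorial * PowerSeries.coeff n (k * h.map (evalRingHom x)) := by
  rw [laurentPoly_divT, if_neg (by omega), eval_mul, eval_C, eval_coeff]
  congr 2
  · congr 2
    omega
  · congr 1
    omega

theorem hasExpansion_laurentPoly {Φ : ℝ → ℝ → ℝ} {k : PowerSeries ℝ} {h : PowerSeries ℝ[X]}
    {F : ℝ → ℝ → ℝ} (hr : ∀ x, Represents (k * h.map (evalRingHom x)) (F x))
    (hF : ∀ x T, T ≠ 0 → F x T / T = Φ x T) : HasExpansion Φ (laurentPoly (divT k) h) := by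
  intro x
  filter_upwards [nhdsWithin_le_nhds (hr x), self_mem_nhdsWithin] with T hT hT0
  rw [← hF x T hT0]
  refine hasSum_of_eq (fun n => ?_) (hT.div_const T)
  rw [eval_laurentPoly_pred, zpow_sub_one₀ hT0, zpow_natCast]
  have := Nat.factorial_ne_zero (n - 1)
  field_simp

theorem map_expXT (x : ℝ) :
    expXT.map (evalRingHom x) = PowerSeries.rescale x (PowerSeries.exp ℝ) := by
  ext n
  simp [expXT, PowerSeries.coeff_rescale, PowerSeries.coeff_exp]
  ring

theorem map_sinhXT_add_map_coshXT (x : ℝ) :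
    sinhXT.map (evalRingHom x) + coshXT.map (evalRingHom x) =
      PowerSeries.rescale x (PowerSeries.exp ℝ) := by
  rw [← map_expXT, ← map_add]
  congr 1
  ext1 n
  rw [map_add, sinhXT, coshXT, expXT]
  simp only [PowerSeries.coeff_mk]
  by_cases h : Even n
  · simp [h]
  · simp [h, Nat.not_even_iff_odd.1 h]

theorem rescale_neg_one_map_sinhXT (x : ℝ) :
    PowerSeries.rescale (-1) (sinhXT.map (evalRingHom x)) = -sinhXT.map (evalRingHom x) := by
  ext n
  rw [PowerSeries.coeff_rescale, map_neg, PowerSeries.coeff_map, sinhXT, PowerSeries.coeff_mk]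
  split_ifs with h
  · simp [h.neg_one_pow]
  · simp

theorem rescale_neg_one_map_coshXT (x : ℝ) :
    PowerSeries.rescale (-1) (coshXT.map (evalRingHom x)) = coshXT.map (evalRingHom x) := by
  ext n
  rw [PowerSeries.coeff_rescale, PowerSeries.coeff_map, coshXT, PowerSeries.coeff_mk]
  split_ifs with h
  · simp [h.neg_one_pow]
  · simp

theorem Represents.expXT (x : ℝ) :
    Represents (expXT.map (evalRingHom x)) (fun T => Real.exp (x * T)) := by
  rw [map_expXT]
  exact Represents.exp.rescale x

theorem rescale_neg_exp (x : ℝ) : PowerSeries.rescale (-x) (PowerSeries.exp ℝ) =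
    coshXT.map (evalRingHom x) - sinhXT.map (evalRingHom x) := by
  rw [← mul_neg_one, ← PowerSeries.rescale_rescale, ← map_sinhXT_add_map_coshXT, map_add,
    rescale_neg_one_map_coshXT, rescale_neg_one_map_sinhXT]
  ring

theorem Represents.sinhXT (x : ℝ) :
    Represents (sinhXT.map (evalRingHom x)) (fun T => Real.sinh (x * T)) := by
  have h := (const (1 / 2)).mul ((exp.rescale x).sub (exp.rescale (-x)))
  have e : LogIntegrals.sinhXT.map (evalRingHom x) = PowerSeries.C (1 / 2) *
      (PowerSeries.rescale x (PowerSeries.exp ℝ) -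
        PowerSeries.rescale (-x) (PowerSeries.exp ℝ)) := by
    rw [rescale_neg_exp, ← map_sinhXT_add_map_coshXT]
    ext n
    simp only [map_sub, map_add, PowerSeries.coeff_C_mul]
    ring
  rw [e]
  refine h.congr (Eventually.of_forall fun T => ?_)
  simp only [Real.sinh_eq, neg_mul]
  ring

theorem Represents.coshXT (x : ℝ) :
    Represents (coshXT.map (evalRingHom x)) (fun T => Real.cosh (x * T)) := by
  have h := (const (1 / 2)).mul ((exp.rescale x).add (exp.rescale (-x)))
  have e : LogIntegrals.coshXT.map (evalRingHom x) = PowerSeries.C (1 / 2) *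
      (PowerSeries.rescale x (PowerSeries.exp ℝ) +
        PowerSeries.rescale (-x) (PowerSeries.exp ℝ)) := by
    rw [rescale_neg_exp, ← map_sinhXT_add_map_coshXT]
    ext n
    simp only [map_sub, map_add, PowerSeries.coeff_C_mul]
    ring
  rw [e]
  refine h.congr (Eventually.of_forall fun T => ?_)
  simp only [Real.cosh_eq, neg_mul]
  ring

/-! ### Parity -/

theorem coeff_eq_zero_of_even {p : PowerSeries ℝ} (hp : PowerSeries.rescale (-1) p = p) {n : ℕ}
    (hn : Odd n) : PowerSeries.coeff n p = 0 := by
  have := congrArg (PowerSeries.coeff n) hp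
  rw [PowerSeries.coeff_rescale, hn.neg_one_pow] at this
  linarith

theorem coeff_eq_zero_of_odd {p : PowerSeries ℝ} (hp : PowerSeries.rescale (-1) p = -p) {n : ℕ}
    (hn : Even n) : PowerSeries.coeff n p = 0 := by
  have := congrArg (PowerSeries.coeff n) hp
  rw [PowerSeries.coeff_rescale, hn.neg_one_pow, map_neg] at this
  linarith

section Parity

variable {e o : PowerSeries ℝ} (x : ℝ) {n : ℕ}

theorem coeff_add_mul_sinh_of_odd (he : PowerSeries.rescale (-1) e = e)
    (ho : PowerSeries.rescale (-1) o = -o) (hn : Odd n) :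
    PowerSeries.coeff n ((e + o) * sinhXT.map (evalRingHom x)) =
      PowerSeries.coeff n (e * PowerSeries.rescale x (PowerSeries.exp ℝ)) := by
  have h1 := coeff_eq_zero_of_even (p := o * sinhXT.map (evalRingHom x))
    (by rw [map_mul, ho, rescale_neg_one_map_sinhXT, neg_mul_neg]) hn
  have h2 := coeff_eq_zero_of_even (p := e * coshXT.map (evalRingHom x))
    (by rw [map_mul, he, rescale_neg_one_map_coshXT]) hn
  rw [← map_sinhXT_add_map_coshXT, add_mul, mul_add, map_add, map_add, h1, h2]

theorem coeff_add_mul_cosh_of_odd (he : PowerSeries.rescale (-1) e = e)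
    (ho : PowerSeries.rescale (-1) o = -o) (hn : Odd n) :
    PowerSeries.coeff n ((e + o) * coshXT.map (evalRingHom x)) =
      PowerSeries.coeff n (o * PowerSeries.rescale x (PowerSeries.exp ℝ)) := by
  have h1 := coeff_eq_zero_of_even (p := o * sinhXT.map (evalRingHom x))
    (by rw [map_mul, ho, rescale_neg_one_map_sinhXT, neg_mul_neg]) hn
  have h2 := coeff_eq_zero_of_even (p := e * coshXT.map (evalRingHom x))
    (by rw [map_mul, he, rescale_neg_one_map_coshXT]) hn
  rw [← map_sinhXT_add_map_coshXT, add_mul, mul_add, map_add, map_add, h1, h2]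

theorem coeff_add_mul_sinh_of_even (he : PowerSeries.rescale (-1) e = e)
    (ho : PowerSeries.rescale (-1) o = -o) (hn : Even n) :
    PowerSeries.coeff n ((e + o) * sinhXT.map (evalRingHom x)) =
      PowerSeries.coeff n (o * PowerSeries.rescale x (PowerSeries.exp ℝ)) := by
  have h1 := coeff_eq_zero_of_odd (p := e * sinhXT.map (evalRingHom x))
    (by rw [map_mul, he, rescale_neg_one_map_sinhXT, mul_neg]) hn
  have h2 := coeff_eq_zero_of_odd (p := o * coshXT.map (evalRingHom x))
    (by rw [map_mul, ho, rescale_neg_one_map_coshXT, neg_mul]) hn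
  rw [← map_sinhXT_add_map_coshXT, add_mul, mul_add, map_add, map_add, h1, h2]
  ring

theorem coeff_add_mul_cosh_of_even (he : PowerSeries.rescale (-1) e = e)
    (ho : PowerSeries.rescale (-1) o = -o) (hn : Even n) :
    PowerSeries.coeff n ((e + o) * coshXT.map (evalRingHom x)) =
      PowerSeries.coeff n (e * PowerSeries.rescale x (PowerSeries.exp ℝ)) := by
  have h1 := coeff_eq_zero_of_odd (p := e * sinhXT.map (evalRingHom x))
    (by rw [map_mul, he, rescale_neg_one_map_sinhXT, mul_neg]) hn
  have h2 := coeff_eq_zero_of_odd (p := o * coshXT.map (evalRingHom x))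
    (by rw [map_mul, ho, rescale_neg_one_map_coshXT, neg_mul]) hn
  rw [← map_sinhXT_add_map_coshXT, add_mul, mul_add, map_add, map_add, h1, h2]
  ring

end Parity

theorem rescale_neg_one_sinSeries (c : ℝ) :
    PowerSeries.rescale (-1) (sinSeries c 0) = -sinSeries c 0 := by
  refine ((Represents.sinSeries c 0).rescale (-1)).unique
    ((Represents.sinSeries c 0).neg.congr (Eventually.of_forall fun T => ?_))
  simp

theorem rescale_neg_one_cosSeries (c : ℝ) :
    PowerSeries.rescale (-1) (cosSeries c 0) = cosSeries c 0 := by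
  refine ((Represents.cosSeries c 0).rescale (-1)).unique
    ((Represents.cosSeries c 0).congr (Eventually.of_forall fun T => ?_))
  simp

theorem rescale_neg_one_cscT {c : ℝ} (hc : c ≠ 0) :
    PowerSeries.rescale (-1) (cscT c) = cscT c := by
  have h := congrArg (PowerSeries.rescale (-1)) (cscT_mul_sinSeries hc)
  rw [map_mul, rescale_neg_one_sinSeries, PowerSeries.rescale_X] at h
  refine mul_right_cancel₀ (sinSeries_zero_ne_zero hc) ?_
  rw [cscT_mul_sinSeries hc, ← neg_inj, ← mul_neg, h]
  simp

theorem sinSeries_eq (c d : ℝ) : sinSeries c d =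
    PowerSeries.C (Real.sin d) * cosSeries c 0 + PowerSeries.C (Real.cos d) * sinSeries c 0 := by
  rw [sinSeries_zero, cosSeries_zero, sinSeries]

theorem cosSeries_eq (c d : ℝ) : cosSeries c d =
    PowerSeries.C (Real.cos d) * cosSeries c 0 - PowerSeries.C (Real.sin d) * sinSeries c 0 := by
  rw [sinSeries_zero, cosSeries_zero, cosSeries]

end

end LogIntegrals

namespace LogIntegrals

open Filter Topology

noncomputable section

/-- The value at `x` of the `m`-th coefficient of `T⁻¹ k(T) exp (x T)`. -/
def ev (k : PowerSeries ℝ) (m : ℕ) (x : ℝ) : ℝ :=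
  m.factorial * PowerSeries.coeff (m + 1) (k * PowerSeries.rescale x (PowerSeries.exp ℝ))

/-- `T cos (c T) / sin (d T)`. -/
def cosCsc (c d : ℝ) : PowerSeries ℝ := cscT d * cosSeries c 0

/-- `T sin (c T) / sin (d T)`. -/
def sinCsc (c d : ℝ) : PowerSeries ℝ := cscT d * sinSeries c 0

theorem rescale_neg_one_cosCsc (c : ℝ) {d : ℝ} (hd : d ≠ 0) :
    PowerSeries.rescale (-1) (cosCsc c d) = cosCsc c d := by
  rw [cosCsc, map_mul, rescale_neg_one_cscT hd, rescale_neg_one_cosSeries]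

theorem rescale_neg_one_sinCsc (c : ℝ) {d : ℝ} (hd : d ≠ 0) :
    PowerSeries.rescale (-1) (sinCsc c d) = -sinCsc c d := by
  rw [sinCsc, map_mul, rescale_neg_one_cscT hd, rescale_neg_one_sinSeries, mul_neg]

/-! ### Values of the second family in terms of `ev` -/

section Eval

variable (c : ℝ) {d : ℝ} (α β x : ℝ) {m : ℕ}

theorem rescale_C (a r : ℝ) :
    PowerSeries.rescale a (PowerSeries.C r) = PowerSeries.C r := by
  ext n
  by_cases h : n = 0 <;> simp [PowerSeries.coeff_rescale, PowerSeries.coeff_C, h]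

theorem C_mul_cosCsc_even (hd : d ≠ 0) :
    PowerSeries.rescale (-1) (PowerSeries.C α * cosCsc c d) = PowerSeries.C α * cosCsc c d := by
  rw [map_mul, rescale_neg_one_cosCsc c hd, rescale_C]

theorem C_mul_sinCsc_odd (hd : d ≠ 0) :
    PowerSeries.rescale (-1) (PowerSeries.C β * sinCsc c d) =
      -(PowerSeries.C β * sinCsc c d) := by
  rw [map_mul, rescale_neg_one_sinCsc c hd, rescale_C, mul_neg]

theorem eval_sinh_of_even (hd : d ≠ 0) (hm : Even m) :
    (laurentPoly (divT (PowerSeries.C α * cosCsc c d + PowerSeries.C β * sinCsc c d))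
      sinhXT m).eval x = α * ev (cosCsc c d) m x := by
  rw [eval_laurentPoly_nat, coeff_add_mul_sinh_of_odd x (C_mul_cosCsc_even c α hd)
    (C_mul_sinCsc_odd c β hd) hm.add_one, mul_assoc, PowerSeries.coeff_C_mul, ev]
  ring

theorem eval_cosh_of_even (hd : d ≠ 0) (hm : Even m) :
    (laurentPoly (divT (PowerSeries.C α * cosCsc c d + PowerSeries.C β * sinCsc c d))
      coshXT m).eval x = β * ev (sinCsc c d) m x := by
  rw [eval_laurentPoly_nat, coeff_add_mul_cosh_of_odd x (C_mul_cosCsc_even c α hd)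
    (C_mul_sinCsc_odd c β hd) hm.add_one, mul_assoc, PowerSeries.coeff_C_mul, ev]
  ring

theorem eval_sinh_of_odd (hd : d ≠ 0) (hm : Odd m) :
    (laurentPoly (divT (PowerSeries.C α * cosCsc c d + PowerSeries.C β * sinCsc c d))
      sinhXT m).eval x = β * ev (sinCsc c d) m x := by
  rw [eval_laurentPoly_nat, coeff_add_mul_sinh_of_even x (C_mul_cosCsc_even c α hd)
    (C_mul_sinCsc_odd c β hd) hm.add_one, mul_assoc, PowerSeries.coeff_C_mul, ev]
  ring

theorem eval_cosh_of_odd (hd : d ≠ 0) (hm : Odd m) :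
    (laurentPoly (divT (PowerSeries.C α * cosCsc c d + PowerSeries.C β * sinCsc c d))
      coshXT m).eval x = α * ev (cosCsc c d) m x := by
  rw [eval_laurentPoly_nat, coeff_add_mul_cosh_of_even x (C_mul_cosCsc_even c α hd)
    (C_mul_sinCsc_odd c β hd) hm.add_one, mul_assoc, PowerSeries.coeff_C_mul, ev]
  ring

end Eval

theorem eval_exp (k : PowerSeries ℝ) (m : ℕ) (x : ℝ) :
    (laurentPoly (divT k) expXT m).eval x = ev k m x := by
  rw [eval_laurentPoly_nat, map_expXT, ev]

/-! ### The kernels of the second family -/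

theorem cos_θ : Real.cos θ = -1 / 2 := by
  rw [θ, show 2 * Real.pi / 3 = Real.pi - Real.pi / 3 by ring, Real.cos_pi_sub,
    Real.cos_pi_div_three]
  norm_num

theorem sin_θ : Real.sin θ = √3 / 2 := by
  rw [θ, show 2 * Real.pi / 3 = Real.pi - Real.pi / 3 by ring, Real.sin_pi_sub,
    Real.sin_pi_div_three]

theorem cos_half_θ : Real.cos (θ / 2) = 1 / 2 := by
  rw [θ, show 2 * Real.pi / 3 / 2 = Real.pi / 3 by ring, Real.cos_pi_div_three]

theorem sin_half_θ : Real.sin (θ / 2) = √3 / 2 := by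
  rw [θ, show 2 * Real.pi / 3 / 2 = Real.pi / 3 by ring, Real.sin_pi_div_three]

theorem two_mul_δ : 2 * δ = θ := by
  rw [δ, θ]
  ring

theorem sin_neg_half_θ_ne_zero : Real.sin (-θ / 2) ≠ 0 := by
  rw [neg_div, Real.sin_neg, sin_half_θ]
  simp

theorem kernelK_eq : cscSeries (3 / 2) 0 * (sinSeries (1 / 2) (θ / 2) : LaurentSeries ℝ) =
    divT (PowerSeries.C (√3 / 2) * cosCsc (1 / 2) (3 / 2) +
      PowerSeries.C (1 / 2) * sinCsc (1 / 2) (3 / 2)) := by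
  rw [cscSeries_zero (by norm_num), divT_mul_coe, sinSeries_eq, sin_half_θ, cos_half_θ,
    cosCsc, sinCsc]
  congr 1
  ring

theorem kernelE_eq : cscSeries (3 / 2) 0 * (cosSeries (1 / 2) θ : LaurentSeries ℝ) =
    divT (PowerSeries.C (-1 / 2) * cosCsc (1 / 2) (3 / 2) +
      PowerSeries.C (-(√3 / 2)) * sinCsc (1 / 2) (3 / 2)) := by
  rw [cscSeries_zero (by norm_num), divT_mul_coe, cosSeries_eq, sin_θ, cos_θ,
    cosCsc, sinCsc, map_neg]
  congr 1
  ring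

theorem kernelN_eq : cscSeries 3 0 * (sinSeries 2 (-2 * δ) : LaurentSeries ℝ) =
    divT (PowerSeries.C (-(√3 / 2)) * cosCsc 2 3 + PowerSeries.C (-1 / 2) * sinCsc 2 3) := by
  rw [cscSeries_zero (by norm_num), divT_mul_coe, sinSeries_eq, neg_mul, two_mul_δ, Real.sin_neg,
    Real.cos_neg, sin_θ, cos_θ, cosCsc, sinCsc]
  congr 1
  ring

theorem kernelC_eq : (sinSeries 2 (-θ) : LaurentSeries ℝ) * cscSeries 3 0 =
    divT (PowerSeries.C (-(√3 / 2)) * cosCsc 2 3 + PowerSeries.C (-1 / 2) * sinCsc 2 3) := by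
  rw [← kernelN_eq, neg_mul, two_mul_δ, mul_comm]

theorem kernelU_eq : cscSeries 3 0 * (cosSeries 2 (-2 * δ) : LaurentSeries ℝ) =
    divT (PowerSeries.C (-1 / 2) * cosCsc 2 3 + PowerSeries.C (√3 / 2) * sinCsc 2 3) := by
  rw [cscSeries_zero (by norm_num), divT_mul_coe, cosSeries_eq, neg_mul, two_mul_δ, Real.sin_neg,
    Real.cos_neg, sin_θ, cos_θ, cosCsc, sinCsc, map_neg]
  congr 1
  ring

theorem kernelG_eq :
    (cosSeries (3 / 2) 0 : LaurentSeries ℝ) * cscSeries (3 / 2) 0 =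
      divT (cosCsc (3 / 2) (3 / 2)) := by
  rw [cscSeries_zero (by norm_num), coe_mul_divT, mul_comm, cosCsc]

theorem kernelA_eq' : cscSeries (1 / 2) (-θ / 2) * cscSeries (1 / 2) 0 =
    divT ((sinSeries (1 / 2) (-θ / 2))⁻¹ * cscT (1 / 2)) := by
  rw [cscSeries_of_ne_zero sin_neg_half_θ_ne_zero, cscSeries_zero (by norm_num), coe_mul_divT]

/-- `sin (3 y) = 4 sin y sin (π/3 - y) sin (π/3 + y)`. -/
theorem sin_three_mul_eq (y : ℝ) : Real.sin (3 * y) =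
    -4 * Real.sin (y + θ / 2) * (Real.sin (y - θ / 2) * Real.sin y) := by
  rw [Real.sin_three_mul, Real.sin_add, Real.sin_sub, sin_half_θ, cos_half_θ]
  have h3 : √3 ^ 2 = 3 := Real.sq_sqrt (by norm_num)
  have hc := Real.sin_sq_add_cos_sq y
  linear_combination (-3 * Real.sin y) * hc + (-Real.sin y * Real.cos y ^ 2) * h3

theorem eventually_sin_ne_zero {c : ℝ} (hc : c ≠ 0) :
    ∀ᶠ T in 𝓝[≠] (0 : ℝ), Real.sin (c * T) ≠ 0 := by
  have h : HasDerivAt (fun T => Real.sin (c * T)) c 0 := by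
    simpa using ((hasDerivAt_id (0 : ℝ)).const_mul c).sin
  simpa using h.eventually_ne hc (c := 0)

theorem kernelA_series_eq : (sinSeries (1 / 2) (-θ / 2))⁻¹ * cscT (1 / 2) =
    PowerSeries.C (-2 * √3) * cosCsc (1 / 2) (3 / 2) +
      PowerSeries.C (-2) * sinCsc (1 / 2) (3 / 2) := by
  have e : PowerSeries.C (-2 * √3) * cosCsc (1 / 2) (3 / 2) +
      PowerSeries.C (-2) * sinCsc (1 / 2) (3 / 2) =
      PowerSeries.C (-4) * (cscT (3 / 2) * sinSeries (1 / 2) (θ / 2)) := by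
    rw [sinSeries_eq _ (θ / 2), sin_half_θ, cos_half_θ, cosCsc, sinCsc,
      show (-2 * √3 : ℝ) = -4 * (√3 / 2) by ring, show (-2 : ℝ) = -4 * (1 / 2) by norm_num,
      map_mul, map_mul]
    ring
  rw [e]
  refine (((Represents.sinSeries (1 / 2) (-θ / 2)).inv ?_).mul
    (Represents.cscT (c := 1 / 2) (by norm_num))).eq_of_eventually_punctured
    ((Represents.const (-4)).mul ((Represents.cscT (c := 3 / 2) (by norm_num)).mul
      (Represents.sinSeries (1 / 2) (θ / 2)))) ?_
  · rw [← (Represents.sinSeries (1 / 2) (-θ / 2)).apply_zero]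
    simpa using sin_neg_half_θ_ne_zero
  · filter_upwards [eventually_sin_ne_zero (c := 3 / 2) (by norm_num), self_mem_nhdsWithin]
      with T h1 (h0 : T ≠ 0)
    have h := sin_three_mul_eq (1 / 2 * T)
    rw [show 3 * (1 / 2 * T) = 3 / 2 * T by ring] at h
    rw [if_neg h0, if_neg h0, h, show 1 / 2 * T + -θ / 2 = 1 / 2 * T - θ / 2 by ring]
    rw [h] at h1
    generalize Real.sin (1 / 2 * T - θ / 2) = u at *
    generalize Real.sin (1 / 2 * T) = v at *
    generalize Real.sin (1 / 2 * T + θ / 2) = w at *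
    simp only [ne_eq, mul_eq_zero, not_or] at h1
    obtain ⟨⟨-, h2⟩, h3, h4⟩ := h1
    field_simp

theorem kernelA_eq : cscSeries (1 / 2) (-θ / 2) * cscSeries (1 / 2) 0 =
    divT (PowerSeries.C (-2 * √3) * cosCsc (1 / 2) (3 / 2) +
      PowerSeries.C (-2) * sinCsc (1 / 2) (3 / 2)) := by
  rw [kernelA_eq', kernelA_series_eq]

/-! ### Expansions -/

theorem hasExpansion_polyA : HasExpansion
    (fun x T => csc (T / 2 - θ / 2) * csc (T / 2) * Real.sinh (x * T)) polyA := by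
  rw [polyA, kernelA_eq']
  refine hasExpansion_laurentPoly (fun x => (((Represents.sinSeries (1 / 2) (-θ / 2)).inv ?_).mul
    (Represents.cscT (c := 1 / 2) (by norm_num))).mul (Represents.sinhXT x)) fun x T hT => ?_
  · rw [← (Represents.sinSeries (1 / 2) (-θ / 2)).apply_zero]
    simpa using sin_neg_half_θ_ne_zero
  · rw [if_neg hT, csc, csc]
    field_simp
    ring_nf

theorem hasExpansion_polyB : HasExpansion
    (fun x T => csc (T / 2 - θ / 2) * csc (T / 2) * Real.cosh (x * T)) polyB := by
  rw [polyB, kernelA_eq']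
  refine hasExpansion_laurentPoly (fun x => (((Represents.sinSeries (1 / 2) (-θ / 2)).inv ?_).mul
    (Represents.cscT (c := 1 / 2) (by norm_num))).mul (Represents.coshXT x)) fun x T hT => ?_
  · rw [← (Represents.sinSeries (1 / 2) (-θ / 2)).apply_zero]
    simpa using sin_neg_half_θ_ne_zero
  · rw [if_neg hT, csc, csc]
    field_simp
    ring_nf

/-- Expansion of `φ(T) csc (c T) η(x T)`, from expansions of `φ` and `η`. -/
theorem hasExpansion_csc {c : ℝ} (hc : c ≠ 0) {p : PowerSeries ℝ} {φ : ℝ → ℝ}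
    (hp : Represents p φ) {h : PowerSeries ℝ[X]} {η : ℝ → ℝ}
    (hh : ∀ x, Represents (h.map (evalRingHom x)) (fun T => η (x * T))) :
    HasExpansion (fun x T => csc (c * T) * φ T * η (x * T))
      (laurentPoly (cscSeries c 0 * p) h) := by
  rw [cscSeries_zero hc, divT_mul_coe]
  refine hasExpansion_laurentPoly (fun x => ((Represents.cscT hc).mul hp).mul (hh x))
    fun x T hT => ?_
  rw [if_neg hT, csc]
  field_simp

theorem HasExpansion.congr {Φ Ψ : ℝ → ℝ → ℝ} {c : ℤ → ℝ[X]} (h : HasExpansion Φ c)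
    (e : ∀ x T, Φ x T = Ψ x T) : HasExpansion Ψ c := by
  rwa [show Ψ = Φ from funext fun x => funext fun T => (e x T).symm]

theorem hasExpansion_polyC : HasExpansion
    (fun x T => Real.sin (2 * T - θ) * csc (3 * T) * Real.sinh (x * T)) polyC := by
  rw [polyC, mul_comm]
  refine (hasExpansion_csc (by norm_num) (Represents.sinSeries 2 (-θ)) Represents.sinhXT).congr
    fun x T => ?_
  ring_nf

theorem hasExpansion_polyD : HasExpansion
    (fun x T => Real.sin (2 * T - θ) * csc (3 * T) * Real.cosh (x * T)) polyD := by
  rw [polyD, mul_comm]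
  refine (hasExpansion_csc (by norm_num) (Represents.sinSeries 2 (-θ)) Represents.coshXT).congr
    fun x T => ?_
  ring_nf

theorem hasExpansion_polyE : HasExpansion
    (fun x T => csc (3 * T / 2) * Real.cos (T / 2 + θ) * Real.sinh (x * T)) polyE := by
  refine (hasExpansion_csc (by norm_num) (Represents.cosSeries (1 / 2) θ)
    Represents.sinhXT).congr fun x T => ?_
  ring_nf

theorem hasExpansion_polyF : HasExpansion
    (fun x T => csc (3 * T / 2) * Real.cos (T / 2 + θ) * Real.cosh (x * T)) polyF := by
  refine (hasExpansion_csc (by norm_num) (Represents.cosSeries (1 / 2) θ)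
    Represents.coshXT).congr fun x T => ?_
  ring_nf

theorem hasExpansion_polyG : HasExpansion
    (fun x T => Real.cot (3 * T / 2) * Real.exp (x * T)) polyG := by
  rw [polyG, mul_comm]
  refine (hasExpansion_csc (by norm_num) (Represents.cosSeries (3 / 2) 0)
    Represents.expXT).congr fun x T => ?_
  rw [csc, Real.cot_eq_cos_div_sin, add_zero, show 3 / 2 * T = 3 * T / 2 by ring]
  ring

theorem hasExpansion_polyK : HasExpansion
    (fun x T => csc (3 * T / 2) * Real.sin (T / 2 + θ / 2) * Real.sinh (x * T)) polyK := by
  refine (hasExpansion_csc (by norm_num) (Represents.sinSeries (1 / 2) (θ / 2))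
    Represents.sinhXT).congr fun x T => ?_
  ring_nf

theorem hasExpansion_polyL : HasExpansion
    (fun x T => csc (3 * T / 2) * Real.sin (T / 2 + θ / 2) * Real.cosh (x * T)) polyL := by
  refine (hasExpansion_csc (by norm_num) (Represents.sinSeries (1 / 2) (θ / 2))
    Represents.coshXT).congr fun x T => ?_
  ring_nf

theorem hasExpansion_polyU : HasExpansion
    (fun x T => csc (3 * T) * Real.cos (2 * T - 2 * δ) * Real.sinh (x * T)) polyU := by
  refine (hasExpansion_csc (by norm_num) (Represents.cosSeries 2 (-2 * δ))
    Represents.sinhXT).congr fun x T => ?_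
  ring_nf

theorem hasExpansion_polyV : HasExpansion
    (fun x T => csc (3 * T) * Real.cos (2 * T - 2 * δ) * Real.cosh (x * T)) polyV := by
  refine (hasExpansion_csc (by norm_num) (Represents.cosSeries 2 (-2 * δ))
    Represents.coshXT).congr fun x T => ?_
  ring_nf

theorem hasExpansion_polyW : HasExpansion
    (fun x T => csc (3 * T) * Real.exp (x * T)) polyW := by
  rw [polyW, ← mul_one (cscSeries 3 0), ← PowerSeries.coe_one]
  refine (hasExpansion_csc (by norm_num) Represents.one Represents.expXT).congr fun x T => ?_
  ring_nf

theorem hasExpansion_polyN : HasExpansion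
    (fun x T => csc (3 * T) * Real.sin (2 * T - 2 * δ) * Real.sinh (x * T)) polyN := by
  refine (hasExpansion_csc (by norm_num) (Represents.sinSeries 2 (-2 * δ))
    Represents.sinhXT).congr fun x T => ?_
  ring_nf

theorem hasExpansion_polyO : HasExpansion
    (fun x T => csc (3 * T) * Real.sin (2 * T - 2 * δ) * Real.cosh (x * T)) polyO := by
  refine (hasExpansion_csc (by norm_num) (Represents.sinSeries 2 (-2 * δ))
    Represents.coshXT).congr fun x T => ?_
  ring_nf

end

end LogIntegrals

namespace LogIntegrals

open Filter Topology

noncomputable section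

/-! ### Exponential generating functions of the first family -/

theorem coeff_sinSeries (c : ℝ) (n : ℕ) : PowerSeries.coeff n (sinSeries c 0) =
    if Odd n then (-1) ^ (n / 2) * c ^ n / n.factorial else 0 := by
  rw [sinSeries_zero, PowerSeries.coeff_rescale, PowerSeries.sin, PowerSeries.coeff_mk]
  by_cases h : Even n
  · simp [h]
  · simp only [h, Nat.not_even_iff_odd.1 h, if_true, if_false]
    simp
    ring

theorem coeff_cosSeries (c : ℝ) (n : ℕ) : PowerSeries.coeff n (cosSeries c 0) =
    if Even n then (-1) ^ (n / 2) * c ^ n / n.factorial else 0 := by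
  rw [cosSeries_zero, PowerSeries.coeff_rescale, PowerSeries.cos, PowerSeries.coeff_mk]
  by_cases h : Even n
  · simp [h]
    ring
  · simp [h]

/-- Coefficients of a product of two exponential generating functions, the first of which has
coefficients supported on `r`. -/
theorem coeff_mul_egf (r : ℕ → Prop) [DecidablePred r] (u v : ℕ → ℝ) (n : ℕ) :
    PowerSeries.coeff n ((PowerSeries.mk fun j => if r j then u j / j.factorial else 0) *
      (PowerSeries.mk fun j => v j / j.factorial)) =
    (∑ j ∈ (Finset.Icc 0 n).filter r, u j * n.choose j * v (n - j)) / n.factorial := by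
  rw [PowerSeries.coeff_mul, Finset.Nat.sum_antidiagonal_eq_sum_range_succ_mk, Finset.sum_filter,
    Finset.sum_div, ← Nat.range_succ_eq_Icc_zero]
  refine Finset.sum_congr rfl fun j hj => ?_
  simp only [PowerSeries.coeff_mk]
  split_ifs
  · rw [Nat.cast_choose ℝ (Nat.lt_succ_iff.1 (Finset.mem_range.1 hj))]
    have h1 := Nat.factorial_ne_zero j
    have h2 := Nat.factorial_ne_zero n
    have h3 := Nat.factorial_ne_zero (n - j)
    field_simp
  · simp

theorem sinSeries_eq_mk (c : ℝ) : sinSeries c 0 =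
    PowerSeries.mk fun j => if Odd j then (-1) ^ (j / 2) * c ^ j / j.factorial else 0 := by
  ext n
  rw [coeff_sinSeries, PowerSeries.coeff_mk]

theorem cosSeries_eq_mk (c : ℝ) : cosSeries c 0 =
    PowerSeries.mk fun j => if Even j then (-1) ^ (j / 2) * c ^ j / j.factorial else 0 := by
  ext n
  rw [coeff_cosSeries, PowerSeries.coeff_mk]

theorem rescale_exp_eq_mk (x : ℝ) : PowerSeries.rescale x (PowerSeries.exp ℝ) =
    PowerSeries.mk fun j => x ^ j / j.factorial := by
  ext n
  simp [PowerSeries.coeff_rescale, PowerSeries.coeff_exp]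
  ring

theorem coeff_cos_mul_exp (c x : ℝ) (n : ℕ) :
    PowerSeries.coeff n (cosSeries c 0 * PowerSeries.rescale x (PowerSeries.exp ℝ)) =
      (∑ j ∈ (Finset.Icc 0 n).filter Even, (-1) ^ (j / 2) * c ^ j * n.choose j * x ^ (n - j)) /
        n.factorial := by
  rw [cosSeries_eq_mk, rescale_exp_eq_mk,
    coeff_mul_egf Even (fun j => (-1) ^ (j / 2) * c ^ j) (fun j => x ^ j)]

theorem filter_odd_Icc_zero (n : ℕ) :
    (Finset.Icc 0 n).filter Odd = (Finset.Icc 1 n).filter Odd := by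
  ext j
  simp only [Finset.mem_filter, Finset.mem_Icc]
  constructor
  · rintro ⟨⟨-, h⟩, h'⟩
    exact ⟨⟨h'.pos, h⟩, h'⟩
  · rintro ⟨⟨-, h⟩, h'⟩
    exact ⟨⟨Nat.zero_le _, h⟩, h'⟩

theorem coeff_sin_mul_exp (c x : ℝ) (n : ℕ) :
    PowerSeries.coeff n (sinSeries c 0 * PowerSeries.rescale x (PowerSeries.exp ℝ)) =
      (∑ j ∈ (Finset.Icc 1 n).filter Odd, (-1) ^ (j / 2) * c ^ j * n.choose j * x ^ (n - j)) /
        n.factorial := by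
  rw [sinSeries_eq_mk, rescale_exp_eq_mk,
    coeff_mul_egf Odd (fun j => (-1) ^ (j / 2) * c ^ j) (fun j => x ^ j), filter_odd_Icc_zero]

/-- The exponential generating function of the values at `x` of a sequence of polynomials. -/
def egf (H : ℕ → ℚ[X]) (x : ℝ) : PowerSeries ℝ :=
  PowerSeries.mk fun k => aeval x (H k) / k.factorial

theorem egf_recPoly (q : ℚ) (h : ℕ → ℚ[X]) (x : ℝ) :
    egf (recPoly q h) x * sinSeries q 0 =
      PowerSeries.C (q : ℝ) * (PowerSeries.X * egf h x) := by
  ext n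
  rw [mul_comm, sinSeries_eq_mk, egf, coeff_mul_egf Odd (fun j => (-1) ^ (j / 2) * (q : ℝ) ^ j)
    (fun k => aeval x (recPoly q h k)), PowerSeries.coeff_C_mul, filter_odd_Icc_zero]
  cases n with
  | zero => simp
  | succ k =>
    have e : (Finset.Icc 1 (k + 1)).filter Odd =
        insert 1 ((Finset.Icc 2 (k + 1)).filter Odd) := by
      ext j
      simp only [Finset.mem_filter, Finset.mem_Icc, Finset.mem_insert]
      constructor
      · rintro ⟨⟨h1, h2⟩, h3⟩
        by_cases h : j = 1
        · exact Or.inl h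
        · exact Or.inr ⟨⟨by omega, h2⟩, h3⟩
      · rintro (rfl | ⟨⟨h1, h2⟩, h3⟩)
        · simp
        · exact ⟨⟨by omega, h2⟩, h3⟩
    rw [e, Finset.sum_insert (by simp), PowerSeries.coeff_succ_X_mul, egf, PowerSeries.coeff_mk]
    have hk : ((k : ℝ) + 1) ≠ 0 := by positivity
    have hrec := congrArg (aeval x) (recPoly_eq q h k)
    simp only [map_add, map_mul, map_sum, aeval_C, eq_ratCast, Rat.cast_pow,
      Rat.cast_neg, Rat.cast_one, Rat.cast_natCast, Rat.cast_div, Rat.cast_add] at hrec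
    have hs : ∑ j ∈ (Finset.Icc 2 (k + 1)).filter Odd,
        (-1) ^ (j / 2) * (q : ℝ) ^ j * ((k + 1).choose j) * aeval x (recPoly q h (k + 1 - j)) =
        -q * ∑ j ∈ (Finset.Icc 2 (k + 1)).filter Odd, (-1) ^ ((j + 1) / 2) *
          ((k + 1).choose j) * (q : ℝ) ^ (j - 1) * aeval x (recPoly q h (k + 1 - j)) := by
      rw [Finset.mul_sum]
      refine Finset.sum_congr rfl fun j hj => ?_
      obtain ⟨hj1, i, rfl⟩ := Finset.mem_filter.1 hj
      rw [show (2 * i + 1) / 2 = i by omega, show (2 * i + 1 + 1) / 2 = i + 1 by omega,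
        show 2 * i + 1 - 1 = 2 * i by omega]
      ring
    rw [hs, Nat.factorial_succ]
    simp only [Nat.choose_one_right, Nat.add_sub_cancel]
    rw [hrec]
    push_cast
    have := Nat.factorial_ne_zero k
    field_simp
    ring

theorem aeval_eq_of_X_mul_egf {H : ℕ → ℚ[X]} {x : ℝ} {p : PowerSeries ℝ}
    (h : PowerSeries.X * egf H x = p) (m : ℕ) :
    aeval x (H m) = m.factorial * PowerSeries.coeff (m + 1) p := by
  rw [← h, PowerSeries.coeff_succ_X_mul, egf, PowerSeries.coeff_mk]
  have := Nat.factorial_ne_zero m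
  field_simp

/-! ### Product formulas -/

theorem sinSeries_two_mul (c : ℝ) :
    sinSeries (2 * c) 0 = PowerSeries.C 2 * sinSeries c 0 * cosSeries c 0 := by
  refine (Represents.sinSeries _ _).unique ((((Represents.const 2).mul
    (Represents.sinSeries c 0)).mul (Represents.cosSeries c 0)).congr
      (Eventually.of_forall fun T => ?_))
  simp only [add_zero]
  rw [mul_assoc 2 c T, Real.sin_two_mul]

theorem cosSeries_mul_cosSeries (c d : ℝ) :
    PowerSeries.C 2 * cosSeries c 0 * cosSeries d 0 =
      cosSeries (c + d) 0 + cosSeries (c - d) 0 := by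
  refine ((((Represents.const 2).mul (Represents.cosSeries c 0)).mul
    (Represents.cosSeries d 0))).unique (((Represents.cosSeries _ 0).add
      (Represents.cosSeries _ 0)).congr (Eventually.of_forall fun T => ?_))
  simp only [add_zero, add_mul, sub_mul, Real.cos_add, Real.cos_sub]
  ring

theorem cosSeries_mul_sinSeries (c d : ℝ) :
    PowerSeries.C 2 * cosSeries c 0 * sinSeries d 0 =
      sinSeries (c + d) 0 - sinSeries (c - d) 0 := by
  refine ((((Represents.const 2).mul (Represents.cosSeries c 0)).mul
    (Represents.sinSeries d 0))).unique (((Represents.sinSeries _ 0).sub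
      (Represents.sinSeries _ 0)).congr (Eventually.of_forall fun T => ?_))
  simp only [add_zero, add_mul, sub_mul, Real.sin_add, Real.sin_sub]
  ring

theorem cosSeries_zero_zero : cosSeries 0 0 = 1 :=
  (Represents.cosSeries 0 0).unique (Represents.one.congr (Eventually.of_forall fun T => by simp))

theorem cosCsc_mul (c : ℝ) {d : ℝ} (hd : d ≠ 0) : cosCsc c d * sinSeries (2 * d) 0 =
    PowerSeries.X * (cosSeries (d + c) 0 + cosSeries (d - c) 0) := by
  rw [← cosSeries_mul_cosSeries, sinSeries_two_mul, cosCsc, ← cscT_mul_sinSeries hd]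
  ring

theorem sinCsc_mul (c : ℝ) {d : ℝ} (hd : d ≠ 0) : sinCsc c d * sinSeries (2 * d) 0 =
    PowerSeries.X * (sinSeries (d + c) 0 - sinSeries (d - c) 0) := by
  rw [← cosSeries_mul_sinSeries, sinSeries_two_mul, sinCsc, ← cscT_mul_sinSeries hd]
  ring

/-! ### Values of the first family in terms of `ev` -/

/-- Solving the generating function equation of a recursive family. -/
theorem aeval_recPoly {d : ℚ} (hd : d ≠ 0) (h : ℕ → ℚ[X]) (x α κ : ℝ) {k g : PowerSeries ℝ}
    (hk : k * sinSeries (2 * d) 0 = PowerSeries.X * g)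
    (hh : PowerSeries.X * egf h x =
      PowerSeries.C α * (g * PowerSeries.rescale x (PowerSeries.exp ℝ)) - PowerSeries.C κ) (m : ℕ) :
    aeval x (recPoly (2 * d) h m) =
      2 * d * α * ev k m x - 2 * d * κ * (m.factorial * PowerSeries.coeff (m + 1) (cscT (2 * d))) := by
  have hd' : (2 * d : ℝ) ≠ 0 := by simpa using hd
  have hX : PowerSeries.X * egf (recPoly (2 * d) h) x =
      PowerSeries.C (2 * d * α) * (k * PowerSeries.rescale x (PowerSeries.exp ℝ)) -
        PowerSeries.C (2 * d * κ) * cscT (2 * d) := by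
    refine mul_right_cancel₀ (sinSeries_zero_ne_zero hd') ?_
    have h1 := egf_recPoly (2 * d) h x
    push_cast at h1
    rw [mul_assoc, h1, hh, sub_mul, mul_assoc _ (cscT _), cscT_mul_sinSeries hd',
      map_mul _ (2 * d : ℝ) α, map_mul _ (2 * d : ℝ) κ]
    linear_combination (-PowerSeries.C (2 * d : ℝ) * PowerSeries.C α *
      PowerSeries.rescale x (PowerSeries.exp ℝ)) * hk
  rw [aeval_eq_of_X_mul_egf hX, map_sub, PowerSeries.coeff_C_mul, PowerSeries.coeff_C_mul, ev]
  ring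

theorem X_mul_egf_eq {h : ℕ → ℚ[X]} {x : ℝ} {p : PowerSeries ℝ}
    (h0 : PowerSeries.constantCoeff p = 0)
    (hs : ∀ k, aeval x (h k) = k.factorial * PowerSeries.coeff (k + 1) p) :
    PowerSeries.X * egf h x = p := by
  ext n
  cases n with
  | zero => simpa using h0.symm
  | succ k =>
    rw [PowerSeries.coeff_succ_X_mul, egf, PowerSeries.coeff_mk, hs]
    have := Nat.factorial_ne_zero k
    field_simp

theorem constantCoeff_cosSeries (c : ℝ) : PowerSeries.constantCoeff (cosSeries c 0) = 1 := by
  simpa using (Represents.cosSeries c 0).apply_zero.symm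

theorem constantCoeff_sinSeries (c : ℝ) : PowerSeries.constantCoeff (sinSeries c 0) = 0 := by
  simpa using (Represents.sinSeries c 0).apply_zero.symm

theorem constantCoeff_rescale_exp (x : ℝ) :
    PowerSeries.constantCoeff (PowerSeries.rescale x (PowerSeries.exp ℝ)) = 1 := by
  simpa using (Represents.exp.rescale x).apply_zero.symm

theorem aeval_even_sum (c : ℚ) (n : ℕ) (x : ℝ) :
    aeval x (∑ j ∈ (Finset.Icc 0 n).filter Even,
      C ((-1) ^ (j / 2) * (n.choose j : ℚ) * c ^ j) * X ^ (n - j)) = n.factorial *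
    PowerSeries.coeff n (cosSeries c 0 * PowerSeries.rescale x (PowerSeries.exp ℝ)) := by
  rw [coeff_cos_mul_exp, mul_div_cancel₀ _ (Nat.cast_ne_zero.2 (Nat.factorial_ne_zero n)), map_sum]
  refine Finset.sum_congr rfl fun j _ => ?_
  simp only [map_mul, map_pow, aeval_C, aeval_X, eq_ratCast]
  push_cast
  ring

theorem aeval_odd_sum (c : ℚ) (n : ℕ) (x : ℝ) :
    aeval x (∑ j ∈ (Finset.Icc 1 n).filter Odd,
      C ((-1) ^ (j / 2) * (n.choose j : ℚ) * c ^ j) * X ^ (n - j)) = n.factorial *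
    PowerSeries.coeff n (sinSeries c 0 * PowerSeries.rescale x (PowerSeries.exp ℝ)) := by
  rw [coeff_sin_mul_exp, mul_div_cancel₀ _ (Nat.cast_ne_zero.2 (Nat.factorial_ne_zero n)), map_sum]
  refine Finset.sum_congr rfl fun j _ => ?_
  simp only [map_mul, map_pow, aeval_C, aeval_X, eq_ratCast]
  push_cast
  ring

theorem even_sum_add (c : ℚ) (n : ℕ) : ∑ j ∈ (Finset.Icc 0 n).filter Even,
      C ((-1) ^ (j / 2) * (n.choose j : ℚ) * (c ^ j + 1)) * X ^ (n - j) =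
    ∑ j ∈ (Finset.Icc 0 n).filter Even,
      C ((-1) ^ (j / 2) * (n.choose j : ℚ) * c ^ j) * X ^ (n - j) +
    ∑ j ∈ (Finset.Icc 0 n).filter Even,
      C ((-1) ^ (j / 2) * (n.choose j : ℚ) * 1 ^ j) * X ^ (n - j) := by
  rw [← Finset.sum_add_distrib]
  refine Finset.sum_congr rfl fun j _ => ?_
  rw [← add_mul, ← C_add, ← mul_add, one_pow]

theorem odd_sum_sub (c : ℚ) (n : ℕ) : ∑ j ∈ (Finset.Icc 1 n).filter Odd,
      C ((-1) ^ ((j - 1) / 2) * (n.choose j : ℚ) * (c ^ j - 1)) * X ^ (n - j) =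
    ∑ j ∈ (Finset.Icc 1 n).filter Odd,
      C ((-1) ^ (j / 2) * (n.choose j : ℚ) * c ^ j) * X ^ (n - j) -
    ∑ j ∈ (Finset.Icc 1 n).filter Odd,
      C ((-1) ^ (j / 2) * (n.choose j : ℚ) * 1 ^ j) * X ^ (n - j) := by
  rw [← Finset.sum_sub_distrib]
  refine Finset.sum_congr rfl fun j hj => ?_
  obtain ⟨-, i, rfl⟩ := Finset.mem_filter.1 hj
  rw [← sub_mul, ← C_sub, ← mul_sub, one_pow, show (2 * i + 1 - 1) / 2 = (2 * i + 1) / 2 by omega]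

theorem odd_sum_neg (c : ℚ) (n : ℕ) : ∑ j ∈ (Finset.Icc 1 n).filter Odd,
      C ((-1) ^ ((j + 1) / 2) * (n.choose j : ℚ) * (c ^ j - 1)) * X ^ (n - j) =
    -∑ j ∈ (Finset.Icc 1 n).filter Odd,
      C ((-1) ^ ((j - 1) / 2) * (n.choose j : ℚ) * (c ^ j - 1)) * X ^ (n - j) := by
  rw [← Finset.sum_neg_distrib]
  refine Finset.sum_congr rfl fun j hj => ?_
  obtain ⟨-, i, rfl⟩ := Finset.mem_filter.1 hj
  rw [show (2 * i + 1 + 1) / 2 = (2 * i + 1 - 1) / 2 + 1 by omega, pow_succ, ← neg_mul, ← C_neg]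
  congr 2
  ring

theorem aeval_polyR (m : ℕ) (x : ℝ) : aeval x (polyR m) =
    3 / 2 * ev (cosCsc (1 / 2) (3 / 2)) m x -
      3 * (m.factorial * PowerSeries.coeff (m + 1) (cscT 3)) := by
  rw [polyR, show (3 : ℚ) = 2 * (3 / 2) by norm_num]
  rw [aeval_recPoly (d := 3 / 2) (by norm_num) _ x (1 / 2) 1
    (by simpa using cosCsc_mul (1 / 2) (d := 3 / 2) (by norm_num)) (X_mul_egf_eq ?_ fun k => ?_)]
  · norm_num
  · simp only [map_sub, map_mul, map_add, constantCoeff_cosSeries, constantCoeff_rescale_exp,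
      PowerSeries.constantCoeff_C]
    norm_num
  · rw [map_mul, even_sum_add, map_add, aeval_even_sum, aeval_even_sum, add_mul, map_sub,
      PowerSeries.coeff_C_mul, map_add, PowerSeries.coeff_C, if_neg (Nat.succ_ne_zero k), aeval_C,
      eq_ratCast]
    norm_num
    push_cast [Nat.factorial_succ]
    field_simp

theorem aeval_polyP (m : ℕ) (x : ℝ) : aeval x (polyP m) =
    3 * ev (cosCsc 2 3) m x - 6 * (m.factorial * PowerSeries.coeff (m + 1) (cscT 6)) := by
  rw [polyP, show (6 : ℚ) = 2 * 3 by norm_num]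
  rw [aeval_recPoly (d := 3) (by norm_num) _ x (1 / 2) 1
    (by simpa using cosCsc_mul 2 (d := 3) (by norm_num)) (X_mul_egf_eq ?_ fun k => ?_)]
  · norm_num
  · simp only [map_sub, map_mul, map_add, constantCoeff_cosSeries, constantCoeff_rescale_exp,
      PowerSeries.constantCoeff_C]
    norm_num
  · rw [map_mul, even_sum_add, map_add, aeval_even_sum, aeval_even_sum, add_mul, map_sub,
      PowerSeries.coeff_C_mul, map_add, PowerSeries.coeff_C, if_neg (Nat.succ_ne_zero k), aeval_C,
      eq_ratCast]
    norm_num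
    push_cast [Nat.factorial_succ]
    field_simp

theorem aeval_polyS (m : ℕ) (x : ℝ) : aeval x (polyS m) =
    -(3 / 2) * ev (sinCsc (1 / 2) (3 / 2)) m x := by
  rw [polyS, show (3 : ℚ) = 2 * (3 / 2) by norm_num]
  rw [aeval_recPoly (d := 3 / 2) (by norm_num) _ x (-1 / 2) 0
    (by simpa using sinCsc_mul (1 / 2) (d := 3 / 2) (by norm_num)) (X_mul_egf_eq ?_ fun k => ?_)]
  · norm_num
  · simp only [map_sub, map_mul, constantCoeff_sinSeries, constantCoeff_rescale_exp,
      PowerSeries.constantCoeff_C]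
    norm_num
  · rw [map_mul, odd_sum_neg, odd_sum_sub, map_neg, map_sub, aeval_odd_sum, aeval_odd_sum, sub_mul,
      map_sub, PowerSeries.coeff_C_mul, map_sub, PowerSeries.coeff_C,
      if_neg (Nat.succ_ne_zero k), aeval_C, eq_ratCast]
    norm_num
    push_cast [Nat.factorial_succ]
    field_simp
    ring

theorem aeval_polyQ (m : ℕ) (x : ℝ) : aeval x (polyQ m) = 3 * ev (sinCsc 2 3) m x := by
  rw [polyQ, show (6 : ℚ) = 2 * 3 by norm_num]
  rw [aeval_recPoly (d := 3) (by norm_num) _ x (1 / 2) 0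
    (by simpa using sinCsc_mul 2 (d := 3) (by norm_num)) (X_mul_egf_eq ?_ fun k => ?_)]
  · norm_num
  · simp only [map_sub, map_mul, constantCoeff_sinSeries, constantCoeff_rescale_exp,
      PowerSeries.constantCoeff_C]
    norm_num
  · rw [map_mul, odd_sum_sub, map_sub, aeval_odd_sum, aeval_odd_sum, sub_mul,
      map_sub, PowerSeries.coeff_C_mul, map_sub, PowerSeries.coeff_C,
      if_neg (Nat.succ_ne_zero k), aeval_C, eq_ratCast]
    norm_num
    push_cast [Nat.factorial_succ]
    field_simp

theorem aeval_polyY (m : ℕ) (x : ℝ) : aeval x (polyY m) =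
    -3 * ev (cosCsc (3 / 2) (3 / 2)) m x +
      6 * (m.factorial * PowerSeries.coeff (m + 1) (cscT 3)) := by
  rw [polyY, show recPoly 3 = recPoly (2 * (3 / 2)) by norm_num]
  rw [aeval_recPoly (d := 3 / 2) (by norm_num) _ x (-1) (-2)
    (by simpa using cosCsc_mul (3 / 2) (d := 3 / 2) (by norm_num)) (X_mul_egf_eq ?_ fun k => ?_)]
  · norm_num
  · simp only [map_sub, map_mul, map_add, constantCoeff_cosSeries, constantCoeff_rescale_exp,
      PowerSeries.constantCoeff_C]
    norm_num
  · rw [map_mul, map_add, aeval_even_sum, add_mul, map_sub,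
      PowerSeries.coeff_C_mul, map_add, PowerSeries.coeff_C, if_neg (Nat.succ_ne_zero k), map_neg,
      aeval_C, eq_ratCast, map_pow, aeval_X, cosSeries_zero_zero, one_mul]
    rw [rescale_exp_eq_mk, PowerSeries.coeff_mk]
    norm_num
    push_cast [Nat.factorial_succ]
    have := Nat.factorial_ne_zero k
    field_simp
    ring

theorem aeval_polyZ (m : ℕ) (x : ℝ) : aeval x (polyZ m) =
    -6 * ev (cscT 3) m x + 12 * (m.factorial * PowerSeries.coeff (m + 1) (cscT 6)) := by
  rw [polyZ, show recPoly 6 = recPoly (2 * 3) by norm_num]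
  have hk : cscT 3 * sinSeries (2 * 3) 0 =
      PowerSeries.X * (PowerSeries.C 2 * cosSeries 3 0) := by
    rw [sinSeries_two_mul, ← cscT_mul_sinSeries (c := 3) (by norm_num)]
    ring
  rw [aeval_recPoly (d := 3) (by norm_num) _ x (-1) (-2)
    (by simpa using hk) (X_mul_egf_eq ?_ fun k => ?_)]
  · norm_num
  · simp only [map_sub, map_mul, constantCoeff_cosSeries, constantCoeff_rescale_exp,
      PowerSeries.constantCoeff_C]
    norm_num
  · rw [map_mul, aeval_even_sum, map_sub, mul_assoc (PowerSeries.C 2),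
      PowerSeries.coeff_C_mul, PowerSeries.coeff_C_mul, PowerSeries.coeff_C,
      if_neg (Nat.succ_ne_zero k), map_neg, aeval_C, eq_ratCast]
    norm_num
    push_cast [Nat.factorial_succ]
    field_simp

end

end LogIntegrals

namespace LogIntegrals

open Filter Topology

noncomputable section

/-! ### Values of the second family -/

section Values

variable {m : ℕ} (x : ℝ)

theorem eval_polyA_of_even (hm : Even m) :
    (polyA m).eval x = -2 * √3 * ev (cosCsc (1 / 2) (3 / 2)) m x := by
  rw [polyA, kernelA_eq, eval_sinh_of_even _ _ _ _ (by norm_num) hm]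

theorem eval_polyA_of_odd (hm : Odd m) :
    (polyA m).eval x = -2 * ev (sinCsc (1 / 2) (3 / 2)) m x := by
  rw [polyA, kernelA_eq, eval_sinh_of_odd _ _ _ _ (by norm_num) hm]

theorem eval_polyB_of_even (hm : Even m) :
    (polyB m).eval x = -2 * ev (sinCsc (1 / 2) (3 / 2)) m x := by
  rw [polyB, kernelA_eq, eval_cosh_of_even _ _ _ _ (by norm_num) hm]

theorem eval_polyB_of_odd (hm : Odd m) :
    (polyB m).eval x = -2 * √3 * ev (cosCsc (1 / 2) (3 / 2)) m x := by
  rw [polyB, kernelA_eq, eval_cosh_of_odd _ _ _ _ (by norm_num) hm]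

theorem eval_polyC_of_even (hm : Even m) :
    (polyC m).eval x = -(√3 / 2) * ev (cosCsc 2 3) m x := by
  rw [polyC, kernelC_eq, eval_sinh_of_even _ _ _ _ (by norm_num) hm]

theorem eval_polyC_of_odd (hm : Odd m) :
    (polyC m).eval x = -1 / 2 * ev (sinCsc 2 3) m x := by
  rw [polyC, kernelC_eq, eval_sinh_of_odd _ _ _ _ (by norm_num) hm]

theorem eval_polyD_of_even (hm : Even m) :
    (polyD m).eval x = -1 / 2 * ev (sinCsc 2 3) m x := by
  rw [polyD, kernelC_eq, eval_cosh_of_even _ _ _ _ (by norm_num) hm]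

theorem eval_polyD_of_odd (hm : Odd m) :
    (polyD m).eval x = -(√3 / 2) * ev (cosCsc 2 3) m x := by
  rw [polyD, kernelC_eq, eval_cosh_of_odd _ _ _ _ (by norm_num) hm]

theorem eval_polyE_of_even (hm : Even m) :
    (polyE m).eval x = -1 / 2 * ev (cosCsc (1 / 2) (3 / 2)) m x := by
  rw [polyE, kernelE_eq, eval_sinh_of_even _ _ _ _ (by norm_num) hm]

theorem eval_polyE_of_odd (hm : Odd m) :
    (polyE m).eval x = -(√3 / 2) * ev (sinCsc (1 / 2) (3 / 2)) m x := by
  rw [polyE, kernelE_eq, eval_sinh_of_odd _ _ _ _ (by norm_num) hm]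

theorem eval_polyF_of_even (hm : Even m) :
    (polyF m).eval x = -(√3 / 2) * ev (sinCsc (1 / 2) (3 / 2)) m x := by
  rw [polyF, kernelE_eq, eval_cosh_of_even _ _ _ _ (by norm_num) hm]

theorem eval_polyF_of_odd (hm : Odd m) :
    (polyF m).eval x = -1 / 2 * ev (cosCsc (1 / 2) (3 / 2)) m x := by
  rw [polyF, kernelE_eq, eval_cosh_of_odd _ _ _ _ (by norm_num) hm]

theorem eval_polyG : (polyG m).eval x = ev (cosCsc (3 / 2) (3 / 2)) m x := by
  rw [polyG, kernelG_eq, eval_exp]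

theorem eval_polyK_of_even (hm : Even m) :
    (polyK m).eval x = √3 / 2 * ev (cosCsc (1 / 2) (3 / 2)) m x := by
  rw [polyK, kernelK_eq, eval_sinh_of_even _ _ _ _ (by norm_num) hm]

theorem eval_polyK_of_odd (hm : Odd m) :
    (polyK m).eval x = 1 / 2 * ev (sinCsc (1 / 2) (3 / 2)) m x := by
  rw [polyK, kernelK_eq, eval_sinh_of_odd _ _ _ _ (by norm_num) hm]

theorem eval_polyL_of_even (hm : Even m) :
    (polyL m).eval x = 1 / 2 * ev (sinCsc (1 / 2) (3 / 2)) m x := by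
  rw [polyL, kernelK_eq, eval_cosh_of_even _ _ _ _ (by norm_num) hm]

theorem eval_polyL_of_odd (hm : Odd m) :
    (polyL m).eval x = √3 / 2 * ev (cosCsc (1 / 2) (3 / 2)) m x := by
  rw [polyL, kernelK_eq, eval_cosh_of_odd _ _ _ _ (by norm_num) hm]

theorem eval_polyU_of_even (hm : Even m) :
    (polyU m).eval x = -1 / 2 * ev (cosCsc 2 3) m x := by
  rw [polyU, kernelU_eq, eval_sinh_of_even _ _ _ _ (by norm_num) hm]

theorem eval_polyU_of_odd (hm : Odd m) :
    (polyU m).eval x = √3 / 2 * ev (sinCsc 2 3) m x := by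
  rw [polyU, kernelU_eq, eval_sinh_of_odd _ _ _ _ (by norm_num) hm]

theorem eval_polyV_of_even (hm : Even m) :
    (polyV m).eval x = √3 / 2 * ev (sinCsc 2 3) m x := by
  rw [polyV, kernelU_eq, eval_cosh_of_even _ _ _ _ (by norm_num) hm]

theorem eval_polyV_of_odd (hm : Odd m) :
    (polyV m).eval x = -1 / 2 * ev (cosCsc 2 3) m x := by
  rw [polyV, kernelU_eq, eval_cosh_of_odd _ _ _ _ (by norm_num) hm]

theorem eval_polyW : (polyW m).eval x = ev (cscT 3) m x := by
  rw [polyW, cscSeries_zero (by norm_num), eval_exp]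

theorem polyN_eq_polyC : polyN = polyC := by
  rw [polyN, polyC, kernelN_eq, kernelC_eq]

theorem polyO_eq_polyD : polyO = polyD := by
  rw [polyO, polyD, kernelN_eq, kernelC_eq]

end Values

/-! ### Comparison of the two families -/

theorem approxMul_of_eval {p : ℚ[X]} {s : ℝ} {q : ℝ[X]} {c : ℝ}
    (h : ∀ x, aeval x p = s * q.eval x + c) : ApproxMul p s q := by
  refine ⟨c, Polynomial.funext fun x => ?_⟩
  rw [eval_map_algebraMap, h]
  simp

theorem eqMul_of_eval {p : ℚ[X]} {s : ℝ} {q : ℝ[X]}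
    (h : ∀ x, aeval x p = s * q.eval x) : EqMul p s q := by
  refine Polynomial.funext fun x => ?_
  rw [eval_map_algebraMap, h]
  simp

theorem sq_sqrt_three : √3 ^ 2 = (3 : ℝ) := Real.sq_sqrt (by norm_num)

theorem comparison_of_even {m : ℕ} (hm : Even m) :
    ApproxMul (polyR m) (-(√3 / 4)) (polyA m) ∧ EqMul (polyS m) (3 / 4) (polyB m) ∧
      ApproxMul (polyP m) (-(2 * √3)) (polyC m) ∧ EqMul (polyQ m) (-6) (polyD m) := by
  refine ⟨approxMul_of_eval (c := -3 * (m.factorial * PowerSeries.coeff (m + 1) (cscT 3)))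
      fun x => ?_, eqMul_of_eval fun x => ?_,
    approxMul_of_eval (c := -6 * (m.factorial * PowerSeries.coeff (m + 1) (cscT 6)))
      fun x => ?_, eqMul_of_eval fun x => ?_⟩
  · rw [aeval_polyR, eval_polyA_of_even x hm]
    linear_combination (-1 / 2 * ev (cosCsc (1 / 2) (3 / 2)) m x) * sq_sqrt_three
  · rw [aeval_polyS, eval_polyB_of_even x hm]
    ring
  · rw [aeval_polyP, eval_polyC_of_even x hm]
    linear_combination (-ev (cosCsc 2 3) m x) * sq_sqrt_three
  · rw [aeval_polyQ, eval_polyD_of_even x hm]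
    ring

theorem comparison_of_odd {m : ℕ} (hm : Odd m) :
    ApproxMul (polyR m) (-(√3 / 4)) (polyB m) ∧ EqMul (polyS m) (3 / 4) (polyA m) ∧
      ApproxMul (polyP m) (-(2 * √3)) (polyD m) ∧ EqMul (polyQ m) (-6) (polyC m) := by
  refine ⟨approxMul_of_eval (c := -3 * (m.factorial * PowerSeries.coeff (m + 1) (cscT 3)))
      fun x => ?_, eqMul_of_eval fun x => ?_,
    approxMul_of_eval (c := -6 * (m.factorial * PowerSeries.coeff (m + 1) (cscT 6)))
      fun x => ?_, eqMul_of_eval fun x => ?_⟩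
  · rw [aeval_polyR, eval_polyB_of_odd x hm]
    linear_combination (-1 / 2 * ev (cosCsc (1 / 2) (3 / 2)) m x) * sq_sqrt_three
  · rw [aeval_polyS, eval_polyA_of_odd x hm]
    ring
  · rw [aeval_polyP, eval_polyD_of_odd x hm]
    linear_combination (-ev (cosCsc 2 3) m x) * sq_sqrt_three
  · rw [aeval_polyQ, eval_polyC_of_odd x hm]
    ring

theorem approxMul_polyY (m : ℕ) : ApproxMul (polyY m) (-3) (polyG m) :=
  approxMul_of_eval (c := 6 * (m.factorial * PowerSeries.coeff (m + 1) (cscT 3)))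
    fun x => by rw [aeval_polyY, eval_polyG]

theorem approxMul_polyZ (m : ℕ) : ApproxMul (polyZ m) (-6) (polyW m) :=
  approxMul_of_eval (c := 12 * (m.factorial * PowerSeries.coeff (m + 1) (cscT 6)))
    fun x => by rw [aeval_polyZ, eval_polyW]

/-! ### The closed formulas in terms of `ev` -/

theorem f1Rec_eq_ev (a b : ℝ) (m : ℕ) : f1Rec a b m =
    θ ^ (m + 1) * (a + b) / (a ^ 3 - b ^ 3) *
      (3 / 2 * (ev (cosCsc (1 / 2) (3 / 2)) m (xθ a) - ev (cosCsc (1 / 2) (3 / 2)) m (xθ b))) -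
    θ ^ (m + 1) / (√3 * (a ^ 2 + a * b + b ^ 2)) *
      (3 / 2 * (ev (sinCsc (1 / 2) (3 / 2)) m (xθ a) +
        ev (sinCsc (1 / 2) (3 / 2)) m (xθ b))) := by
  rw [f1Rec, aeval_polyR, aeval_polyR, aeval_polyS, aeval_polyS]
  ring

theorem f2Rec_eq_ev (a b : ℝ) (m : ℕ) : f2Rec a b m =
    δ ^ (m + 1) * (a + b) / (a ^ 3 - b ^ 3) *
      (3 * (ev (cosCsc 2 3) m (xδ a) - ev (cosCsc 2 3) m (xδ b))) +
    δ ^ (m + 1) / (√3 * (a ^ 2 + a * b + b ^ 2)) *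
      (3 * (ev (sinCsc 2 3) m (xδ a) + ev (sinCsc 2 3) m (xδ b))) := by
  rw [f2Rec, aeval_polyP, aeval_polyP, aeval_polyQ, aeval_polyQ]
  ring

theorem g1Rec_eq_ev (a b : ℝ) (m : ℕ) : g1Rec a b m =
    θ ^ (m + 1) / (3 * (a ^ 2 + a * b + b ^ 2)) *
      (-(3 / 2) * ev (cosCsc (1 / 2) (3 / 2)) m (xθ a) +
        9 / 2 * ev (cosCsc (1 / 2) (3 / 2)) m (xθ b) -
        3 * ev (cosCsc (3 / 2) (3 / 2)) m (xθ a)) -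
    θ ^ (m + 1) * (a + b) / (√3 * (a ^ 3 - b ^ 3)) *
      (3 / 2 * (ev (sinCsc (1 / 2) (3 / 2)) m (xθ a) -
        ev (sinCsc (1 / 2) (3 / 2)) m (xθ b))) := by
  rw [g1Rec, aeval_polyR, aeval_polyR, aeval_polyS, aeval_polyS, aeval_polyY]
  ring

theorem g2Rec_eq_ev (a b : ℝ) (m : ℕ) : g2Rec a b m =
    δ ^ (m + 1) / (3 * (a ^ 2 + a * b + b ^ 2)) *
      (-3 * ev (cosCsc 2 3) m (xδ a) + 9 * ev (cosCsc 2 3) m (xδ b) - 6 * ev (cscT 3) m (xδ a)) +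
    δ ^ (m + 1) * (a + b) / (√3 * (a ^ 3 - b ^ 3)) *
      (3 * (ev (sinCsc 2 3) m (xδ a) - ev (sinCsc 2 3) m (xδ b))) := by
  rw [g2Rec, aeval_polyP, aeval_polyP, aeval_polyQ, aeval_polyQ, aeval_polyZ]
  ring

theorem f1Rec_eq_f1Alt (a b : ℝ) (m : ℕ) : f1Rec a b m = f1Alt a b m := by
  rw [f1Rec_eq_ev, f1Alt]
  split_ifs with hm
  · rw [eval_polyA_of_even _ hm, eval_polyA_of_even _ hm, eval_polyB_of_even _ hm,
      eval_polyB_of_even _ hm]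
    linear_combination (-(θ ^ (m + 1) * (a + b) / (a ^ 3 - b ^ 3) *
      (1 / 2 * (ev (cosCsc (1 / 2) (3 / 2)) m (xθ a) -
        ev (cosCsc (1 / 2) (3 / 2)) m (xθ b))))) * sq_sqrt_three
  · rw [Nat.not_even_iff_odd] at hm
    rw [eval_polyA_of_odd _ hm, eval_polyA_of_odd _ hm, eval_polyB_of_odd _ hm,
      eval_polyB_of_odd _ hm]
    linear_combination (-(θ ^ (m + 1) * (a + b) / (a ^ 3 - b ^ 3) *
      (1 / 2 * (ev (cosCsc (1 / 2) (3 / 2)) m (xθ a) -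
        ev (cosCsc (1 / 2) (3 / 2)) m (xθ b))))) * sq_sqrt_three

theorem f2Rec_eq_f2Alt (a b : ℝ) (m : ℕ) : f2Rec a b m = f2Alt a b m := by
  rw [f2Rec_eq_ev, f2Alt]
  split_ifs with hm
  · rw [eval_polyC_of_even _ hm, eval_polyC_of_even _ hm, eval_polyD_of_even _ hm,
      eval_polyD_of_even _ hm]
    linear_combination (-(δ ^ (m + 1) * (a + b) / (a ^ 3 - b ^ 3) *
      (ev (cosCsc 2 3) m (xδ a) - ev (cosCsc 2 3) m (xδ b)))) * sq_sqrt_three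
  · rw [Nat.not_even_iff_odd] at hm
    rw [eval_polyC_of_odd _ hm, eval_polyC_of_odd _ hm, eval_polyD_of_odd _ hm,
      eval_polyD_of_odd _ hm]
    linear_combination (-(δ ^ (m + 1) * (a + b) / (a ^ 3 - b ^ 3) *
      (ev (cosCsc 2 3) m (xδ a) - ev (cosCsc 2 3) m (xδ b)))) * sq_sqrt_three

theorem div_sqrt_three_mul (u v : ℝ) : u / (√3 * v) = u / v * √3 / 3 := by
  have : √3 ≠ (0 : ℝ) := by positivity
  rw [div_mul_eq_div_div_swap, div_eq_div_iff this (by norm_num), mul_assoc, ← sq, sq_sqrt_three]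

theorem g1Rec_eq_g1Alt (a b : ℝ) (m : ℕ) : g1Rec a b m = g1Alt a b m := by
  rw [g1Rec_eq_ev, g1Alt, div_sqrt_three_mul]
  split_ifs with hm
  · rw [eval_polyE_of_even _ hm, eval_polyK_of_even _ hm, eval_polyF_of_even _ hm,
      eval_polyL_of_even _ hm, eval_polyG]
    linear_combination (-(3 / 2 * (θ ^ (m + 1) / (3 * (a ^ 2 + a * b + b ^ 2)) *
      ev (cosCsc (1 / 2) (3 / 2)) m (xθ b))) + θ ^ (m + 1) * (a + b) / (a ^ 3 - b ^ 3) * √3 / 6 *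
      (ev (sinCsc (1 / 2) (3 / 2)) m (xθ a) -
        ev (sinCsc (1 / 2) (3 / 2)) m (xθ b))) * sq_sqrt_three
  · rw [Nat.not_even_iff_odd] at hm
    rw [eval_polyE_of_odd _ hm, eval_polyK_of_odd _ hm, eval_polyF_of_odd _ hm,
      eval_polyL_of_odd _ hm, eval_polyG]
    linear_combination (-(3 / 2 * (θ ^ (m + 1) / (3 * (a ^ 2 + a * b + b ^ 2)) *
      ev (cosCsc (1 / 2) (3 / 2)) m (xθ b))) + θ ^ (m + 1) * (a + b) / (a ^ 3 - b ^ 3) * √3 / 6 *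
      (ev (sinCsc (1 / 2) (3 / 2)) m (xθ a) -
        ev (sinCsc (1 / 2) (3 / 2)) m (xθ b))) * sq_sqrt_three

theorem g2Rec_eq_g2Alt (a b : ℝ) (m : ℕ) : g2Rec a b m = g2Alt a b m := by
  rw [g2Rec_eq_ev, g2Alt, div_sqrt_three_mul, polyN_eq_polyC, polyO_eq_polyD]
  split_ifs with hm
  · rw [eval_polyC_of_even _ hm, eval_polyD_of_even _ hm, eval_polyU_of_even _ hm,
      eval_polyV_of_even _ hm, eval_polyW]
    linear_combination (-(3 * (δ ^ (m + 1) / (3 * (a ^ 2 + a * b + b ^ 2)) *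
      ev (cosCsc 2 3) m (xδ b))) - δ ^ (m + 1) * (a + b) / (a ^ 3 - b ^ 3) * √3 / 3 *
      (ev (sinCsc 2 3) m (xδ a) - ev (sinCsc 2 3) m (xδ b))) * sq_sqrt_three
  · rw [Nat.not_even_iff_odd] at hm
    rw [eval_polyC_of_odd _ hm, eval_polyD_of_odd _ hm, eval_polyU_of_odd _ hm,
      eval_polyV_of_odd _ hm, eval_polyW]
    linear_combination (-(3 * (δ ^ (m + 1) / (3 * (a ^ 2 + a * b + b ^ 2)) *
      ev (cosCsc 2 3) m (xδ b))) - δ ^ (m + 1) * (a + b) / (a ^ 3 - b ^ 3) * √3 / 3 *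
      (ev (sinCsc 2 3) m (xδ a) - ev (sinCsc 2 3) m (xδ b))) * sq_sqrt_three

/-! ### Arithmetic nature of the coefficients -/

/-- Series whose even coefficients are rational and whose odd coefficients are in `√3 ℚ`. -/
def twistedRational : Subring (PowerSeries ℝ) :=
  ((PowerSeries.rescale √3).comp (PowerSeries.map (algebraMap ℚ ℝ))).range

theorem sqrt_three_pow (n : ℕ) : ∃ r : ℚ, √3 ^ n = if Even n then (r : ℝ) else √3 * r := by
  rcases Nat.even_or_odd' n with ⟨k, rfl | rfl⟩
  · refine ⟨3 ^ k, ?_⟩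
    rw [if_pos (even_two_mul k), pow_mul, sq_sqrt_three]
    push_cast
    rfl
  · refine ⟨3 ^ k, ?_⟩
    rw [if_neg (Nat.not_even_iff_odd.2 (odd_two_mul_add_one k)), pow_succ, pow_mul, sq_sqrt_three]
    push_cast
    ring

theorem mem_twistedRational {p : PowerSeries ℝ} : p ∈ twistedRational ↔
    ∀ n, ∃ r : ℚ, PowerSeries.coeff n p = √3 ^ n * r := by
  constructor
  · rintro ⟨q, rfl⟩ n
    exact ⟨PowerSeries.coeff n q, by simp [PowerSeries.coeff_rescale]⟩
  · intro h
    choose r hr using h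
    refine ⟨PowerSeries.mk r, ?_⟩
    ext n
    simp [PowerSeries.coeff_rescale, hr]

theorem inv_mem_twistedRational {p : PowerSeries ℝ} (hp : p ∈ twistedRational)
    (h0 : PowerSeries.constantCoeff p ≠ 0) : p⁻¹ ∈ twistedRational := by
  obtain ⟨q, rfl⟩ := hp
  have hq : PowerSeries.constantCoeff q ≠ 0 := by
    intro h
    apply h0
    rw [← PowerSeries.coeff_zero_eq_constantCoeff_apply] at h ⊢
    simp [PowerSeries.coeff_rescale, h]
  refine ⟨q⁻¹, ?_⟩
  rw [PowerSeries.eq_inv_iff_mul_eq_one h0, ← map_mul, PowerSeries.inv_mul_cancel _ hq, map_one]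

theorem C_mem_twistedRational (r : ℚ) : PowerSeries.C (r : ℝ) ∈ twistedRational :=
  ⟨PowerSeries.C r, by simp [rescale_C]⟩

theorem cosSeries_mem_twistedRational (c : ℚ) : cosSeries c 0 ∈ twistedRational := by
  refine mem_twistedRational.2 fun n => ?_
  rw [coeff_cosSeries]
  rcases Nat.even_or_odd' n with ⟨k, rfl | rfl⟩
  · refine ⟨(3 ^ k)⁻¹ * ((-1) ^ k * c ^ (2 * k) / (2 * k).factorial), ?_⟩
    rw [pow_mul (√3), sq_sqrt_three]
    simp
  · exact ⟨0, by simp⟩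

theorem sqrt_three_mul_sinSeries_mem_twistedRational (c : ℚ) :
    PowerSeries.C √3 * sinSeries c 0 ∈ twistedRational := by
  refine mem_twistedRational.2 fun n => ?_
  rw [PowerSeries.coeff_C_mul, coeff_sinSeries]
  rcases Nat.even_or_odd' n with ⟨k, rfl | rfl⟩
  · exact ⟨0, by simp⟩
  · refine ⟨(3 ^ k)⁻¹ * ((-1) ^ k * c ^ (2 * k + 1) / (2 * k + 1).factorial), ?_⟩
    rw [pow_succ √3, pow_mul √3, sq_sqrt_three, show (2 * k + 1) / 2 = k by omega]
    simp
    field_simp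

theorem cscT_mem_twistedRational {c : ℚ} (hc : c ≠ 0) : cscT c ∈ twistedRational := by
  refine inv_mem_twistedRational (mem_twistedRational.2 fun n => ?_) ?_
  · rw [PowerSeries.coeff_mk, coeff_sinSeries]
    rcases Nat.even_or_odd' n with ⟨k, rfl | rfl⟩
    · refine ⟨(3 ^ k)⁻¹ * ((-1) ^ k * c ^ (2 * k + 1) / (2 * k + 1).factorial), ?_⟩
      rw [pow_mul √3, sq_sqrt_three, show (2 * k + 1) / 2 = k by omega]
      simp
    · exact ⟨0, by simp [parity_simps]⟩
  · rw [constantCoeff_sincSeries]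
    exact_mod_cast hc

theorem coeffsInQSqrt3_zero : CoeffsInQSqrt3 0 := fun i => ⟨0, by simp⟩

/-- The series `k` whose coefficients of every degree lie in `ℚ ∪ √3 ℚ`. -/
def CoeffsRat (k : PowerSeries ℝ) : Prop :=
  ∀ n, ∃ r : ℚ, PowerSeries.coeff n k = r ∨ PowerSeries.coeff n k = √3 * r

theorem coeffsRat_of_mem {k : PowerSeries ℝ} (hk : k ∈ twistedRational) : CoeffsRat k := by
  intro n
  obtain ⟨r, hr⟩ := mem_twistedRational.1 hk n
  obtain ⟨s, hs⟩ := sqrt_three_pow n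
  refine ⟨s * r, ?_⟩
  rw [hr, hs]
  push_cast
  split_ifs
  · exact Or.inl rfl
  · exact Or.inr (by ring)

theorem coeffsRat_of_sqrt_three_mul_mem {k : PowerSeries ℝ}
    (hk : PowerSeries.C √3 * k ∈ twistedRational) : CoeffsRat k := by
  intro n
  obtain ⟨r, hr⟩ := coeffsRat_of_mem hk n
  rw [PowerSeries.coeff_C_mul] at hr
  have h3 : √3 ≠ (0 : ℝ) := by positivity
  rcases hr with hr | hr
  · refine ⟨r / 3, Or.inr (mul_left_cancel₀ h3 ?_)⟩
    rw [hr, ← mul_assoc, ← sq, sq_sqrt_three]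
    push_cast
    ring
  · exact ⟨r, Or.inl (mul_left_cancel₀ h3 hr)⟩

/-- The coefficients of a series in `T` and `x` are rational multiples of powers `xⁿ` of matching
degree. -/
theorem coeffsInQSqrt3_laurentPoly {k : PowerSeries ℝ} (hk : CoeffsRat k) {h : PowerSeries ℝ[X]}
    (hh : ∀ n, ∃ r : ℚ, PowerSeries.coeff n h = C (r : ℝ) * X ^ n) (m : ℤ) :
    CoeffsInQSqrt3 (laurentPoly (divT k) h m) := by
  rw [laurentPoly_divT]
  split_ifs
  · exact coeffsInQSqrt3_zero
  · intro i
    choose r hr using hh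
    generalize (m + 1).toNat = n
    rw [coeff_C_mul, PowerSeries.coeff_mul, finsetSum_coeff]
    by_cases hi : i ≤ n
    · rw [Finset.sum_eq_single (n - i, i)]
      · obtain ⟨s, hs⟩ := hk (n - i)
        refine ⟨m.toNat.factorial * (s * r i), ?_⟩
        rw [PowerSeries.coeff_map, hr, coeff_C_mul, coeff_C_mul, coeff_X_pow_self]
        push_cast
        rcases hs with hs | hs
        · exact Or.inl (by rw [hs]; ring)
        · exact Or.inr (by rw [hs]; ring)
      · rintro ⟨u, v⟩ huv hne
        rw [PowerSeries.coeff_map, hr, coeff_C_mul, coeff_C_mul, coeff_X_pow, if_neg]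
        · simp
        · rintro rfl
          apply hne
          rw [Finset.HasAntidiagonal.mem_antidiagonal] at huv
          simp only at huv
          ext <;> simp
          omega
      · intro h'
        exfalso
        apply h'
        rw [Finset.HasAntidiagonal.mem_antidiagonal]
        exact Nat.sub_add_cancel hi
    · refine ⟨0, Or.inl ?_⟩
      rw [Finset.sum_eq_zero]
      · simp
      · rintro ⟨u, v⟩ huv
        rw [PowerSeries.coeff_map, hr, coeff_C_mul, coeff_C_mul, coeff_X_pow, if_neg]
        · simp
        · rw [Finset.HasAntidiagonal.mem_antidiagonal] at huv
          simp only at huv ⊢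
          omega

theorem coeff_expXT_rat (n : ℕ) : ∃ r : ℚ, PowerSeries.coeff n expXT = C (r : ℝ) * X ^ n :=
  ⟨1 / n.factorial, by simp [expXT]⟩

theorem coeff_sinhXT_rat (n : ℕ) : ∃ r : ℚ, PowerSeries.coeff n sinhXT = C (r : ℝ) * X ^ n := by
  refine ⟨if Odd n then 1 / n.factorial else 0, ?_⟩
  rw [sinhXT, PowerSeries.coeff_mk]
  split_ifs <;> simp

theorem coeff_coshXT_rat (n : ℕ) : ∃ r : ℚ, PowerSeries.coeff n coshXT = C (r : ℝ) * X ^ n := by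
  refine ⟨if Even n then 1 / n.factorial else 0, ?_⟩
  rw [coshXT, PowerSeries.coeff_mk]
  split_ifs <;> simp

theorem cosCsc_mem_twistedRational (c : ℚ) {d : ℚ} (hd : d ≠ 0) :
    cosCsc c d ∈ twistedRational :=
  mul_mem (cscT_mem_twistedRational hd) (cosSeries_mem_twistedRational c)

theorem sqrt_three_mul_sinCsc_mem_twistedRational (c : ℚ) {d : ℚ} (hd : d ≠ 0) :
    PowerSeries.C √3 * sinCsc c d ∈ twistedRational := by
  rw [sinCsc, mul_left_comm]
  exact mul_mem (cscT_mem_twistedRational hd) (sqrt_three_mul_sinSeries_mem_twistedRational c)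

theorem coeffsRat_sqrt_three_cos_add_sin (r s c : ℚ) {d : ℚ} (hd : d ≠ 0) :
    CoeffsRat (PowerSeries.C (√3 * r) * cosCsc c d + PowerSeries.C (s : ℝ) * sinCsc c d) := by
  refine coeffsRat_of_sqrt_three_mul_mem ?_
  have : PowerSeries.C √3 * (PowerSeries.C (√3 * r) * cosCsc c d +
      PowerSeries.C (s : ℝ) * sinCsc c d) =
      PowerSeries.C ((3 * r : ℚ) : ℝ) * cosCsc c d +
        PowerSeries.C (s : ℝ) * (PowerSeries.C √3 * sinCsc c d) := by
    have h3 : PowerSeries.C (3 : ℝ) = PowerSeries.C √3 * PowerSeries.C √3 := by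
      rw [← map_mul, ← sq, sq_sqrt_three]
    push_cast
    rw [map_mul _ (3 : ℝ), h3, map_mul]
    ring
  rw [this]
  exact add_mem (mul_mem (C_mem_twistedRational _) (cosCsc_mem_twistedRational c hd))
    (mul_mem (C_mem_twistedRational _) (sqrt_three_mul_sinCsc_mem_twistedRational c hd))

theorem coeffsRat_cos_add_sqrt_three_sin (r s c : ℚ) {d : ℚ} (hd : d ≠ 0) :
    CoeffsRat (PowerSeries.C (r : ℝ) * cosCsc c d + PowerSeries.C (√3 * s) * sinCsc c d) := by
  refine coeffsRat_of_mem ?_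
  rw [map_mul, mul_right_comm, mul_comm _ (PowerSeries.C (s : ℝ))]
  exact add_mem (mul_mem (C_mem_twistedRational _) (cosCsc_mem_twistedRational c hd))
    (mul_mem (C_mem_twistedRational _) (sqrt_three_mul_sinCsc_mem_twistedRational c hd))

theorem coeffsInQSqrt3_secondFamily : ∀ p ∈ [polyA, polyB, polyC, polyD, polyE, polyF, polyG,
    polyK, polyL, polyU, polyV, polyW, polyN, polyO], ∀ m : ℤ, CoeffsInQSqrt3 (p m) := by
  have hA := coeffsRat_sqrt_three_cos_add_sin (-2) (-2) (1 / 2) (d := 3 / 2) (by norm_num)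
  have hK := coeffsRat_sqrt_three_cos_add_sin (1 / 2) (1 / 2) (1 / 2) (d := 3 / 2) (by norm_num)
  have hE := coeffsRat_cos_add_sqrt_three_sin (-1 / 2) (-1 / 2) (1 / 2) (d := 3 / 2) (by norm_num)
  have hC := coeffsRat_sqrt_three_cos_add_sin (-1 / 2) (-1 / 2) 2 (d := 3) (by norm_num)
  have hU := coeffsRat_cos_add_sqrt_three_sin (-1 / 2) (1 / 2) 2 (d := 3) (by norm_num)
  have hG := coeffsRat_of_mem (cosCsc_mem_twistedRational (3 / 2) (d := 3 / 2) (by norm_num))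
  have hW := coeffsRat_of_mem (cscT_mem_twistedRational (c := 3) (by norm_num))
  push_cast at hA hK hE hC hU hG hW
  rw [show √3 * -2 = -2 * √3 by ring] at hA
  rw [show √3 * (1 / 2) = √3 / 2 by ring] at hK hU
  rw [show √3 * (-1 / 2) = -(√3 / 2) by ring] at hE hC
  simp only [List.forall_mem_cons, List.not_mem_nil, false_imp_iff, implies_true, and_true,
    polyN_eq_polyC, polyO_eq_polyD]
  rw [polyA, polyB, polyC, polyD, polyE, polyF, polyG, polyK, polyL, polyU, polyV, polyW,
    kernelA_eq, kernelC_eq, kernelE_eq, kernelG_eq, kernelK_eq, kernelU_eq,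
    cscSeries_zero (c := 3) (by norm_num)]
  exact ⟨coeffsInQSqrt3_laurentPoly hA coeff_sinhXT_rat,
    coeffsInQSqrt3_laurentPoly hA coeff_coshXT_rat,
    coeffsInQSqrt3_laurentPoly hC coeff_sinhXT_rat,
    coeffsInQSqrt3_laurentPoly hC coeff_coshXT_rat,
    coeffsInQSqrt3_laurentPoly hE coeff_sinhXT_rat,
    coeffsInQSqrt3_laurentPoly hE coeff_coshXT_rat,
    coeffsInQSqrt3_laurentPoly hG coeff_expXT_rat,
    coeffsInQSqrt3_laurentPoly hK coeff_sinhXT_rat,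
    coeffsInQSqrt3_laurentPoly hK coeff_coshXT_rat,
    coeffsInQSqrt3_laurentPoly hU coeff_sinhXT_rat,
    coeffsInQSqrt3_laurentPoly hU coeff_coshXT_rat,
    coeffsInQSqrt3_laurentPoly hW coeff_expXT_rat,
    coeffsInQSqrt3_laurentPoly hC coeff_sinhXT_rat,
    coeffsInQSqrt3_laurentPoly hC coeff_coshXT_rat⟩

end

end LogIntegrals

namespace LogIntegrals

open Filter Topology

noncomputable section

/-! ### The cosecant and Bernoulli numbers -/

/-- The series with coefficients `(-1)^(n/2) pₙ`; it turns hyperbolic into circular functions. -/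
def twist (p : PowerSeries ℝ) : PowerSeries ℝ :=
  PowerSeries.mk fun n => (-1) ^ (n / 2) * PowerSeries.coeff n p

theorem twist_mul {p : PowerSeries ℝ} (hp : ∀ n, Odd n → PowerSeries.coeff n p = 0)
    (q : PowerSeries ℝ) : twist p * twist q = twist (p * q) := by
  ext n
  rw [twist, twist, twist, PowerSeries.coeff_mul, PowerSeries.coeff_mk, PowerSeries.coeff_mul,
    Finset.mul_sum]
  refine Finset.sum_congr rfl fun x hx => ?_
  rw [PowerSeries.coeff_mk, PowerSeries.coeff_mk, ← Finset.HasAntidiagonal.mem_antidiagonal.1 hx]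
  rcases Nat.even_or_odd' x.1 with ⟨k, h | h⟩
  · rw [h, show (2 * k + x.2) / 2 = k + x.2 / 2 by omega, show 2 * k / 2 = k by omega, pow_add]
    ring
  · simp [hp x.1 ⟨k, h⟩]

/-- The series of `z / sinh z`. -/
def cschSeries : PowerSeries ℝ :=
  PowerSeries.C 2 * bernoulliPowerSeries ℝ - PowerSeries.rescale 2 (bernoulliPowerSeries ℝ)

theorem coeff_cschSeries (n : ℕ) : PowerSeries.coeff n cschSeries =
    (2 - 2 ^ n) * ((bernoulli n : ℚ) : ℝ) / n.factorial := by
  simp [cschSeries, bernoulliPowerSeries, PowerSeries.coeff_rescale]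
  ring

theorem coeff_cschSeries_of_odd (n : ℕ) (hn : Odd n) : PowerSeries.coeff n cschSeries = 0 := by
  rw [coeff_cschSeries]
  rcases eq_or_ne n 1 with rfl | h
  · norm_num
  · rw [bernoulli_eq_zero_of_odd hn (by have := hn.pos; omega)]
    simp

theorem cschSeries_mul_sinh :
    cschSeries * sinhXT.map (evalRingHom (1 : ℝ)) = PowerSeries.X := by
  set e := PowerSeries.exp ℝ with he
  have h1 : sinhXT.map (evalRingHom (1 : ℝ)) + coshXT.map (evalRingHom (1 : ℝ)) = e := by
    rw [map_sinhXT_add_map_coshXT, PowerSeries.rescale_one, RingHom.id_apply]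
  have h2 := rescale_neg_exp 1
  rw [← he] at h2
  have h3 : e * PowerSeries.rescale (-1) e = 1 := PowerSeries.exp_mul_exp_neg_eq_one
  have h4 : e ^ 2 = PowerSeries.rescale 2 e := by
    simpa using PowerSeries.exp_pow_eq_rescale_exp (A := ℝ) 2
  have h5 : bernoulliPowerSeries ℝ * (e - 1) = PowerSeries.X :=
    bernoulliPowerSeries_mul_exp_sub_one ℝ
  have h6 := congrArg (PowerSeries.rescale (2 : ℝ)) h5
  rw [map_mul, map_sub, map_one, ← h4, PowerSeries.rescale_X] at h6
  have h7 : PowerSeries.C (2 : ℝ) = 2 := map_ofNat _ 2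
  have h8 : e ≠ 0 := fun h => by simp [h] at h3
  have h9 : (2 : PowerSeries ℝ) ≠ 0 := by
    rw [← h7]
    exact fun h => by simpa using congrArg PowerSeries.constantCoeff h
  rw [h7] at h6
  refine mul_left_cancel₀ h8 (mul_left_cancel₀ h9 ?_)
  rw [cschSeries, h7]
  linear_combination ((2 * bernoulliPowerSeries ℝ -
    PowerSeries.rescale 2 (bernoulliPowerSeries ℝ)) * e) * (h1 + h2) -
    (2 * bernoulliPowerSeries ℝ - PowerSeries.rescale 2 (bernoulliPowerSeries ℝ)) * h3 +
    2 * (e + 1) * h5 - h6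

theorem cscT_half_eq :
    cscT (1 / 2) = PowerSeries.mk fun n => if Even n then bernCoeff (n / 2) else 0 := by
  have h := congrArg (fun p => twist (PowerSeries.rescale (1 / 2) p)) cschSeries_mul_sinh
  simp only [map_mul] at h
  rw [← twist_mul (fun n hn => by rw [PowerSeries.coeff_rescale, coeff_cschSeries_of_odd n hn,
    mul_zero])] at h
  have hs : twist (PowerSeries.rescale (1 / 2) (sinhXT.map (evalRingHom (1 : ℝ)))) =
      sinSeries (1 / 2) 0 := by
    ext n
    rw [twist, PowerSeries.coeff_mk, PowerSeries.coeff_rescale, PowerSeries.coeff_map, sinhXT,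
      PowerSeries.coeff_mk, coeff_sinSeries]
    split_ifs
    · simp
      ring
    · simp
  have hX : twist (PowerSeries.rescale (1 / 2) PowerSeries.X) =
      PowerSeries.C (1 / 2) * PowerSeries.X := by
    ext n
    rw [twist, PowerSeries.coeff_mk, PowerSeries.rescale_X, PowerSeries.coeff_C_mul,
      PowerSeries.coeff_X]
    split_ifs with h <;> simp [h]
  rw [hs, hX] at h
  have h' : cscT (1 / 2) = PowerSeries.C 2 * twist (PowerSeries.rescale (1 / 2) cschSeries) := by
    refine mul_right_cancel₀ (sinSeries_zero_ne_zero (c := 1 / 2) (by norm_num)) ?_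
    rw [cscT_mul_sinSeries (by norm_num), mul_assoc, h, ← mul_assoc, ← map_mul]
    norm_num
  rw [h']
  ext n
  rw [PowerSeries.coeff_C_mul, twist, PowerSeries.coeff_mk, PowerSeries.coeff_rescale,
    PowerSeries.coeff_mk]
  rcases Nat.even_or_odd' n with ⟨k, rfl | rfl⟩
  · rw [if_pos (even_two_mul k), coeff_cschSeries, bernCoeff, show 2 * k / 2 = k by omega,
      zpow_sub_one₀ (by norm_num), zpow_sub_one₀ (by norm_num), zpow_natCast,
      show (2 : ℤ) * k = ((2 * k : ℕ) : ℤ) by push_cast; rfl, zpow_natCast, one_div_pow]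
    have := Nat.factorial_ne_zero (2 * k)
    field_simp
    ring
  · rw [if_neg (Nat.not_even_iff_odd.2 (odd_two_mul_add_one k)),
      coeff_cschSeries_of_odd _ (odd_two_mul_add_one k)]
    simp

/-! ### Reciprocals and partitions -/

/-- The coefficients of `1 / (1 - g)` as sums over partitions. -/
theorem coeff_inv_one_sub (w : ℕ → ℝ) (n : ℕ) :
    PowerSeries.coeff n (1 - PowerSeries.X * PowerSeries.mk fun j => w (j + 1))⁻¹ =
      ∑ p : n.Partition, ((p.parts.card.factorial : ℕ) : ℝ) /
        ((∏ j ∈ Finset.Icc 1 n, (p.parts.count j).factorial : ℕ) : ℝ) *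
        ∏ j ∈ Finset.Icc 1 n, w j ^ p.parts.count j := by
  set g := PowerSeries.X * PowerSeries.mk fun j => w (j + 1) with hg
  set gn : PowerSeries ℝ := ∑ j ∈ Finset.Icc 1 n, PowerSeries.C (w j) * PowerSeries.X ^ j with hgn
  have hg0 : PowerSeries.constantCoeff (1 - g) = 1 := by simp [hg]
  have hgX : PowerSeries.X ∣ g := Dvd.intro _ rfl
  have hgg : PowerSeries.X ^ (n + 1) ∣ g - gn := by
    rw [PowerSeries.X_pow_dvd_iff]
    intro i hi
    rw [map_sub, hgn, map_sum]
    simp only [PowerSeries.coeff_C_mul, PowerSeries.coeff_X_pow, mul_ite, mul_one, mul_zero,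
      Finset.sum_ite_eq, Finset.mem_Icc]
    cases i with
    | zero => simp [hg]
    | succ i => rw [hg, PowerSeries.coeff_succ_X_mul, PowerSeries.coeff_mk, if_pos (by omega),
        sub_self]
  have h1 : PowerSeries.coeff n (1 - g)⁻¹ =
      ∑ k ∈ Finset.range (n + 1), PowerSeries.coeff n (gn ^ k) := by
    have h2 : (1 - g)⁻¹ = ∑ k ∈ Finset.range (n + 1), g ^ k + g ^ (n + 1) * (1 - g)⁻¹ := by
      have h3 := PowerSeries.mul_inv_cancel (1 - g) (by rw [hg0]; exact one_ne_zero)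
      have h4 := geom_sum_mul_neg g (n + 1)
      linear_combination (∑ k ∈ Finset.range (n + 1), g ^ k) * h3 - (1 - g)⁻¹ * h4
    have h5 : PowerSeries.coeff n (g ^ (n + 1) * (1 - g)⁻¹) = 0 :=
      PowerSeries.X_pow_dvd_iff.1 (Dvd.dvd.mul_right (pow_dvd_pow_of_dvd hgX _) _) n n.lt_succ_self
    rw [h2, map_add, h5, add_zero, map_sum]
    refine Finset.sum_congr rfl fun k _ => ?_
    have h6 := PowerSeries.X_pow_dvd_iff.1 (hgg.trans (sub_dvd_pow_sub_pow g gn k)) n n.lt_succ_self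
    rwa [map_sub, sub_eq_zero] at h6
  have h2 : ∀ k, PowerSeries.coeff n (gn ^ k) =
      ∑ s ∈ ((Finset.Icc 1 n).sym k).filter (fun s => s.val.sum = n),
        (s.val.countPerms : ℝ) * (s.val.map w).prod := by
    intro k
    rw [hgn, Finset.sum_pow, map_sum, Finset.sum_filter]
    refine Finset.sum_congr rfl fun s _ => ?_
    have h3 : (s.val.map fun j => PowerSeries.C (w j) * PowerSeries.X ^ j).prod =
        PowerSeries.C (s.val.map w).prod * PowerSeries.X ^ s.val.sum := by
      rw [Multiset.prod_map_mul, map_multiset_prod, Multiset.map_map]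
      congr 1
      induction s.val using Multiset.induction_on with
      | empty => simp
      | cons a t ih => simp [ih, pow_add]
    rw [h3, ← nsmul_eq_mul, map_nsmul, PowerSeries.coeff_C_mul, PowerSeries.coeff_X_pow,
      nsmul_eq_mul]
    simp only [eq_comm (a := n), mul_ite, mul_one, mul_zero]
  rw [h1, Finset.sum_congr rfl fun k _ => h2 k, Finset.sum_sigma']
  symm
  have hmem : ∀ p : n.Partition, ∀ j ∈ p.parts, j ∈ Finset.Icc 1 n := fun p j hj =>
    Finset.mem_Icc.2 ⟨p.parts_pos hj, Nat.Partition.le_of_mem_parts hj⟩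
  refine Finset.sum_bij' (fun p _ => ⟨p.parts.card, ⟨p.parts, rfl⟩⟩)
    (fun x hx => ⟨x.2.1, fun {i} hi => ?_, ?_⟩) (fun p _ => ?_) (fun x _ => Finset.mem_univ _)
    (fun p _ => rfl) (fun x hx => ?_) (fun p _ => ?_)
  · have := (Finset.mem_filter.1 (Finset.mem_sigma.1 hx).2).1
    exact (Finset.mem_Icc.1 (Finset.mem_sym_iff.1 this i hi)).1
  · exact (Finset.mem_filter.1 (Finset.mem_sigma.1 hx).2).2
  · refine Finset.mem_sigma.2 ⟨Finset.mem_range.2 (Nat.lt_succ_of_le ?_), Finset.mem_filter.2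
      ⟨Finset.mem_sym_iff.2 (hmem p), p.parts_sum⟩⟩
    have := Multiset.card_nsmul_le_sum (fun x hx => p.parts_pos hx : ∀ x ∈ p.parts, 1 ≤ x)
    simpa [p.parts_sum] using this
  · obtain ⟨k, s, hs⟩ := x
    subst hs
    rfl
  · dsimp only
    have hsub : p.parts.toFinset ⊆ Finset.Icc 1 n := fun j hj =>
      hmem p j (Multiset.mem_toFinset.1 hj)
    have hprod : (p.parts.map w).prod = ∏ j ∈ Finset.Icc 1 n, w j ^ p.parts.count j := by
      rw [Finset.prod_multiset_map_count]
      refine Finset.prod_subset hsub fun j _ hj => ?_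
      rw [Multiset.count_eq_zero.2 (fun h => hj (Multiset.mem_toFinset.2 h)), pow_zero]
    have hcard : ∑ j ∈ Finset.Icc 1 n, p.parts.count j = p.parts.card :=
      Multiset.sum_count_eq_card (hmem p)
    have hcount : p.parts.countPerms = Nat.multinomial (Finset.Icc 1 n) (p.parts.count ·) := by
      rw [Multiset.countPerms, Finsupp.multinomial_eq_of_support_subset (s := Finset.Icc 1 n)]
      · rfl
      · simpa using hsub
    have hspec := Nat.multinomial_spec (Finset.Icc 1 n) (p.parts.count ·)
    rw [hcard] at hspec
    change _ = ((p.parts.countPerms : ℕ) : ℝ) * (p.parts.map w).prod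
    rw [hcount, hprod, ← hspec, Nat.cast_mul, mul_div_cancel_left₀]
    exact Nat.cast_ne_zero.2 (Finset.prod_ne_zero_iff.2 fun j _ => Nat.factorial_ne_zero _)

end

end LogIntegrals

namespace LogIntegrals

open Filter Topology

noncomputable section

/-- The coefficients `wⱼ` in `sin (T/2 - π/3) = -(√3/2) (1 - ∑ⱼ wⱼ Tʲ)`. -/
def muWeight (j : ℕ) : ℝ :=
  (if j % 4 = 0 ∨ j % 4 = 3 then -1 else 1) * (if Odd j then (√3)⁻¹ else 1) * (1 / 2) ^ j *
    (j.factorial : ℝ)⁻¹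

theorem sinSeries_half_eq : sinSeries (1 / 2) (-θ / 2) =
    PowerSeries.C (-(√3 / 2)) *
      (1 - PowerSeries.X * PowerSeries.mk fun j => muWeight (j + 1)) := by
  rw [sinSeries_eq, neg_div, Real.sin_neg, Real.cos_neg, sin_half_θ, cos_half_θ]
  ext n
  rw [map_add, PowerSeries.coeff_C_mul, PowerSeries.coeff_C_mul, PowerSeries.coeff_C_mul, map_sub,
    coeff_cosSeries, coeff_sinSeries]
  cases n with
  | zero => simp
  | succ n =>
    rw [PowerSeries.coeff_succ_X_mul, PowerSeries.coeff_mk, PowerSeries.coeff_one,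
      if_neg (Nat.succ_ne_zero n), muWeight]
    generalize n + 1 = j
    have h3 : √3 ≠ (0 : ℝ) := by positivity
    have hj := Nat.factorial_ne_zero j
    have key : (j % 4 = 0 ∨ j % 4 = 3) ↔ Odd ((j + 1) / 2 + 1) := by
      rw [Nat.odd_iff]
      omega
    rcases Nat.even_or_odd' j with ⟨k, rfl | rfl⟩
    · have e1 : (2 * k + 1) / 2 = k := by omega
      have e2 : 2 * k / 2 = k := by omega
      have o : ¬Odd (2 * k) := Nat.not_odd_iff_even.2 (even_two_mul k)
      simp only [key, e1, e2, o, even_two_mul, if_true, if_false]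
      rcases Nat.even_or_odd k with hk | hk
      · simp only [hk.add_one, hk.neg_one_pow, if_true]
        field_simp
        ring
      · simp only [Nat.not_odd_iff_even.2 hk.add_one, hk.neg_one_pow, if_false]
        field_simp
        ring
    · have e1 : (2 * k + 1 + 1) / 2 = k + 1 := by omega
      have e2 : (2 * k + 1) / 2 = k := by omega
      have o : ¬Even (2 * k + 1) := Nat.not_even_iff_odd.2 (odd_two_mul_add_one k)
      simp only [key, e1, e2, o, odd_two_mul_add_one, if_true, if_false]
      rcases Nat.even_or_odd k with hk | hk
      · simp only [Nat.not_odd_iff_even.2 hk.add_one.add_one, hk.neg_one_pow, if_false]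
        field_simp
        ring
      · simp only [hk.add_one.add_one, hk.neg_one_pow, if_true]
        field_simp
        ring

theorem prod_ite_pow_count (s : Finset ℕ) (P : ℕ → Prop) [DecidablePred P] (c : ℝ) (f : ℕ → ℕ) :
    ∏ j ∈ s, (if P j then c else 1) ^ f j = c ^ ∑ j ∈ s.filter P, f j := by
  rw [← Finset.prod_pow_eq_pow_sum, Finset.prod_filter]
  refine Finset.prod_congr rfl fun j _ => ?_
  split_ifs <;> simp

theorem sum_mul_count_parts {n : ℕ} (p : n.Partition) :
    ∑ j ∈ Finset.Icc 1 n, j * p.parts.count j = n := by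
  conv_rhs => rw [← p.parts_sum, Finset.sum_multiset_count]
  symm
  refine (Finset.sum_subset (fun j hj => ?_) fun j _ hj => ?_).trans
    (Finset.sum_congr rfl fun j _ => ?_)
  · rw [Multiset.mem_toFinset] at hj
    exact Finset.mem_Icc.2 ⟨p.parts_pos hj, Nat.Partition.le_of_mem_parts hj⟩
  · rw [Multiset.count_eq_zero.2 (fun h => hj (Multiset.mem_toFinset.2 h)), zero_smul]
  · rw [smul_eq_mul, mul_comm]

theorem prod_muWeight {n : ℕ} (p : n.Partition) :
    ∏ j ∈ Finset.Icc 1 n, muWeight j ^ p.parts.count j =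
      ((-1) ^ (∑ j ∈ (Finset.Icc 1 n).filter (fun j => j % 4 = 0 ∨ j % 4 = 3), p.parts.count j)
          / √3 ^ (∑ j ∈ (Finset.Icc 1 n).filter Odd, p.parts.count j)) * (1 / 2) ^ n
        * (1 / ((∏ j ∈ Finset.Icc 1 n, j.factorial ^ p.parts.count j : ℕ) : ℝ)) := by
  simp only [muWeight, mul_pow, Finset.prod_mul_distrib, prod_ite_pow_count]
  congr 1
  · congr 1
    · rw [inv_pow, div_eq_mul_inv]
    · refine Eq.trans ?_ (congrArg (fun i => (1 / 2 : ℝ) ^ i) (sum_mul_count_parts p))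
      simp only [← Finset.prod_pow_eq_pow_sum, pow_mul]
  · push_cast
    rw [one_div, ← Finset.prod_inv_distrib]
    exact Finset.prod_congr rfl fun j _ => inv_pow _ _

theorem inv_sinSeries_half_eq : (sinSeries (1 / 2) (-θ / 2))⁻¹ =
    PowerSeries.mk fun n => mu n / n.factorial := by
  rw [sinSeries_half_eq, PowerSeries.mul_inv_rev, PowerSeries.C_inv]
  ext n
  rw [PowerSeries.coeff_mul_C, coeff_inv_one_sub, PowerSeries.coeff_mk, mu, Finset.sum_mul,
    Finset.mul_sum, Finset.sum_div]
  refine Finset.sum_congr rfl fun p _ => ?_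
  rw [prod_muWeight, zpow_sub_one₀ (by norm_num), zpow_natCast]
  have h3 : √3 ≠ (0 : ℝ) := by positivity
  have hn : (n.factorial : ℝ) ≠ 0 := Nat.cast_ne_zero.2 (Nat.factorial_ne_zero n)
  have h1 : ((∏ j ∈ Finset.Icc 1 n, (p.parts.count j).factorial : ℕ) : ℝ) ≠ 0 :=
    Nat.cast_ne_zero.2 (Finset.prod_ne_zero_iff.2 fun j _ => Nat.factorial_ne_zero _)
  have h2 : ((∏ j ∈ Finset.Icc 1 n, j.factorial ^ p.parts.count j : ℕ) : ℝ) ≠ 0 :=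
    Nat.cast_ne_zero.2 (Finset.prod_ne_zero_iff.2 fun j _ =>
      pow_ne_zero _ (Nat.factorial_ne_zero _))
  rw [Nat.cast_mul, one_div_pow, ← neg_div, inv_div]
  field_simp

/-! ### The explicit formulas -/

theorem coeff_even_mul (e : ℕ → ℝ) (p : PowerSeries ℝ) (n N : ℕ) (hN : n / 2 ≤ N) :
    PowerSeries.coeff n ((PowerSeries.mk fun i => if Even i then e (i / 2) else 0) * p) =
      ∑ k ∈ Finset.range (N + 1), e k * if 2 * k ≤ n then PowerSeries.coeff (n - 2 * k) p else 0 := by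
  rw [PowerSeries.coeff_mul, Finset.Nat.sum_antidiagonal_eq_sum_range_succ_mk]
  simp only [PowerSeries.coeff_mk, ite_mul, zero_mul, mul_ite, mul_zero]
  rw [← Finset.sum_filter, ← Finset.sum_filter]
  refine Finset.sum_bij' (fun i _ => i / 2) (fun k _ => 2 * k) ?_ ?_ ?_ ?_ ?_
  · intro i hi
    rw [Finset.mem_filter, Finset.mem_range] at hi ⊢
    omega
  · intro k hk
    rw [Finset.mem_filter, Finset.mem_range] at hk ⊢
    exact ⟨by omega, even_two_mul k⟩
  · intro i hi
    exact Nat.two_mul_div_two_of_even (Finset.mem_filter.1 hi).2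
  · intro k _
    omega
  · intro i hi
    rw [Nat.two_mul_div_two_of_even (Finset.mem_filter.1 hi).2]

theorem coeff_odd_mul (o : ℕ → ℝ) (p : PowerSeries ℝ) (n : ℕ) :
    PowerSeries.coeff (n + 1) ((PowerSeries.mk fun i => if Odd i then o (i / 2) else 0) * p) =
      ∑ j ∈ Finset.range (n / 2 + 1), o j * PowerSeries.coeff (n - 2 * j) p := by
  have h : (PowerSeries.mk fun i => if Odd i then o (i / 2) else 0) =
      PowerSeries.X * PowerSeries.mk fun i => if Even i then o (i / 2) else 0 := by
    ext i
    cases i with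
    | zero => simp
    | succ i =>
      rw [PowerSeries.coeff_succ_X_mul, PowerSeries.coeff_mk, PowerSeries.coeff_mk]
      by_cases hi : Even i
      · rw [if_pos hi, if_pos hi.add_one]
        obtain ⟨k, rfl⟩ := hi
        congr 1
        omega
      · rw [if_neg hi, if_neg (Nat.not_odd_iff_even.2 (Nat.not_even_iff_odd.1 hi).add_one)]
  rw [h, mul_assoc, PowerSeries.coeff_succ_X_mul, coeff_even_mul o p n (n / 2) le_rfl]
  refine Finset.sum_congr rfl fun j hj => ?_
  rw [if_pos]
  have := Finset.mem_range.1 hj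
  omega

theorem coeff_cscT_mul_inv (n i N : ℕ) (hN : (n - 2 * i) / 2 ≤ N) (hi : 2 * i ≤ n) :
    PowerSeries.coeff (n - 2 * i) (cscT (1 / 2) * (sinSeries (1 / 2) (-θ / 2))⁻¹) =
      ∑ k ∈ Finset.range (N + 1), bernCoeff k * muDiv ((n : ℤ) - 2 * i - 2 * k) := by
  rw [cscT_half_eq, inv_sinSeries_half_eq, coeff_even_mul bernCoeff _ _ N hN]
  refine Finset.sum_congr rfl fun k _ => ?_
  rw [muDiv, PowerSeries.coeff_mk]
  congr 1
  have e : ((n : ℤ) - 2 * i - 2 * k).toNat = n - 2 * i - 2 * k := by omega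
  rw [e]
  split_ifs with h1 h2 h2
  · rfl
  · omega
  · omega
  · rfl

theorem map_sinhXT_eq (x : ℝ) : sinhXT.map (evalRingHom x) =
    PowerSeries.mk fun i => if Odd i then
      (fun j => x ^ (2 * j + 1) / ((2 * j + 1).factorial : ℝ)) (i / 2) else 0 := by
  ext i
  rw [PowerSeries.coeff_map, sinhXT, PowerSeries.coeff_mk, PowerSeries.coeff_mk]
  split_ifs with h
  · dsimp only
    rw [Nat.two_mul_div_two_add_one_of_odd h]
    simp
    ring
  · simp

theorem map_coshXT_eq (x : ℝ) : coshXT.map (evalRingHom x) =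
    PowerSeries.mk fun i => if Even i then
      (fun j => x ^ (2 * j) / ((2 * j).factorial : ℝ)) (i / 2) else 0 := by
  ext i
  rw [PowerSeries.coeff_map, coshXT, PowerSeries.coeff_mk, PowerSeries.coeff_mk]
  split_ifs with h
  · dsimp only
    rw [Nat.two_mul_div_two_of_even h]
    simp
    ring
  · simp

theorem polyA_eq_explicitA (m : ℕ) : polyA m = explicitA m := by
  refine Polynomial.funext fun x => ?_
  rw [polyA, kernelA_eq', eval_laurentPoly_nat, mul_comm _ (cscT _), mul_comm _ (PowerSeries.map _ _),
    map_sinhXT_eq,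
    coeff_odd_mul (fun j => x ^ (2 * j + 1) / ((2 * j + 1).factorial : ℝ)), explicitA, eval_mul, eval_C, eval_finsetSum]
  congr 1
  refine Finset.sum_congr rfl fun j hj => ?_
  have := Finset.mem_range.1 hj
  rw [coeff_cscT_mul_inv m j ((m + 1) / 2) (by omega) (by omega)]
  simp only [eval_mul, eval_C, eval_pow, eval_X]
  ring

theorem polyB_eq_explicitB (m : ℕ) : polyB m = explicitB m := by
  refine Polynomial.funext fun x => ?_
  rw [polyB, kernelA_eq', eval_laurentPoly_nat, mul_comm _ (cscT _), mul_comm _ (PowerSeries.map _ _),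
    map_coshXT_eq,
    coeff_even_mul (fun j => x ^ (2 * j) / ((2 * j).factorial : ℝ)) _ _ ((m + 1) / 2) le_rfl, explicitB, eval_mul, eval_C,
    eval_finsetSum]
  congr 1
  refine Finset.sum_congr rfl fun j hj => ?_
  have := Finset.mem_range.1 hj
  rw [if_pos (by omega), coeff_cscT_mul_inv (m + 1) j ((m + 1) / 2) (by omega) (by omega)]
  simp only [eval_mul, eval_C, eval_pow, eval_X]
  have e : ∀ k : ℕ, ((m + 1 : ℕ) : ℤ) - 2 * j - 2 * k = (m : ℤ) - 2 * j - 2 * k + 1 := fun k => by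
    push_cast
    ring
  simp only [e]
  ring

end

end LogIntegrals

namespace LogIntegrals

open Filter Topology MeasureTheory ProbabilityTheory

noncomputable section

/-! ### Moments of the logistic distribution -/

/-- The function `log (x / (1 - x))`, a logistic random variable on `(0, 1)`. -/
def logit (x : ℝ) : ℝ := Real.log (x / (1 - x))

/-- The moments of `logit`. -/
def logitMoment (k : ℕ) : ℝ := ∫ x in Set.Ioo (0 : ℝ) 1, logit x ^ k

theorem exp_mul_logit {x : ℝ} (hx : x ∈ Set.Ioo (0 : ℝ) 1) (s : ℝ) :
    ((Real.exp (s * logit x) : ℝ) : ℂ) =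
      (x : ℂ) ^ ((1 + s : ℂ) - 1) * (1 - (x : ℂ)) ^ ((1 - s : ℂ) - 1) := by
  have h0 := hx.1
  have h1 : 0 < 1 - x := sub_pos.2 hx.2
  have e1 : (x : ℂ) ^ ((1 + s : ℂ) - 1) = ((x ^ s : ℝ) : ℂ) := by
    rw [Complex.ofReal_cpow h0.le]
    congr 1
    ring
  have e2 : (1 - (x : ℂ)) ^ ((1 - s : ℂ) - 1) = (((1 - x) ^ (-s) : ℝ) : ℂ) := by
    rw [Complex.ofReal_cpow h1.le]
    push_cast
    congr 1
    ring
  rw [e1, e2, ← Complex.ofReal_mul, Real.rpow_def_of_pos h0, Real.rpow_def_of_pos h1,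
    ← Real.exp_add, logit, Real.log_div h0.ne' h1.ne']
  congr 2
  ring

theorem integrable_exp_mul_logit {s : ℝ} (hs : |s| < 1) :
    IntegrableOn (fun x => Real.exp (s * logit x)) (Set.Ioo 0 1) := by
  rw [abs_lt] at hs
  have h := Complex.betaIntegral_convergent (u := 1 + s) (v := 1 - s)
    (by simp; linarith) (by simp; linarith)
  rw [intervalIntegrable_iff_integrableOn_Ioo_of_le zero_le_one] at h
  have h' : IntegrableOn (fun x => ((Real.exp (s * logit x) : ℝ) : ℂ)) (Set.Ioo 0 1) :=
    h.congr_fun (fun x hx => (exp_mul_logit hx s).symm) measurableSet_Ioo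
  exact h'.re

theorem mgf_logit {s : ℝ} (hs : |s| < 1) (hs0 : s ≠ 0) :
    mgf logit (volume.restrict (Set.Ioo 0 1)) s = Real.pi * s / Real.sin (Real.pi * s) := by
  rw [abs_lt] at hs
  have h1 : ((mgf logit (volume.restrict (Set.Ioo 0 1)) s : ℝ) : ℂ) =
      Complex.betaIntegral (1 + s) (1 - s) := by
    rw [mgf, Complex.betaIntegral, intervalIntegral.integral_of_le zero_le_one,
      integral_Ioc_eq_integral_Ioo, ← integral_complex_ofReal]
    exact setIntegral_congr_fun measurableSet_Ioo fun x hx => exp_mul_logit hx s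
  have h2 := Complex.Gamma_mul_Gamma_eq_betaIntegral (s := 1 + s) (t := 1 - s)
    (by simp; linarith) (by simp; linarith)
  have h3 : (1 + s + (1 - s) : ℂ) = (1 : ℕ) + 1 := by
    push_cast
    ring
  rw [h3, Complex.Gamma_nat_eq_factorial, Nat.factorial_one, Nat.cast_one, one_mul, ← h1,
    add_comm, Complex.Gamma_add_one _ (Complex.ofReal_ne_zero.2 hs0), mul_assoc,
    Complex.Gamma_mul_Gamma_one_sub] at h2
  apply Complex.ofReal_injective
  rw [← h2]
  push_cast
  ring

theorem zero_mem_interior_integrableExpSet_logit :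
    (0 : ℝ) ∈ interior (integrableExpSet logit (volume.restrict (Set.Ioo 0 1))) := by
  rw [mem_interior_iff_mem_nhds]
  filter_upwards [Metric.ball_mem_nhds (0 : ℝ) one_pos] with s hs
  exact integrable_exp_mul_logit (by simpa using hs)

theorem integrable_logit_pow (k : ℕ) : IntegrableOn (fun x => logit x ^ k) (Set.Ioo 0 1) :=
  integrable_pow_of_mem_interior_integrableExpSet zero_mem_interior_integrableExpSet_logit k

theorem mk_logitMoment : (PowerSeries.mk fun k => logitMoment k / k.factorial) =
    PowerSeries.C Real.pi * cscT Real.pi := by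
  have h : Represents (PowerSeries.mk fun k => logitMoment k / k.factorial)
      (mgf logit (volume.restrict (Set.Ioo 0 1))) := by
    rw [Represents.iff_hasFPowerSeriesAt]
    have := hasFPowerSeriesAt_mgf zero_mem_interior_integrableExpSet_logit
    simpa [logitMoment] using this
  refine h.eq_of_eventually_punctured
    ((Represents.const Real.pi).mul (Represents.cscT Real.pi_ne_zero)) ?_
  filter_upwards [nhdsWithin_le_nhds (Metric.ball_mem_nhds (0 : ℝ) one_pos),
    self_mem_nhdsWithin] with s hs (hs0 : s ≠ 0)
  rw [mgf_logit (by simpa using hs) hs0, if_neg hs0, mul_div_assoc]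

theorem image_div_one_sub : (fun x : ℝ => x / (1 - x)) '' Set.Ioo 0 1 = Set.Ioi 0 := by
  ext t
  constructor
  · rintro ⟨x, hx, rfl⟩
    exact div_pos hx.1 (sub_pos.2 hx.2)
  · intro (ht : 0 < t)
    refine ⟨t / (1 + t), ⟨by positivity, ?_⟩, ?_⟩
    · rw [div_lt_one (by positivity)]
      linarith
    · have : 1 + t ≠ 0 := by positivity
      dsimp only
      field_simp
      ring

theorem hasDerivWithinAt_div_one_sub {x : ℝ} (hx : x ∈ Set.Ioo (0 : ℝ) 1) :
    HasDerivWithinAt (fun x : ℝ => x / (1 - x)) (((1 - x) ^ 2)⁻¹) (Set.Ioo 0 1) x := by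
  have h1 : 1 - x ≠ 0 := (sub_pos.2 hx.2).ne'
  have := ((hasDerivAt_id x).div ((hasDerivAt_id x).const_sub 1) h1).hasDerivWithinAt
    (s := Set.Ioo 0 1)
  refine this.congr_deriv ?_
  simp only [id]
  field_simp
  ring

theorem injOn_div_one_sub : Set.InjOn (fun x : ℝ => x / (1 - x)) (Set.Ioo 0 1) := by
  intro x hx y hy h
  have h1 : 1 - x ≠ 0 := (sub_pos.2 hx.2).ne'
  have h2 : 1 - y ≠ 0 := (sub_pos.2 hy.2).ne'
  dsimp only at h
  rw [div_eq_div_iff h1 h2] at h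
  linarith

theorem abs_deriv_smul_logit {x : ℝ} (hx : x ∈ Set.Ioo (0 : ℝ) 1) (k : ℕ) :
    |((1 - x) ^ 2)⁻¹| • (Real.log (x / (1 - x)) ^ k / (1 + x / (1 - x)) ^ 2) = logit x ^ k := by
  have h1 : 1 - x ≠ 0 := (sub_pos.2 hx.2).ne'
  rw [abs_of_nonneg (by positivity), smul_eq_mul, logit]
  have : 1 + x / (1 - x) = (1 - x)⁻¹ := by
    field_simp
    ring
  rw [this]
  field_simp

theorem integrableOn_log_pow_div (k : ℕ) :
    IntegrableOn (fun t => Real.log t ^ k / (1 + t) ^ 2) (Set.Ioi 0) := by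
  rw [← image_div_one_sub, integrableOn_image_iff_integrableOn_abs_deriv_smul measurableSet_Ioo
    (fun x hx => hasDerivWithinAt_div_one_sub hx) injOn_div_one_sub]
  exact (integrable_logit_pow k).congr_fun (fun x hx => (abs_deriv_smul_logit hx k).symm)
    measurableSet_Ioo

theorem integral_log_pow_div (k : ℕ) :
    ∫ t in Set.Ioi (0 : ℝ), Real.log t ^ k / (1 + t) ^ 2 = logitMoment k := by
  rw [← image_div_one_sub, integral_image_eq_integral_abs_deriv_smul measurableSet_Ioo
    (fun x hx => hasDerivWithinAt_div_one_sub hx) injOn_div_one_sub, logitMoment]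
  exact setIntegral_congr_fun measurableSet_Ioo (fun x hx => abs_deriv_smul_logit hx k)

theorem integrableOn_abs_log_pow_div (k : ℕ) :
    IntegrableOn (fun t => |Real.log t| ^ k / (1 + t) ^ 2) (Set.Ioi 0) := by
  refine (integrableOn_log_pow_div k).norm.congr (Eventually.of_forall fun t => ?_)
  simp

end

end LogIntegrals

namespace LogIntegrals

open Filter Topology MeasureTheory ProbabilityTheory

noncomputable section

/-! ### The basic integral `∫₀^∞ logᵐ t (1 / (t + exp z) - 1 / (t + 1)) dt` -/

/-- The strip `|Im z| < π`. -/
def strip : Set ℂ := {z | |z.im| < Real.pi}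

theorem isOpen_strip : IsOpen strip :=
  isOpen_lt (continuous_abs.comp Complex.continuous_im) continuous_const

theorem convex_strip : Convex ℝ strip := by
  have : strip = Complex.imLm ⁻¹' Set.Ioo (-Real.pi) Real.pi := by
    ext z
    simp [strip, abs_lt]
  rw [this]
  exact (convex_Ioo _ _).linear_preimage _

theorem ofReal_mem_strip (x : ℝ) : (x : ℂ) ∈ strip := by
  simp [strip, Real.pi_pos]

theorem norm_add_exp_ge (t : ℝ) (z : ℂ) :
    Real.cos (z.im / 2) * (t + Real.exp z.re) ≤ ‖(t : ℂ) + Complex.exp z‖ := by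
  refine le_of_sq_le_sq ?_ (norm_nonneg _)
  rw [← Complex.normSq_eq_norm_sq, Complex.normSq_apply, mul_pow, Real.cos_sq]
  simp only [Complex.add_re, Complex.add_im, Complex.ofReal_re, Complex.ofReal_im, Complex.exp_re,
    Complex.exp_im, zero_add]
  rw [show 2 * (z.im / 2) = z.im by ring]
  have h1 := Real.cos_le_one z.im
  have h2 := Real.sin_sq_add_cos_sq z.im
  have h3 : 0 ≤ (1 - Real.cos z.im) / 2 * (t - Real.exp z.re) ^ 2 :=
    mul_nonneg (by linarith) (sq_nonneg _)
  have e : (t + Real.exp z.re * Real.cos z.im) * (t + Real.exp z.re * Real.cos z.im) +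
      Real.exp z.re * Real.sin z.im * (Real.exp z.re * Real.sin z.im) -
      (1 / 2 + Real.cos z.im / 2) * (t + Real.exp z.re) ^ 2 =
      (1 - Real.cos z.im) / 2 * (t - Real.exp z.re) ^ 2 := by
    linear_combination (Real.exp z.re ^ 2) * h2
  linarith

theorem add_exp_ne_zero {t : ℝ} (ht : 0 ≤ t) {z : ℂ} (hz : z ∈ strip) :
    (t : ℂ) + Complex.exp z ≠ 0 := by
  have hc : 0 < Real.cos (z.im / 2) := by
    have := abs_lt.1 (show |z.im| < Real.pi from hz)
    exact Real.cos_pos_of_mem_Ioo ⟨by linarith, by linarith⟩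
  have := norm_add_exp_ge t z
  refine norm_pos_iff.1 (lt_of_lt_of_le ?_ this)
  positivity

/-- Near a point of the strip, `|t + exp z|` is bounded below by a multiple of `1 + t`. -/
theorem eventually_norm_add_exp_ge {z₀ : ℂ} (hz₀ : z₀ ∈ strip) : ∃ c > 0, ∀ᶠ z in 𝓝 z₀,
    z ∈ strip ∧ ∀ t : ℝ, 0 ≤ t → c * (1 + t) ≤ ‖(t : ℂ) + Complex.exp z‖ := by
  have hpos : ∀ z ∈ strip, 0 < Real.cos (z.im / 2) := fun z hz => by
    have := abs_lt.1 (show |z.im| < Real.pi from hz)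
    exact Real.cos_pos_of_mem_Ioo ⟨by linarith, by linarith⟩
  have hm : 0 < min 1 (Real.exp z₀.re) := lt_min one_pos (Real.exp_pos _)
  refine ⟨Real.cos (z₀.im / 2) * min 1 (Real.exp z₀.re) / 2, by
    have := hpos z₀ hz₀
    positivity, ?_⟩
  have hcont : ContinuousAt (fun z : ℂ => Real.cos (z.im / 2) * min 1 (Real.exp z.re)) z₀ := by
    fun_prop
  have hlt : Real.cos (z₀.im / 2) * min 1 (Real.exp z₀.re) / 2 <
      Real.cos (z₀.im / 2) * min 1 (Real.exp z₀.re) :=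
    half_lt_self (mul_pos (hpos z₀ hz₀) hm)
  filter_upwards [isOpen_strip.mem_nhds hz₀, hcont.eventually_const_lt hlt] with z hz hlt
  refine ⟨hz, fun t ht => le_trans ?_ (norm_add_exp_ge t z)⟩
  have h1 : min 1 (Real.exp z.re) * (1 + t) ≤ t + Real.exp z.re := by
    have := min_le_left 1 (Real.exp z.re)
    have := min_le_right 1 (Real.exp z.re)
    nlinarith
  calc _ ≤ Real.cos (z.im / 2) * min 1 (Real.exp z.re) * (1 + t) := by gcongr
    _ = Real.cos (z.im / 2) * (min 1 (Real.exp z.re) * (1 + t)) := by ring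
    _ ≤ _ := mul_le_mul_of_nonneg_left h1 (hpos z hz).le

/-- The integrand `logᵐ t (1 / (t + exp z) - 1 / (t + 1))`. -/
def logKernel (m : ℕ) (z : ℂ) (t : ℝ) : ℂ :=
  (Real.log t : ℂ) ^ m * (((t : ℂ) + Complex.exp z)⁻¹ - ((t : ℂ) + 1)⁻¹)

theorem measurable_logKernel (m : ℕ) (z : ℂ) : Measurable (logKernel m z) := by
  unfold logKernel
  fun_prop

theorem integrableOn_logKernel (m : ℕ) {z : ℂ} (hz : z ∈ strip) :
    IntegrableOn (logKernel m z) (Set.Ioi 0) := by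
  obtain ⟨c, hc, h⟩ := eventually_norm_add_exp_ge hz
  have h := h.self_of_nhds.2
  refine Integrable.mono' ((integrableOn_abs_log_pow_div m).const_mul (c⁻¹ * ‖1 - Complex.exp z‖))
    (measurable_logKernel m z).aestronglyMeasurable ?_
  filter_upwards [ae_restrict_mem measurableSet_Ioi] with t (ht : 0 < t)
  have h1 : (t : ℂ) + 1 ≠ 0 := by
    exact_mod_cast (by positivity : t + 1 ≠ 0)
  have h2 := add_exp_ne_zero ht.le hz
  have e : ((t : ℂ) + Complex.exp z)⁻¹ - ((t : ℂ) + 1)⁻¹ =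
      (1 - Complex.exp z) / (((t : ℂ) + Complex.exp z) * ((t : ℂ) + 1)) := by
    field_simp
    ring
  have h3 : ‖(t : ℂ) + 1‖ = 1 + t := by
    rw [add_comm, show (1 : ℂ) + t = ((1 + t : ℝ) : ℂ) by push_cast; rfl, Complex.norm_real,
      Real.norm_of_nonneg (by positivity)]
  rw [logKernel, e, norm_mul, norm_pow, norm_div, norm_mul, h3, Complex.norm_real, Real.norm_eq_abs]
  calc |Real.log t| ^ m * (‖1 - Complex.exp z‖ / (‖(t : ℂ) + Complex.exp z‖ * (1 + t)))
      ≤ |Real.log t| ^ m * (‖1 - Complex.exp z‖ / (c * (1 + t) * (1 + t))) := by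
        gcongr
        exact h t ht.le
    _ = _ := by
        field_simp

/-- The derivative of `logKernel` in `z`. -/
def logKernelDeriv (m : ℕ) (z : ℂ) (t : ℝ) : ℂ :=
  -((Real.log t : ℂ) ^ m * (Complex.exp z / ((t : ℂ) + Complex.exp z) ^ 2))

theorem hasDerivAt_integral_logKernel (m : ℕ) {z : ℂ} (hz : z ∈ strip) :
    HasDerivAt (fun z => ∫ t in Set.Ioi (0 : ℝ), logKernel m z t)
      (∫ t in Set.Ioi (0 : ℝ), logKernelDeriv m z t) z := by
  obtain ⟨c, hc, h⟩ := eventually_norm_add_exp_ge hz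
  have hexp : ∀ᶠ w in 𝓝 z, ‖Complex.exp w‖ < ‖Complex.exp z‖ + 1 :=
    (Complex.continuous_exp.norm.continuousAt (x := z)).eventually_lt_const (lt_add_one _)
  refine (hasDerivAt_integral_of_dominated_loc_of_deriv_le (h.and hexp)
    (Eventually.of_forall fun w => (measurable_logKernel m w).aestronglyMeasurable)
    (integrableOn_logKernel m hz) ?_ (F' := logKernelDeriv m)
    (bound := fun t => (‖Complex.exp z‖ + 1) / c ^ 2 * (|Real.log t| ^ m / (1 + t) ^ 2))
    ?_ ((integrableOn_abs_log_pow_div m).const_mul _) ?_).2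
  · refine Measurable.aestronglyMeasurable ?_
    unfold logKernelDeriv
    fun_prop
  · filter_upwards [ae_restrict_mem measurableSet_Ioi] with t (ht : 0 < t)
    rintro w ⟨⟨-, hw⟩, hw'⟩
    rw [logKernelDeriv, norm_neg, norm_mul, norm_pow, norm_div, norm_pow, Complex.norm_real,
      Real.norm_eq_abs]
    calc |Real.log t| ^ m * (‖Complex.exp w‖ / ‖(t : ℂ) + Complex.exp w‖ ^ 2)
        ≤ |Real.log t| ^ m * ((‖Complex.exp z‖ + 1) / (c * (1 + t)) ^ 2) := by
          gcongr
          exact hw t ht.le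
      _ = _ := by
          field_simp
  · filter_upwards [ae_restrict_mem measurableSet_Ioi] with t (ht : 0 < t)
    rintro w ⟨⟨hw, -⟩, -⟩
    have h1 := ((Complex.hasDerivAt_exp w).const_add (t : ℂ)).fun_inv (add_exp_ne_zero ht.le hw)
    refine ((h1.sub_const (((t : ℂ) + 1)⁻¹)).const_mul ((Real.log t : ℂ) ^ m)).congr_deriv ?_
    rw [logKernelDeriv]
    ring

theorem integral_logKernelDeriv_ofReal (m : ℕ) (L : ℝ) :
    ∫ t in Set.Ioi (0 : ℝ), logKernelDeriv m L t =
      ((-∑ k ∈ Finset.range (m + 1), logitMoment k * L ^ (m - k) * m.choose k : ℝ) : ℂ) := by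
  have e : ∀ t : ℝ, logKernelDeriv m L t = ((-(Real.log t ^ m *
      (Real.exp L / (t + Real.exp L) ^ 2)) : ℝ) : ℂ) := fun t => by
    rw [logKernelDeriv]
    push_cast
    rfl
  simp only [e]
  rw [integral_complex_ofReal]
  congr 1
  rw [integral_neg]
  congr 1
  have h := integral_comp_mul_left_Ioi (fun t => Real.log t ^ m *
      (Real.exp L / (t + Real.exp L) ^ 2)) 0 (Real.exp_pos L)
  rw [mul_zero, smul_eq_mul, eq_inv_mul_iff_mul_eq₀ (Real.exp_pos L).ne'] at h
  rw [← h, ← integral_const_mul]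
  have e2 : ∀ t ∈ Set.Ioi (0 : ℝ), Real.exp L * (Real.log (Real.exp L * t) ^ m *
      (Real.exp L / (Real.exp L * t + Real.exp L) ^ 2)) =
      ∑ k ∈ Finset.range (m + 1), L ^ (m - k) * m.choose k * (Real.log t ^ k / (1 + t) ^ 2) := by
    intro t (ht : 0 < t)
    rw [Real.log_mul (Real.exp_pos L).ne' ht.ne', Real.log_exp, add_comm L, add_pow, Finset.sum_mul,
      Finset.mul_sum]
    refine Finset.sum_congr rfl fun k _ => ?_
    have h1 : 1 + t ≠ 0 := by positivity
    have h2 := (Real.exp_pos L).ne'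
    rw [show Real.exp L * t + Real.exp L = Real.exp L * (1 + t) by ring]
    field_simp
  rw [setIntegral_congr_fun measurableSet_Ioi e2, integral_finsetSum]
  · refine Finset.sum_congr rfl fun k _ => ?_
    rw [integral_const_mul, integral_log_pow_div]
    ring
  · exact fun k _ => (integrableOn_log_pow_div k).const_mul _

/-- The polynomial in `z` that evaluates the basic integral. -/
def logPoly (m : ℕ) (z : ℂ) : ℂ :=
  -∑ k ∈ Finset.range (m + 1), logitMoment k * (z ^ (m - k + 1) / ((m - k : ℕ) + 1)) * m.choose k

theorem hasDerivAt_logPoly (m : ℕ) (z : ℂ) : HasDerivAt (logPoly m)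
    (-∑ k ∈ Finset.range (m + 1), logitMoment k * z ^ (m - k) * m.choose k) z := by
  refine HasDerivAt.neg (HasDerivAt.fun_sum fun k _ => ?_)
  refine ((((hasDerivAt_pow (m - k + 1) z).div_const _).const_mul _).mul_const _).congr_deriv ?_
  have : ((m - k : ℕ) : ℂ) + 1 ≠ 0 := by exact_mod_cast Nat.succ_ne_zero (m - k)
  rw [Nat.add_sub_cancel]
  push_cast
  field_simp

theorem continuous_logPoly (m : ℕ) : Continuous (logPoly m) :=
  continuous_iff_continuousAt.2 fun z => (hasDerivAt_logPoly m z).continuousAt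

theorem logPoly_zero (m : ℕ) : logPoly m 0 = 0 := by
  simp [logPoly]

theorem integral_logKernel_ofReal (m : ℕ) (L : ℝ) :
    ∫ t in Set.Ioi (0 : ℝ), logKernel m L t = logPoly m L := by
  have hd : ∀ x : ℝ, HasDerivAt (fun x : ℝ => (∫ t in Set.Ioi (0 : ℝ), logKernel m x t) -
      logPoly m x) 0 x := fun x => by
    have h := (hasDerivAt_integral_logKernel m (ofReal_mem_strip x)).sub (hasDerivAt_logPoly m x)
    refine h.comp_ofReal.congr_deriv ?_
    rw [integral_logKernelDeriv_ofReal]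
    push_cast
    ring
  have hc := is_const_of_deriv_eq_zero (fun x => (hd x).differentiableAt)
    (fun x => (hd x).deriv) L 0
  have h0 : ∀ t, logKernel m 0 t = 0 := fun t => by simp [logKernel]
  simp only [Complex.ofReal_zero, h0, logPoly_zero, integral_zero, sub_zero] at hc
  exact sub_eq_zero.1 hc

theorem integral_logKernel (m : ℕ) {z : ℂ} (hz : z ∈ strip) :
    ∫ t in Set.Ioi (0 : ℝ), logKernel m z t = logPoly m z := by
  have h1 : AnalyticOnNhd ℂ (fun z => ∫ t in Set.Ioi (0 : ℝ), logKernel m z t) strip :=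
    DifferentiableOn.analyticOnNhd (fun z hz =>
      (hasDerivAt_integral_logKernel m hz).differentiableAt.differentiableWithinAt) isOpen_strip
  have h2 : AnalyticOnNhd ℂ (logPoly m) strip :=
    DifferentiableOn.analyticOnNhd (fun z _ =>
      (hasDerivAt_logPoly m z).differentiableAt.differentiableWithinAt) isOpen_strip
  refine h1.eqOn_of_preconnected_of_frequently_eq h2 convex_strip.isPreconnected
    (ofReal_mem_strip 0) ?_ hz
  have ht : Tendsto (fun x : ℝ => (x : ℂ)) (𝓝[≠] 0) (𝓝[≠] ((0 : ℝ) : ℂ)) :=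
    Complex.continuous_ofReal.continuousWithinAt.tendsto_nhdsWithin fun x hx => by simpa using hx
  exact ht.frequently (Eventually.of_forall fun x => integral_logKernel_ofReal m x).frequently

/-! ### Real and imaginary parts -/

theorem logPoly_eq_coeff (m : ℕ) (z : ℂ) : logPoly m z = -(m.factorial * PowerSeries.coeff (m + 1)
    ((PowerSeries.mk fun k => logitMoment k / k.factorial).map Complex.ofRealHom *
      (PowerSeries.rescale z (PowerSeries.exp ℂ) - 1))) := by
  rw [logPoly, PowerSeries.coeff_mul, Finset.Nat.sum_antidiagonal_eq_sum_range_succ_mk,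
    Finset.sum_range_succ _ (m + 1), neg_inj, mul_add, Finset.mul_sum, ← add_zero (Finset.sum _ _)]
  congr 1
  · refine Finset.sum_congr rfl fun k hk => ?_
    have hk : k ≤ m := Nat.lt_succ_iff.1 (Finset.mem_range.1 hk)
    rw [show m + 1 - k = m - k + 1 by omega, map_sub, PowerSeries.coeff_rescale,
      PowerSeries.coeff_exp, PowerSeries.coeff_one, if_neg (Nat.succ_ne_zero _),
      PowerSeries.coeff_map, PowerSeries.coeff_mk, Nat.cast_choose ℂ hk, Nat.factorial_succ]
    have h1 := Nat.factorial_ne_zero k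
    have h2 := Nat.factorial_ne_zero (m - k)
    have h3 : ((m - k : ℕ) : ℂ) + 1 ≠ 0 := by exact_mod_cast Nat.succ_ne_zero (m - k)
    simp
    field_simp
  · have h : PowerSeries.coeff 0 (PowerSeries.rescale z (PowerSeries.exp ℂ) - 1) = 0 := by
      rw [map_sub, PowerSeries.coeff_rescale]
      simp
    rw [Nat.sub_self, h, mul_zero, mul_zero]

theorem rescale_exp_ofReal_mul_I (φ : ℝ) :
    PowerSeries.rescale ((φ : ℂ) * Complex.I) (PowerSeries.exp ℂ) =
      (cosSeries φ 0).map Complex.ofRealHom +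
        PowerSeries.C Complex.I * (sinSeries φ 0).map Complex.ofRealHom := by
  ext n
  rw [map_add, PowerSeries.coeff_C_mul, PowerSeries.coeff_map, PowerSeries.coeff_map,
    coeff_cosSeries, coeff_sinSeries, PowerSeries.coeff_rescale, PowerSeries.coeff_exp]
  rcases Nat.even_or_odd' n with ⟨k, rfl | rfl⟩
  · have o : ¬Odd (2 * k) := Nat.not_odd_iff_even.2 (even_two_mul k)
    rw [if_pos (even_two_mul k), if_neg o, mul_pow, pow_mul Complex.I, Complex.I_sq]
    simp
    ring
  · have o : ¬Even (2 * k + 1) := Nat.not_even_iff_odd.2 (odd_two_mul_add_one k)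
    rw [if_pos (odd_two_mul_add_one k), if_neg o, mul_pow, pow_succ Complex.I, pow_mul Complex.I,
      Complex.I_sq, show (2 * k + 1) / 2 = k by omega]
    simp
    ring

theorem rescale_exp_ofReal_add (L φ : ℝ) :
    PowerSeries.rescale ((L : ℂ) + φ * Complex.I) (PowerSeries.exp ℂ) =
      (cosSeries φ 0 * PowerSeries.rescale L (PowerSeries.exp ℝ)).map Complex.ofRealHom +
        PowerSeries.C Complex.I *
          (sinSeries φ 0 * PowerSeries.rescale L (PowerSeries.exp ℝ)).map Complex.ofRealHom := by
  have h : PowerSeries.rescale (L : ℂ) (PowerSeries.exp ℂ) =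
      (PowerSeries.rescale L (PowerSeries.exp ℝ)).map Complex.ofRealHom := by
    rw [← PowerSeries.rescale_map, PowerSeries.map_exp]
    rfl
  rw [← PowerSeries.exp_mul_exp_eq_exp_add, rescale_exp_ofReal_mul_I, h, map_mul, map_mul]
  ring

theorem logPoly_ofReal_add (m : ℕ) (L φ : ℝ) : logPoly m (L + φ * Complex.I) =
    ((-(Real.pi * (ev (cosCsc φ Real.pi) m L -
      m.factorial * PowerSeries.coeff (m + 1) (cscT Real.pi))) : ℝ) : ℂ) +
    ((-(Real.pi * ev (sinCsc φ Real.pi) m L) : ℝ) : ℂ) * Complex.I := by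
  rw [logPoly_eq_coeff, mk_logitMoment, rescale_exp_ofReal_add]
  have e : (PowerSeries.C Real.pi * cscT Real.pi).map Complex.ofRealHom *
      ((cosSeries φ 0 * PowerSeries.rescale L (PowerSeries.exp ℝ)).map Complex.ofRealHom +
        PowerSeries.C Complex.I *
          (sinSeries φ 0 * PowerSeries.rescale L (PowerSeries.exp ℝ)).map Complex.ofRealHom - 1) =
      (PowerSeries.C Real.pi * (cosCsc φ Real.pi *
        PowerSeries.rescale L (PowerSeries.exp ℝ) - cscT Real.pi)).map Complex.ofRealHom +
      PowerSeries.C Complex.I * (PowerSeries.C Real.pi * (sinCsc φ Real.pi *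
        PowerSeries.rescale L (PowerSeries.exp ℝ))).map Complex.ofRealHom := by
    rw [cosCsc, sinCsc]
    simp only [map_mul, map_sub]
    ring
  rw [e, map_add, PowerSeries.coeff_C_mul, PowerSeries.coeff_map, PowerSeries.coeff_map,
    PowerSeries.coeff_C_mul, PowerSeries.coeff_C_mul, map_sub, ev, ev]
  simp only [Complex.ofRealHom_eq_coe]
  push_cast
  ring

/-- The real part of the basic integral at `L + i φ`. -/
def logRe (φ : ℝ) (m : ℕ) (L : ℝ) : ℝ := (logPoly m (L + φ * Complex.I)).re

/-- The imaginary part of the basic integral at `L + i φ`. -/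
def logIm (φ : ℝ) (m : ℕ) (L : ℝ) : ℝ := (logPoly m (L + φ * Complex.I)).im

theorem logRe_eq (φ : ℝ) (m : ℕ) (L : ℝ) : logRe φ m L = -(Real.pi * (ev (cosCsc φ Real.pi) m L -
      m.factorial * PowerSeries.coeff (m + 1) (cscT Real.pi))) := by
  rw [logRe, logPoly_ofReal_add]
  simp

theorem logIm_eq (φ : ℝ) (m : ℕ) (L : ℝ) :
    logIm φ m L = -(Real.pi * ev (sinCsc φ Real.pi) m L) := by
  rw [logIm, logPoly_ofReal_add]
  simp

/-! ### Scaling -/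

theorem rescale_sinSeries (a c : ℝ) :
    PowerSeries.rescale c (sinSeries a 0) = sinSeries (a * c) 0 := by
  rw [sinSeries_zero, sinSeries_zero, PowerSeries.rescale_rescale]

theorem rescale_cosSeries (a c : ℝ) :
    PowerSeries.rescale c (cosSeries a 0) = cosSeries (a * c) 0 := by
  rw [cosSeries_zero, cosSeries_zero, PowerSeries.rescale_rescale]

theorem rescale_cscT {a c : ℝ} (ha : a ≠ 0) (hc : c ≠ 0) :
    PowerSeries.rescale c (cscT a) = PowerSeries.C c * cscT (a * c) := by
  have h := congrArg (PowerSeries.rescale c) (cscT_mul_sinSeries ha)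
  rw [map_mul, rescale_sinSeries, PowerSeries.rescale_X] at h
  refine mul_right_cancel₀ (sinSeries_zero_ne_zero (mul_ne_zero ha hc)) ?_
  rw [h, mul_assoc, cscT_mul_sinSeries (mul_ne_zero ha hc)]

theorem pow_mul_ev (k : PowerSeries ℝ) {c : ℝ} (hc : c ≠ 0) (m : ℕ) (x : ℝ) :
    c ^ (m + 1) * ev k m (x / c) = ev (PowerSeries.rescale c k) m x := by
  have : PowerSeries.rescale c k * PowerSeries.rescale x (PowerSeries.exp ℝ) =
      PowerSeries.rescale c (k * PowerSeries.rescale (x / c) (PowerSeries.exp ℝ)) := by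
    rw [map_mul, PowerSeries.rescale_rescale, div_mul_cancel₀ _ hc]
  rw [ev, ev, this, PowerSeries.coeff_rescale]
  ring

theorem ev_C_mul (r : ℝ) (k : PowerSeries ℝ) (m : ℕ) (x : ℝ) :
    ev (PowerSeries.C r * k) m x = r * ev k m x := by
  rw [ev, ev, mul_assoc, PowerSeries.coeff_C_mul]
  ring

theorem pow_mul_ev_cosCsc (a : ℝ) {b c : ℝ} (hb : b ≠ 0) (hc : c ≠ 0) (m : ℕ) (x : ℝ) :
    c ^ (m + 1) * ev (cosCsc a b) m (x / c) = c * ev (cosCsc (a * c) (b * c)) m x := by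
  rw [pow_mul_ev _ hc, cosCsc, map_mul, rescale_cscT hb hc, rescale_cosSeries, mul_assoc, ev_C_mul,
    cosCsc]

theorem pow_mul_ev_sinCsc (a : ℝ) {b c : ℝ} (hb : b ≠ 0) (hc : c ≠ 0) (m : ℕ) (x : ℝ) :
    c ^ (m + 1) * ev (sinCsc a b) m (x / c) = c * ev (sinCsc (a * c) (b * c)) m x := by
  rw [pow_mul_ev _ hc, sinCsc, map_mul, rescale_cscT hb hc, rescale_sinSeries, mul_assoc, ev_C_mul,
    sinCsc]

theorem cscT_eq_cosCsc (d : ℝ) : cscT d = cosCsc 0 d := by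
  rw [cosCsc, cosSeries_zero_zero, mul_one]

end

end LogIntegrals

namespace LogIntegrals

open Filter Topology MeasureTheory

noncomputable section

/-! ### Calculus of integrals and principal values -/

namespace HasIntegral

variable {f g : ℝ → ℝ} {u v : ℝ}

theorem add (hf : HasIntegral f u) (hg : HasIntegral g v) :
    HasIntegral (fun t => f t + g t) (u + v) :=
  ⟨hf.1.add hg.1, by rw [integral_add hf.1 hg.1, hf.2, hg.2]⟩

theorem const_mul (c : ℝ) (hf : HasIntegral f u) : HasIntegral (fun t => c * f t) (c * u) :=
  ⟨hf.1.const_mul c, by rw [integral_const_mul, hf.2]⟩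

theorem sub (hf : HasIntegral f u) (hg : HasIntegral g v) :
    HasIntegral (fun t => f t - g t) (u - v) :=
  ⟨hf.1.sub hg.1, by rw [integral_sub hf.1 hg.1, hf.2, hg.2]⟩

theorem congr (hf : HasIntegral f u) (h : ∀ t, 0 < t → f t = g t) : HasIntegral g u :=
  ⟨hf.1.congr_fun (fun t ht => h t ht) measurableSet_Ioi, by
    rw [← hf.2]
    exact setIntegral_congr_fun measurableSet_Ioi fun t ht => (h t ht).symm⟩

end HasIntegral

theorem measurableSet_pvDomain (ε c : ℝ) : MeasurableSet {t : ℝ | 0 < t ∧ ε ≤ |t - c|} :=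
  (measurableSet_lt measurable_const measurable_id).inter
    (measurableSet_le measurable_const (by fun_prop : Measurable fun t : ℝ => |t - c|))

namespace HasPVIntegral

variable {f g : ℝ → ℝ} {c u v : ℝ}

theorem of_hasIntegral (hf : HasIntegral f v) (c : ℝ) : HasPVIntegral f c v := by
  refine ⟨fun ε _ => hf.1.mono_set fun t ht => ht.1, ?_⟩
  have h : ∀ ε, ∫ t in {t : ℝ | 0 < t ∧ ε ≤ |t - c|}, f t =
      ∫ t in Set.Ioi (0 : ℝ), {t : ℝ | ε ≤ |t - c|}.indicator f t := fun ε => by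
    rw [setIntegral_indicator (measurableSet_le measurable_const (by fun_prop))]
    rfl
  simp only [h]
  rw [← hf.2]
  refine tendsto_integral_filter_of_dominated_convergence (fun t => ‖f t‖)
    (Eventually.of_forall fun ε => hf.1.aestronglyMeasurable.indicator
      (measurableSet_le measurable_const (by fun_prop)))
    (Eventually.of_forall fun ε => Eventually.of_forall fun t => norm_indicator_le_norm_self _ _)
    hf.1.norm ?_
  have hne : ∀ᵐ t ∂(volume.restrict (Set.Ioi (0 : ℝ))), t ≠ c :=
    ae_restrict_of_ae (Measure.ae_ne volume c)
  filter_upwards [hne] with t ht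
  refine tendsto_const_nhds.congr' ?_
  have hpos : 0 < |t - c| := abs_pos.2 (sub_ne_zero.2 ht)
  filter_upwards [nhdsWithin_le_nhds (Iic_mem_nhds hpos)] with ε hε
  exact (Set.indicator_of_mem (s := {t : ℝ | ε ≤ |t - c|}) hε f).symm

theorem add (hf : HasPVIntegral f c u) (hg : HasPVIntegral g c v) :
    HasPVIntegral (fun t => f t + g t) c (u + v) := by
  refine ⟨fun ε hε => (hf.1 ε hε).add (hg.1 ε hε), (hf.2.add hg.2).congr' ?_⟩
  filter_upwards [self_mem_nhdsWithin] with ε hε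
  exact (integral_add (hf.1 ε hε) (hg.1 ε hε)).symm

theorem const_mul (r : ℝ) (hf : HasPVIntegral f c u) :
    HasPVIntegral (fun t => r * f t) c (r * u) := by
  refine ⟨fun ε hε => (hf.1 ε hε).const_mul r, (hf.2.const_mul r).congr' ?_⟩
  exact Eventually.of_forall fun ε => (integral_const_mul r f).symm

theorem congr (hf : HasPVIntegral f c u) (h : ∀ t, 0 < t → t ≠ c → f t = g t) :
    HasPVIntegral g c u := by
  have h' : ∀ ε > 0, Set.EqOn f g {t : ℝ | 0 < t ∧ ε ≤ |t - c|} := fun ε hε t ht =>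
    h t ht.1 fun e => by
      have := ht.2
      rw [e, sub_self, abs_zero] at this
      exact absurd this (not_le.2 hε)
  refine ⟨fun ε hε => (hf.1 ε hε).congr_fun (h' ε hε) (measurableSet_pvDomain ε c),
    hf.2.congr' ?_⟩
  filter_upwards [self_mem_nhdsWithin] with ε hε
  exact setIntegral_congr_fun (measurableSet_pvDomain ε c) (h' ε hε)

end HasPVIntegral

/-! ### A principal value equal to zero -/

section PoleBase

variable {c ε : ℝ}

theorem pvDomain_eq (hε : 0 < ε) (hεc : ε < c) :
    {t : ℝ | 0 < t ∧ ε ≤ |t - c|} = Set.Ioc 0 (c - ε) ∪ Set.Ici (c + ε) := by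
  ext t
  simp only [Set.mem_ofPred_eq, Set.mem_union, Set.mem_Ioc, Set.mem_Ici, le_abs]
  constructor
  · rintro ⟨h1, h2 | h2⟩
    · exact Or.inr (by linarith)
    · exact Or.inl ⟨h1, by linarith⟩
  · rintro (⟨h1, h2⟩ | h1)
    · exact ⟨h1, Or.inr (by linarith)⟩
    · exact ⟨by linarith, Or.inl (by linarith)⟩

theorem hasDerivAt_log_sub_log {t : ℝ} (h1 : t - c ≠ 0) (h2 : t + c ≠ 0) :
    HasDerivAt (fun t => Real.log (t - c) - Real.log (t + c)) (2 * c / (t ^ 2 - c ^ 2)) t := by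
  have h := (((hasDerivAt_id t).sub_const c).log h1).sub (((hasDerivAt_id t).add_const c).log h2)
  refine h.congr_deriv ?_
  rw [show t ^ 2 - c ^ 2 = (t - c) * (t + c) by ring]
  simp only [id]
  field_simp
  ring

theorem intervalIntegrable_pole (hε : 0 < ε) (hεc : ε < c) :
    IntervalIntegrable (fun t => 2 * c / (t ^ 2 - c ^ 2)) volume 0 (c - ε) := by
  refine ContinuousOn.intervalIntegrable ?_
  rw [Set.uIcc_of_le (by linarith)]
  refine ContinuousOn.div continuousOn_const (by fun_prop) fun t ht => ?_
  have := ht.1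
  have := ht.2
  have : t ^ 2 - c ^ 2 < 0 := by nlinarith
  exact this.ne

theorem integral_pole_left (hε : 0 < ε) (hεc : ε < c) :
    ∫ t in Set.Ioc 0 (c - ε), 2 * c / (t ^ 2 - c ^ 2) = Real.log ε - Real.log (2 * c - ε) := by
  rw [← intervalIntegral.integral_of_le (by linarith),
    intervalIntegral.integral_eq_sub_of_hasDerivAt
      (f := fun t => Real.log (t - c) - Real.log (t + c)) (fun t ht => ?_)
      (intervalIntegrable_pole hε hεc)]
  · rw [zero_sub, zero_add, Real.log_neg_eq_log, sub_self, sub_zero,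
      show c - ε - c = -ε by ring, Real.log_neg_eq_log, show c - ε + c = 2 * c - ε by ring]
  · rw [Set.uIcc_of_le (by linarith)] at ht
    have := ht.1
    have := ht.2
    exact hasDerivAt_log_sub_log (by linarith) (by linarith)

theorem tendsto_log_sub_log (c : ℝ) :
    Tendsto (fun t => Real.log (t - c) - Real.log (t + c)) atTop (𝓝 0) := by
  have h1 : Tendsto (fun t : ℝ => 1 - 2 * c / (t + c)) atTop (𝓝 (1 - 0)) :=
    tendsto_const_nhds.sub (tendsto_const_nhds.div_atTop (tendsto_atTop_add_const_right _ _ tendsto_id))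
  rw [sub_zero] at h1
  have h2 := ((Real.continuousAt_log one_ne_zero).tendsto.comp h1)
  rw [Real.log_one] at h2
  refine h2.congr' ?_
  filter_upwards [eventually_gt_atTop |c|] with t ht
  have := abs_lt.1 ht
  rw [Function.comp_apply, ← Real.log_div (by linarith) (by linarith)]
  congr 1
  have : t + c ≠ 0 := by linarith
  field_simp
  ring

theorem integrableOn_pole_right (hε : 0 < ε) (hc : 0 < c) :
    IntegrableOn (fun t => 2 * c / (t ^ 2 - c ^ 2)) (Set.Ioi (c + ε)) := by
  refine integrableOn_Ioi_deriv_of_nonneg' (fun t ht => ?_) (fun t ht => ?_) (tendsto_log_sub_log c)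
  · have : c + ε ≤ t := ht
    exact hasDerivAt_log_sub_log (by linarith) (by linarith)
  · have : c + ε < t := ht
    have : 0 ≤ t ^ 2 - c ^ 2 := by nlinarith
    positivity

theorem integral_pole_right (hε : 0 < ε) (hc : 0 < c) :
    ∫ t in Set.Ici (c + ε), 2 * c / (t ^ 2 - c ^ 2) = Real.log (2 * c + ε) - Real.log ε := by
  rw [integral_Ici_eq_integral_Ioi, integral_Ioi_of_hasDerivAt_of_tendsto' (fun t ht => ?_)
    (integrableOn_pole_right hε hc) (tendsto_log_sub_log c)]
  · rw [show c + ε - c = ε by ring, show c + ε + c = 2 * c + ε by ring]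
    ring
  · have : c + ε ≤ t := ht
    exact hasDerivAt_log_sub_log (by linarith) (by linarith)

theorem integrableOn_pole (hε : 0 < ε) (hεc : ε < c) :
    IntegrableOn (fun t => 2 * c / (t ^ 2 - c ^ 2)) {t : ℝ | 0 < t ∧ ε ≤ |t - c|} := by
  rw [pvDomain_eq hε hεc]
  refine IntegrableOn.union ?_ ?_
  · exact (intervalIntegrable_iff_integrableOn_Ioc_of_le (by linarith)).1
      (intervalIntegrable_pole hε hεc)
  · exact (integrableOn_Ici_iff_integrableOn_Ioi (by simp)).2 (integrableOn_pole_right hε (by linarith))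

theorem hasPVIntegral_pole (hc : 0 < c) :
    HasPVIntegral (fun t => 2 * c / (t ^ 2 - c ^ 2)) c 0 := by
  constructor
  · intro ε hε
    refine (integrableOn_pole (ε := min ε (c / 2)) (lt_min hε (by positivity))
      ((min_le_right _ _).trans_lt (by linarith))).mono_set fun t ht => ⟨ht.1, ?_⟩
    exact (min_le_left _ _).trans ht.2
  · have h : Tendsto (fun ε => Real.log (2 * c + ε) - Real.log (2 * c - ε)) (𝓝[>] 0) (𝓝 0) := by
      have h1 : ContinuousAt (fun ε => Real.log (2 * c + ε) - Real.log (2 * c - ε)) 0 := by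
        refine ContinuousAt.sub (ContinuousAt.log (by fun_prop) ?_)
          (ContinuousAt.log (by fun_prop) ?_) <;> simp [hc.ne']
      have h2 := h1.tendsto
      rw [add_zero, sub_zero, sub_self] at h2
      exact h2.mono_left nhdsWithin_le_nhds
    refine h.congr' ?_
    filter_upwards [self_mem_nhdsWithin, nhdsWithin_le_nhds (Iio_mem_nhds hc)] with ε
      (hε : 0 < ε) (hεc : ε < c)
    rw [pvDomain_eq hε hεc, setIntegral_union ?_ measurableSet_Ici
      ((intervalIntegrable_iff_integrableOn_Ioc_of_le (by linarith)).1
        (intervalIntegrable_pole hε hεc))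
      ((integrableOn_Ici_iff_integrableOn_Ioi (by simp)).2 (integrableOn_pole_right hε hc)),
      integral_pole_left hε hεc, integral_pole_right hε hc]
    · ring
    · rw [Set.disjoint_left]
      intro t h1 (h2 : c + ε ≤ t)
      have := h1.2
      linarith

end PoleBase

end

end LogIntegrals

namespace LogIntegrals

open Filter Topology MeasureTheory

noncomputable section

/-! ### Real forms of the basic integral -/

theorem normSq_add_exp (t L φ : ℝ) : Complex.normSq ((t : ℂ) + Complex.exp (L + φ * Complex.I)) =
    t ^ 2 + 2 * t * Real.exp L * Real.cos φ + Real.exp L ^ 2 := by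
  rw [Complex.normSq_apply]
  simp only [Complex.add_re, Complex.add_im, Complex.ofReal_re, Complex.ofReal_im, Complex.exp_re,
    Complex.exp_im, Complex.mul_re, Complex.mul_im, Complex.I_re, Complex.I_im]
  simp only [mul_zero, mul_one, sub_zero, add_zero, zero_add]
  linear_combination Real.exp L ^ 2 * Real.sin_sq_add_cos_sq φ

theorem add_exp_re (t L φ : ℝ) :
    ((t : ℂ) + Complex.exp (L + φ * Complex.I)).re = t + Real.exp L * Real.cos φ := by
  simp [Complex.exp_re]

theorem add_exp_im (t L φ : ℝ) :
    ((t : ℂ) + Complex.exp (L + φ * Complex.I)).im = Real.exp L * Real.sin φ := by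
  simp [Complex.exp_im]

theorem logKernel_re (m : ℕ) (L φ t : ℝ) : (logKernel m (L + φ * Complex.I) t).re =
    Real.log t ^ m * ((t + Real.exp L * Real.cos φ) /
      (t ^ 2 + 2 * t * Real.exp L * Real.cos φ + Real.exp L ^ 2) - (t + 1)⁻¹) := by
  have h : ((t : ℂ) + 1)⁻¹ = (((t + 1)⁻¹ : ℝ) : ℂ) := by push_cast; rfl
  rw [logKernel, ← Complex.ofReal_pow, Complex.re_ofReal_mul, Complex.sub_re, Complex.inv_re,
    normSq_add_exp, add_exp_re, h, Complex.ofReal_re]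

theorem logKernel_im (m : ℕ) (L φ t : ℝ) : (logKernel m (L + φ * Complex.I) t).im =
    Real.log t ^ m * (-(Real.exp L * Real.sin φ) /
      (t ^ 2 + 2 * t * Real.exp L * Real.cos φ + Real.exp L ^ 2)) := by
  have h : ((t : ℂ) + 1)⁻¹ = (((t + 1)⁻¹ : ℝ) : ℂ) := by push_cast; rfl
  rw [logKernel, ← Complex.ofReal_pow, Complex.im_ofReal_mul, Complex.sub_im, Complex.inv_im,
    normSq_add_exp, add_exp_im, h, Complex.ofReal_im, sub_zero]

theorem ofReal_add_mul_I_mem_strip (L : ℝ) {φ : ℝ} (hφ : |φ| < Real.pi) :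
    (L + φ * Complex.I : ℂ) ∈ strip := by
  simpa [strip] using hφ

theorem hasIntegral_logKernel_re (m : ℕ) (L : ℝ) {φ : ℝ} (hφ : |φ| < Real.pi) :
    HasIntegral (fun t => Real.log t ^ m * ((t + Real.exp L * Real.cos φ) /
      (t ^ 2 + 2 * t * Real.exp L * Real.cos φ + Real.exp L ^ 2) - (t + 1)⁻¹)) (logRe φ m L) := by
  simp only [← logKernel_re]
  have hz := ofReal_add_mul_I_mem_strip L hφ
  have hi := integrableOn_logKernel m hz
  refine ⟨hi.re, ?_⟩
  rw [logRe, ← integral_logKernel m hz]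
  exact integral_re hi

theorem hasIntegral_logKernel_im (m : ℕ) (L : ℝ) {φ : ℝ} (hφ : |φ| < Real.pi) :
    HasIntegral (fun t => Real.log t ^ m * (-(Real.exp L * Real.sin φ) /
      (t ^ 2 + 2 * t * Real.exp L * Real.cos φ + Real.exp L ^ 2))) (logIm φ m L) := by
  simp only [← logKernel_im]
  have hz := ofReal_add_mul_I_mem_strip L hφ
  have hi := integrableOn_logKernel m hz
  refine ⟨hi.im, ?_⟩
  rw [logIm, ← integral_logKernel m hz]
  exact integral_im hi

theorem continuous_logRe (m : ℕ) (L : ℝ) : Continuous fun φ => logRe φ m L :=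
  Complex.continuous_re.comp ((continuous_logPoly m).comp (by fun_prop))

theorem logRe_zero_right (φ L : ℝ) : logRe φ 0 L = logRe 0 0 L := by
  simp [logRe, logPoly]

/-! ### The principal value with a simple pole -/

section Pole

variable {c : ℝ}

/-- The regular part of `logᵐ t · 2 c / (t² - c²)` at `t = c`. -/
def poleRegular (m : ℕ) (c t : ℝ) : ℝ :=
  dslope (fun t => Real.log t ^ m) c t * (2 * c / (t + c))

theorem poleRegular_of_ne (m : ℕ) {t : ℝ} (ht : t ≠ c) : poleRegular m c t =
    (Real.log t ^ m - Real.log c ^ m) * (2 * c / ((t - c) * (t + c))) := by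
  rw [poleRegular, dslope_of_ne _ ht, slope_def_field]
  rw [← div_div (2 * c)]
  ring

theorem continuousOn_poleRegular (m : ℕ) (hc : 0 < c) :
    ContinuousOn (poleRegular m c) (Set.Ioi 0) := by
  refine ContinuousOn.mul ((continuousOn_dslope (Ioi_mem_nhds hc)).2 ⟨?_, ?_⟩)
    (ContinuousOn.div continuousOn_const (by fun_prop) fun t (ht : 0 < t) => by positivity)
  · exact ContinuousOn.pow (Real.continuousOn_log.mono fun t (ht : 0 < t) => ht.ne') m
  · exact (Real.differentiableAt_log hc.ne').pow m

theorem abs_poleRegular_le (m : ℕ) (hc : 0 < c) {t : ℝ} (ht : 0 < t)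
    (h : t ≤ c / 2 ∨ 2 * c ≤ t) : |poleRegular m c t| ≤
      6 * c / min 1 c ^ 2 * (|Real.log t| ^ m / (1 + t) ^ 2 +
        |Real.log c| ^ m * (|Real.log t| ^ 0 / (1 + t) ^ 2)) := by
  have hm : 0 < min 1 c := lt_min one_pos hc
  have h1 : (t + c) / 3 ≤ |t - c| := by
    rcases h with h | h
    · exact le_trans (by linarith) (neg_le_abs _)
    · exact le_trans (by linarith) (le_abs_self _)
  have h2 : min 1 c * (1 + t) ≤ t + c := by
    have := min_le_left 1 c
    have := min_le_right 1 c
    nlinarith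
  have hne : t ≠ c := by
    rcases h with h | h
    · linarith
    · linarith
  have h3 : min 1 c * (1 + t) / 3 ≤ |t - c| := le_trans (by linarith) h1
  rw [poleRegular_of_ne m hne, abs_mul, abs_div, abs_mul (t - c), abs_of_pos (by positivity : 0 < 2 * c),
    abs_of_pos (by positivity : 0 < t + c), pow_zero]
  calc |Real.log t ^ m - Real.log c ^ m| * (2 * c / (|t - c| * (t + c)))
      ≤ (|Real.log t| ^ m + |Real.log c| ^ m) *
        (2 * c / ((min 1 c * (1 + t) / 3) * (min 1 c * (1 + t)))) := by
        gcongr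
        refine (abs_sub _ _).trans ?_
        rw [abs_pow, abs_pow]
    _ = _ := by
        field_simp
        ring

theorem integrableOn_poleRegular (m : ℕ) (hc : 0 < c) :
    IntegrableOn (poleRegular m c) (Set.Ioi 0) := by
  have hcont := continuousOn_poleRegular m hc
  have hsub : Set.Icc (c / 2) (2 * c) ⊆ Set.Ioi 0 := fun t ht =>
    lt_of_lt_of_le (by positivity : (0 : ℝ) < c / 2) ht.1
  have h1 : IntegrableOn (poleRegular m c) (Set.Icc (c / 2) (2 * c)) :=
    (hcont.mono hsub).integrableOn_Icc
  have h2 : IntegrableOn (poleRegular m c) (Set.Ioi 0 \ Set.Icc (c / 2) (2 * c)) := by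
    refine Integrable.mono' (g := fun t => 6 * c / min 1 c ^ 2 * (|Real.log t| ^ m / (1 + t) ^ 2 +
        |Real.log c| ^ m * (|Real.log t| ^ 0 / (1 + t) ^ 2))) ?_ ?_ ?_
    · exact IntegrableOn.mono_set ((((integrableOn_abs_log_pow_div m).add
        ((integrableOn_abs_log_pow_div 0).const_mul (|Real.log c| ^ m)))).const_mul _)
        Set.sdiff_subset
    · exact (hcont.mono Set.sdiff_subset).aestronglyMeasurable
        (measurableSet_Ioi.diff measurableSet_Icc)
    · filter_upwards [ae_restrict_mem (measurableSet_Ioi.diff measurableSet_Icc)] with t ht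
      refine abs_poleRegular_le m hc ht.1 ?_
      by_contra! h
      exact ht.2 ⟨h.1.le, h.2.le⟩
  have := h1.union h2
  rwa [Set.union_sdiff_cancel hsub] at this

/-- The kernel `Re (1 / (t + c exp (i φ))) - 1 / (t + c)`. -/
def rotatedKernel (c φ t : ℝ) : ℝ :=
  (t + c * Real.cos φ) / (t ^ 2 + 2 * t * c * Real.cos φ + c ^ 2) - (t + c)⁻¹

theorem rotatedKernel_eq (hc : 0 < c) {φ t : ℝ} (ht : 0 < t)
    (hD : 0 < t ^ 2 + 2 * t * c * Real.cos φ + c ^ 2) : rotatedKernel c φ t =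
    (t - c) * (c * (1 - Real.cos φ)) / ((t + c) * (t ^ 2 + 2 * t * c * Real.cos φ + c ^ 2)) := by
  have h : t + c ≠ 0 := by positivity
  rw [rotatedKernel, inv_eq_one_div, div_sub_div _ _ hD.ne' h, mul_comm (t + c)]
  congr 1
  ring

theorem sq_sub_mul_le (c t φ : ℝ) : (t - c) ^ 2 * ((1 - Real.cos φ) / 2) ≤
    t ^ 2 + 2 * t * c * Real.cos φ + c ^ 2 := by
  have : 0 ≤ (t + c) ^ 2 * (1 + Real.cos φ) :=
    mul_nonneg (sq_nonneg _) (by linarith [Real.neg_one_le_cos φ])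
  nlinarith

theorem abs_rotatedKernel_le (hc : 0 < c) {φ t : ℝ} (hφ : Real.cos φ < 1) (ht : 0 < t)
    (htc : t ≠ c) : |rotatedKernel c φ t| ≤ |2 * c / ((t - c) * (t + c))| := by
  have hs : 0 < (t - c) ^ 2 := by
    have := sub_ne_zero.2 htc
    positivity
  have h := sq_sub_mul_le c t φ
  have hc1 : 0 < (1 - Real.cos φ) / 2 := by linarith
  have hD := lt_of_lt_of_le (mul_pos hs hc1) h
  have ha : 0 < |t - c| := abs_pos.2 (sub_ne_zero.2 htc)
  rw [rotatedKernel_eq hc ht hD, abs_div, abs_div, abs_mul, abs_mul (t + c), abs_mul (t - c),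
    abs_of_pos (by positivity : 0 < t + c), abs_of_pos hD, abs_of_pos (by positivity : 0 < 2 * c),
    abs_of_pos (by nlinarith : 0 < c * (1 - Real.cos φ)), div_le_div_iff₀ (by positivity)
      (by positivity)]
  have e : |t - c| * |t - c| = (t - c) ^ 2 := by rw [← sq, sq_abs]
  calc |t - c| * (c * (1 - Real.cos φ)) * (|t - c| * (t + c))
      = (2 * c * (t + c)) * ((t - c) ^ 2 * ((1 - Real.cos φ) / 2)) := by rw [← e]; ring
    _ ≤ (2 * c * (t + c)) * (t ^ 2 + 2 * t * c * Real.cos φ + c ^ 2) := by gcongr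
    _ = _ := by ring

theorem tendsto_rotatedKernel {t : ℝ} (hc : 0 < c) (ht : 0 < t) (htc : t ≠ c) :
    Tendsto (fun φ => rotatedKernel c φ t) (𝓝 Real.pi) (𝓝 (2 * c / ((t - c) * (t + c)))) := by
  have h1 : t - c ≠ 0 := sub_ne_zero.2 htc
  have h2 : t + c ≠ 0 := by positivity
  have hne : t ^ 2 + 2 * t * c * Real.cos Real.pi + c ^ 2 ≠ 0 := by
    rw [Real.cos_pi, show t ^ 2 + 2 * t * c * -1 + c ^ 2 = (t - c) ^ 2 by ring]
    positivity
  have h : ContinuousAt (fun φ => rotatedKernel c φ t) Real.pi := by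
    unfold rotatedKernel
    exact ContinuousAt.sub (ContinuousAt.div (by fun_prop) (by fun_prop) hne) continuousAt_const
  have e : rotatedKernel c Real.pi t = 2 * c / ((t - c) * (t + c)) := by
    rw [rotatedKernel, Real.cos_pi, show t ^ 2 + 2 * t * c * -1 + c ^ 2 = (t - c) ^ 2 by ring]
    field_simp
    ring
  rw [← e]
  exact h

theorem hasIntegral_rotatedKernel (m : ℕ) (hc : 0 < c) {φ : ℝ} (hφ : |φ| < Real.pi) :
    HasIntegral (fun t => (Real.log t ^ m - Real.log c ^ m) * rotatedKernel c φ t)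
      (logRe φ m (Real.log c) - logRe 0 m (Real.log c)) := by
  have h0 : |(0 : ℝ)| < Real.pi := by simp [Real.pi_pos]
  have h := ((hasIntegral_logKernel_re m (Real.log c) hφ).sub
    (hasIntegral_logKernel_re m (Real.log c) h0)).sub
    (((hasIntegral_logKernel_re 0 (Real.log c) hφ).sub
      (hasIntegral_logKernel_re 0 (Real.log c) h0)).const_mul (Real.log c ^ m))
  rw [logRe_zero_right φ, sub_self, mul_zero, sub_zero] at h
  refine h.congr fun t ht => ?_
  have h1 : t + c ≠ 0 := by positivity
  rw [Real.exp_log hc, Real.cos_zero, rotatedKernel,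
    show t ^ 2 + 2 * t * c * 1 + c ^ 2 = (t + c) * (t + c) by ring, mul_one, div_mul_cancel_left₀ h1]
  ring

theorem hasIntegral_poleRegular (m : ℕ) (hc : 0 < c) :
    HasIntegral (poleRegular m c) (logRe Real.pi m (Real.log c) - logRe 0 m (Real.log c)) := by
  have hi := integrableOn_poleRegular m hc
  refine ⟨hi, ?_⟩
  have hne : ∀ᵐ t ∂(volume.restrict (Set.Ioi (0 : ℝ))), t ≠ c :=
    ae_restrict_of_ae (Measure.ae_ne volume c)
  have hev : ∀ᶠ φ in 𝓝[<] Real.pi, φ ∈ Set.Ioo 0 Real.pi := Ioo_mem_nhdsLT Real.pi_pos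
  have habs : ∀ φ ∈ Set.Ioo 0 Real.pi, |φ| < Real.pi := fun φ hφ => by
    rw [abs_of_pos hφ.1]
    exact hφ.2
  have h1 : Tendsto (fun φ => ∫ t in Set.Ioi (0 : ℝ),
      (Real.log t ^ m - Real.log c ^ m) * rotatedKernel c φ t) (𝓝[<] Real.pi)
      (𝓝 (∫ t in Set.Ioi (0 : ℝ), poleRegular m c t)) := by
    refine tendsto_integral_filter_of_dominated_convergence (fun t => ‖poleRegular m c t‖)
      ?_ ?_ hi.norm ?_
    · filter_upwards [hev] with φ hφ
      exact (hasIntegral_rotatedKernel m hc (habs φ hφ)).1.aestronglyMeasurable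
    · filter_upwards [hev] with φ hφ
      filter_upwards [hne, ae_restrict_mem measurableSet_Ioi] with t htc ht
      rw [poleRegular_of_ne m htc, norm_mul, norm_mul]
      refine mul_le_mul_of_nonneg_left (abs_rotatedKernel_le hc ?_ ht htc) (norm_nonneg _)
      rw [← Real.cos_zero]
      exact Real.cos_lt_cos_of_nonneg_of_le_pi le_rfl hφ.2.le hφ.1
    · filter_upwards [hne, ae_restrict_mem measurableSet_Ioi] with t htc ht
      rw [poleRegular_of_ne m htc]
      exact ((tendsto_rotatedKernel hc ht htc).mono_left nhdsWithin_le_nhds).const_mul _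
  have h2 : Tendsto (fun φ => ∫ t in Set.Ioi (0 : ℝ),
      (Real.log t ^ m - Real.log c ^ m) * rotatedKernel c φ t) (𝓝[<] Real.pi)
      (𝓝 (logRe Real.pi m (Real.log c) - logRe 0 m (Real.log c))) := by
    have h3 : Tendsto (fun φ => logRe φ m (Real.log c) - logRe 0 m (Real.log c)) (𝓝[<] Real.pi)
        (𝓝 (logRe Real.pi m (Real.log c) - logRe 0 m (Real.log c))) :=
      (((continuous_logRe m (Real.log c)).tendsto Real.pi).sub_const _).mono_left
        nhdsWithin_le_nhds
    refine h3.congr' ?_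
    filter_upwards [hev] with φ hφ
    exact (hasIntegral_rotatedKernel m hc (habs φ hφ)).2.symm
  exact tendsto_nhds_unique h1 h2

/-- The kernel `logᵐ t (1 / (t - a) - 1 / (t + 1))`. -/
def poleKernel (m : ℕ) (a t : ℝ) : ℝ := Real.log t ^ m * ((t - a)⁻¹ - (t + 1)⁻¹)

theorem hasIntegral_poleKernel_neg (m : ℕ) (hc : 0 < c) :
    HasIntegral (poleKernel m (-c)) (logRe 0 m (Real.log c)) := by
  refine (hasIntegral_logKernel_re m (Real.log c) (φ := 0) (by simp [Real.pi_pos])).congr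
    fun t ht => ?_
  have h1 : t + c ≠ 0 := by positivity
  rw [Real.exp_log hc, Real.cos_zero, poleKernel,
    show t ^ 2 + 2 * t * c * 1 + c ^ 2 = (t + c) * (t + c) by ring, mul_one, div_mul_cancel_left₀ h1,
    sub_neg_eq_add]

theorem hasPVIntegral_poleKernel (m : ℕ) (hc : 0 < c) :
    HasPVIntegral (poleKernel m c) c (logRe Real.pi m (Real.log c)) := by
  have h := (HasPVIntegral.of_hasIntegral
    ((hasIntegral_poleKernel_neg m hc).add (hasIntegral_poleRegular m hc)) c).add
    ((hasPVIntegral_pole hc).const_mul (Real.log c ^ m))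
  rw [mul_zero, add_zero, add_sub_cancel] at h
  refine h.congr fun t ht htc => ?_
  have h1 : t - c ≠ 0 := sub_ne_zero.2 htc
  have h2 : t + c ≠ 0 := by positivity
  rw [poleRegular_of_ne m htc, poleKernel, poleKernel, sub_neg_eq_add,
    show t ^ 2 - c ^ 2 = (t - c) * (t + c) by ring,
    show 2 * c / ((t - c) * (t + c)) = (t - c)⁻¹ - (t + c)⁻¹ by field_simp; ring]
  ring

end Pole

end

end LogIntegrals

namespace LogIntegrals

noncomputable section

/-! ### The quadratic kernels -/

/-- The argument in `(-π, π)` of `a * exp (i π / 3)`. -/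
def angle (a : ℝ) : ℝ := if 0 < a then Real.pi / 3 else -(2 * Real.pi / 3)

theorem abs_angle_lt (a : ℝ) : |angle a| < Real.pi := by
  have := Real.pi_pos
  rw [angle, abs_lt]
  split_ifs <;> constructor <;> linarith

theorem cos_two_pi_div_three : Real.cos (2 * Real.pi / 3) = -(1 / 2) := by
  rw [show 2 * Real.pi / 3 = Real.pi - Real.pi / 3 by ring, Real.cos_pi_sub, Real.cos_pi_div_three]

theorem sin_two_pi_div_three : Real.sin (2 * Real.pi / 3) = √3 / 2 := by
  rw [show 2 * Real.pi / 3 = Real.pi - Real.pi / 3 by ring, Real.sin_pi_sub, Real.sin_pi_div_three]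

theorem exp_log_abs_mul_cos {a : ℝ} (ha : a ≠ 0) :
    Real.exp (Real.log |a|) * Real.cos (angle a) = a / 2 := by
  rw [Real.exp_log (abs_pos.2 ha), angle]
  split_ifs with h
  · rw [abs_of_pos h, Real.cos_pi_div_three]
    ring
  · rw [abs_of_nonpos (not_lt.1 h), Real.cos_neg, cos_two_pi_div_three]
    ring

theorem exp_log_abs_mul_sin {a : ℝ} (ha : a ≠ 0) :
    Real.exp (Real.log |a|) * Real.sin (angle a) = √3 / 2 * a := by
  rw [Real.exp_log (abs_pos.2 ha), angle]
  split_ifs with h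
  · rw [abs_of_pos h, Real.sin_pi_div_three]
    ring
  · rw [abs_of_nonpos (not_lt.1 h), Real.sin_neg, sin_two_pi_div_three]
    ring

/-- The kernel `logᵐ t (Re (1 / (t + a exp (i π / 3))) - 1 / (t + 1))`. -/
def reKernel (m : ℕ) (a t : ℝ) : ℝ :=
  Real.log t ^ m * ((t + a / 2) / (t ^ 2 + a * t + a ^ 2) - (t + 1)⁻¹)

/-- The kernel `logᵐ t Im (1 / (t + a exp (i π / 3)))`. -/
def imKernel (m : ℕ) (a t : ℝ) : ℝ :=
  Real.log t ^ m * (-(√3 / 2 * a) / (t ^ 2 + a * t + a ^ 2))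

theorem denominator_eq {a : ℝ} (ha : a ≠ 0) (t : ℝ) :
    t ^ 2 + 2 * t * Real.exp (Real.log |a|) * Real.cos (angle a) + Real.exp (Real.log |a|) ^ 2 =
      t ^ 2 + a * t + a ^ 2 := by
  rw [mul_assoc (2 * t), exp_log_abs_mul_cos ha, Real.exp_log (abs_pos.2 ha), sq_abs]
  ring

theorem hasIntegral_reKernel (m : ℕ) {a : ℝ} (ha : a ≠ 0) :
    HasIntegral (reKernel m a) (logRe (angle a) m (Real.log |a|)) := by
  have h := hasIntegral_logKernel_re m (Real.log |a|) (abs_angle_lt a)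
  simp only [denominator_eq ha, exp_log_abs_mul_cos ha] at h
  exact h

theorem hasIntegral_imKernel (m : ℕ) {a : ℝ} (ha : a ≠ 0) :
    HasIntegral (imKernel m a) (logIm (angle a) m (Real.log |a|)) := by
  have h := hasIntegral_logKernel_im m (Real.log |a|) (abs_angle_lt a)
  simp only [denominator_eq ha, exp_log_abs_mul_sin ha] at h
  exact h

/-! ### Partial fractions -/

theorem quadratic_pos {a : ℝ} (ha : a ≠ 0) (t : ℝ) : 0 < t ^ 2 + a * t + a ^ 2 := by
  have : 0 < a ^ 2 := by positivity
  nlinarith [sq_nonneg (2 * t + a)]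

theorem symmetric_ne_zero {a : ℝ} (ha : a ≠ 0) (b : ℝ) : a ^ 2 + a * b + b ^ 2 ≠ 0 := by
  have := quadratic_pos ha b
  intro h
  linarith

theorem f1Integrand_eq (m : ℕ) {a b : ℝ} (ha : a ≠ 0) (hb : b ≠ 0) (hab : a ≠ b) (t : ℝ) :
    (-((a + b) / (a ^ 3 - b ^ 3))) * (reKernel m a t - reKernel m b t) +
      1 / (√3 * (a ^ 2 + a * b + b ^ 2)) * (imKernel m a t + imKernel m b t) =
      f1Integrand a b m t := by
  have h1 := (quadratic_pos ha t).ne'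
  have h2 := (quadratic_pos hb t).ne'
  have h3 := symmetric_ne_zero ha b
  have h4 := sub_ne_zero.2 hab
  have h5 : √3 ≠ 0 := by positivity
  rw [f1Integrand, reKernel, reKernel, imKernel, imKernel,
    show a ^ 3 - b ^ 3 = (a - b) * (a ^ 2 + a * b + b ^ 2) by ring]
  generalize Real.log t ^ m = l
  have e : l * (-(√3 / 2 * a) / (t ^ 2 + a * t + a ^ 2)) +
      l * (-(√3 / 2 * b) / (t ^ 2 + b * t + b ^ 2)) =
      √3 * (-(l * ((a / 2) / (t ^ 2 + a * t + a ^ 2) + (b / 2) / (t ^ 2 + b * t + b ^ 2)))) := by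
    ring
  have e' : ∀ u v : ℝ, 1 / (√3 * u) * (√3 * v) = v / u := fun u v => by
    rw [one_div_mul_eq_div, mul_div_mul_left _ _ h5]
  rw [e, e']
  obtain ⟨u, hu⟩ : ∃ u, u = t ^ 2 + a * t + a ^ 2 := ⟨_, rfl⟩
  obtain ⟨v, hv⟩ : ∃ v, v = t ^ 2 + b * t + b ^ 2 := ⟨_, rfl⟩
  obtain ⟨s, hs⟩ : ∃ s, s = a ^ 2 + a * b + b ^ 2 := ⟨_, rfl⟩
  rw [← hu, ← hv, ← hs]
  rw [← hu] at h1
  rw [← hv] at h2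
  rw [← hs] at h3
  field_simp
  rw [hu, hv, hs]
  ring

theorem g1Integrand_eq (m : ℕ) {a b : ℝ} (ha : a ≠ 0) (hb : b ≠ 0) (hab : a ≠ b) {t : ℝ}
    (hta : t ≠ a) :
    2 / (3 * (a ^ 2 + a * b + b ^ 2)) * poleKernel m a t +
      (1 / (3 * (a ^ 2 + a * b + b ^ 2)) * reKernel m a t +
        (-(1 / (a ^ 2 + a * b + b ^ 2))) * reKernel m b t +
        (a + b) / (√3 * (a ^ 3 - b ^ 3)) * (imKernel m a t - imKernel m b t)) =
      g1Integrand a b m t := by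
  have h1 := (quadratic_pos ha t).ne'
  have h2 := (quadratic_pos hb t).ne'
  have h3 := symmetric_ne_zero ha b
  have h4 := sub_ne_zero.2 hab
  have h5 : √3 ≠ 0 := by positivity
  have h6 := sub_ne_zero.2 hta
  rw [g1Integrand, poleKernel, reKernel, reKernel, imKernel, imKernel,
    show a ^ 3 - b ^ 3 = (a - b) * (a ^ 2 + a * b + b ^ 2) by ring,
    show t ^ 3 - a ^ 3 = (t - a) * (t ^ 2 + a * t + a ^ 2) by ring]
  generalize Real.log t ^ m = l
  have e : l * (-(√3 / 2 * a) / (t ^ 2 + a * t + a ^ 2)) -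
      l * (-(√3 / 2 * b) / (t ^ 2 + b * t + b ^ 2)) =
      √3 * (-(l * ((a / 2) / (t ^ 2 + a * t + a ^ 2) - (b / 2) / (t ^ 2 + b * t + b ^ 2)))) := by
    ring
  have e' : ∀ u v w : ℝ, w / (√3 * u) * (√3 * v) = w * v / u := fun u v w => by
    rw [div_mul_eq_mul_div, mul_left_comm, mul_div_mul_left _ _ h5]
  have e'' : ∀ s x y z k : ℝ, 2 / (3 * s) * (l * (x - k)) +
      (1 / (3 * s) * (l * (y - k)) + -(1 / s) * (l * (z - k))) =
      l * (2 / 3 * x + 1 / 3 * y - z) / s := fun s x y z k => by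
    ring
  rw [e, e', ← add_assoc, e'']
  obtain ⟨u, hu⟩ : ∃ u, u = t ^ 2 + a * t + a ^ 2 := ⟨_, rfl⟩
  obtain ⟨v, hv⟩ : ∃ v, v = t ^ 2 + b * t + b ^ 2 := ⟨_, rfl⟩
  obtain ⟨s, hs⟩ : ∃ s, s = a ^ 2 + a * b + b ^ 2 := ⟨_, rfl⟩
  rw [← hu, ← hv, ← hs]
  rw [← hu] at h1
  rw [← hv] at h2
  rw [← hs] at h3
  field_simp
  rw [hu, hv, hs]
  ring

theorem f2Integrand_eq_neg (a b : ℝ) (m : ℕ) : f2Integrand a b m = f1Integrand (-a) (-b) m := by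
  funext t
  simp only [f2Integrand, f1Integrand]
  ring_nf

theorem g2Integrand_eq_neg (a b : ℝ) (m : ℕ) : g2Integrand a b m = g1Integrand (-a) (-b) m := by
  funext t
  simp only [g2Integrand, g1Integrand]
  ring_nf

/-! ### Values of the integrals -/

/-- The principal value of `∫₀^∞ poleKernel m a`. -/
def poleValue (m : ℕ) (a : ℝ) : ℝ := logRe (if 0 < a then Real.pi else 0) m (Real.log |a|)

/-- The integral of `reKernel m a`. -/
def reValue (m : ℕ) (a : ℝ) : ℝ := logRe (angle a) m (Real.log |a|)

/-- The integral of `imKernel m a`. -/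
def imValue (m : ℕ) (a : ℝ) : ℝ := logIm (angle a) m (Real.log |a|)

def f1Value (a b : ℝ) (m : ℕ) : ℝ :=
  (-((a + b) / (a ^ 3 - b ^ 3))) * (reValue m a - reValue m b) +
    1 / (√3 * (a ^ 2 + a * b + b ^ 2)) * (imValue m a + imValue m b)

def g1Value (a b : ℝ) (m : ℕ) : ℝ :=
  2 / (3 * (a ^ 2 + a * b + b ^ 2)) * poleValue m a +
    (1 / (3 * (a ^ 2 + a * b + b ^ 2)) * reValue m a +
      (-(1 / (a ^ 2 + a * b + b ^ 2))) * reValue m b +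
      (a + b) / (√3 * (a ^ 3 - b ^ 3)) * (imValue m a - imValue m b))

theorem hasIntegral_poleKernel (m : ℕ) {a : ℝ} (ha : a < 0) :
    HasIntegral (poleKernel m a) (poleValue m a) := by
  have h := hasIntegral_poleKernel_neg m (neg_pos.2 ha)
  rwa [neg_neg, ← abs_of_neg ha, ← if_neg (c := 0 < a) (t := Real.pi) (e := 0) ha.not_gt] at h

theorem hasPVIntegral_poleKernel_abs (m : ℕ) {a : ℝ} (ha : a ≠ 0) :
    HasPVIntegral (poleKernel m a) |a| (poleValue m a) := by
  rcases ha.lt_or_gt with h | h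
  · exact HasPVIntegral.of_hasIntegral (hasIntegral_poleKernel m h) _
  · rw [poleValue, if_pos h, abs_of_pos h]
    exact hasPVIntegral_poleKernel m h

theorem hasIntegral_f1Integrand (m : ℕ) {a b : ℝ} (ha : a ≠ 0) (hb : b ≠ 0) (hab : a ≠ b) :
    HasIntegral (f1Integrand a b m) (f1Value a b m) :=
  ((((hasIntegral_reKernel m ha).sub (hasIntegral_reKernel m hb)).const_mul _).add
    (((hasIntegral_imKernel m ha).add (hasIntegral_imKernel m hb)).const_mul _)).congr
    fun _ _ => f1Integrand_eq m ha hb hab _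

theorem hasIntegral_g1Regular (m : ℕ) {a b : ℝ} (ha : a ≠ 0) (hb : b ≠ 0) (u v w : ℝ) :
    HasIntegral (fun t => u * reKernel m a t + v * reKernel m b t +
      w * (imKernel m a t - imKernel m b t))
      (u * reValue m a + v * reValue m b + w * (imValue m a - imValue m b)) :=
  (((hasIntegral_reKernel m ha).const_mul u).add ((hasIntegral_reKernel m hb).const_mul v)).add
    (((hasIntegral_imKernel m ha).sub (hasIntegral_imKernel m hb)).const_mul w)

theorem hasIntegral_g1Integrand (m : ℕ) {a b : ℝ} (ha : a < 0) (hb : b ≠ 0) (hab : a ≠ b) :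
    HasIntegral (g1Integrand a b m) (g1Value a b m) :=
  (((hasIntegral_poleKernel m ha).const_mul _).add
    (hasIntegral_g1Regular m ha.ne hb _ _ _)).congr
    fun _ ht => g1Integrand_eq m ha.ne hb hab (ha.trans ht).ne'

theorem hasPVIntegral_g1Integrand (m : ℕ) {a b : ℝ} (ha : a ≠ 0) (hb : b ≠ 0) (hab : a ≠ b) :
    HasPVIntegral (g1Integrand a b m) |a| (g1Value a b m) := by
  refine (((hasPVIntegral_poleKernel_abs m ha).const_mul _).add
    (HasPVIntegral.of_hasIntegral (hasIntegral_g1Regular m ha hb _ _ _) _)).congr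
    fun t ht hta => g1Integrand_eq m ha hb hab ?_
  rintro rfl
  exact hta (abs_of_pos ht).symm

/-! ### Comparison with the closed formulas -/

theorem θ_ne_zero : θ ≠ 0 := by
  rw [θ]
  positivity

theorem δ_ne_zero : δ ≠ 0 := by
  rw [δ]
  positivity

theorem θ_pow_mul_cosCsc (m : ℕ) (a : ℝ) :
    θ ^ (m + 1) * (3 / 2 * ev (cosCsc (1 / 2) (3 / 2)) m (xθ a)) =
      Real.pi * ev (cosCsc (Real.pi / 3) Real.pi) m (Real.log |a|) := by
  have h := pow_mul_ev_cosCsc (1 / 2) (b := 3 / 2) (by norm_num) θ_ne_zero m (Real.log |a|)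
  rw [show 1 / 2 * θ = Real.pi / 3 by rw [θ]; ring, show 3 / 2 * θ = Real.pi by rw [θ]; ring] at h
  rw [xθ, mul_left_comm, h, θ]
  ring

theorem θ_pow_mul_sinCsc (m : ℕ) (a : ℝ) :
    θ ^ (m + 1) * (3 / 2 * ev (sinCsc (1 / 2) (3 / 2)) m (xθ a)) =
      Real.pi * ev (sinCsc (Real.pi / 3) Real.pi) m (Real.log |a|) := by
  have h := pow_mul_ev_sinCsc (1 / 2) (b := 3 / 2) (by norm_num) θ_ne_zero m (Real.log |a|)
  rw [show 1 / 2 * θ = Real.pi / 3 by rw [θ]; ring, show 3 / 2 * θ = Real.pi by rw [θ]; ring] at h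
  rw [xθ, mul_left_comm, h, θ]
  ring

theorem θ_pow_mul_cot (m : ℕ) (a : ℝ) :
    θ ^ (m + 1) * (3 / 2 * ev (cosCsc (3 / 2) (3 / 2)) m (xθ a)) =
      Real.pi * ev (cosCsc Real.pi Real.pi) m (Real.log |a|) := by
  have h := pow_mul_ev_cosCsc (3 / 2) (b := 3 / 2) (by norm_num) θ_ne_zero m (Real.log |a|)
  rw [show 3 / 2 * θ = Real.pi by rw [θ]; ring] at h
  rw [xθ, mul_left_comm, h, θ]
  ring

theorem δ_pow_mul_cosCsc (m : ℕ) (a : ℝ) :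
    δ ^ (m + 1) * (3 * ev (cosCsc 2 3) m (xδ a)) =
      Real.pi * ev (cosCsc (2 * Real.pi / 3) Real.pi) m (Real.log |a|) := by
  have h := pow_mul_ev_cosCsc 2 (b := 3) (by norm_num) δ_ne_zero m (Real.log |a|)
  rw [show 2 * δ = 2 * Real.pi / 3 by rw [δ]; ring, show 3 * δ = Real.pi by rw [δ]; ring] at h
  rw [xδ, mul_left_comm, h, δ]
  ring

theorem δ_pow_mul_sinCsc (m : ℕ) (a : ℝ) :
    δ ^ (m + 1) * (3 * ev (sinCsc 2 3) m (xδ a)) =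
      Real.pi * ev (sinCsc (2 * Real.pi / 3) Real.pi) m (Real.log |a|) := by
  have h := pow_mul_ev_sinCsc 2 (b := 3) (by norm_num) δ_ne_zero m (Real.log |a|)
  rw [show 2 * δ = 2 * Real.pi / 3 by rw [δ]; ring, show 3 * δ = Real.pi by rw [δ]; ring] at h
  rw [xδ, mul_left_comm, h, δ]
  ring

theorem δ_pow_mul_csc (m : ℕ) (a : ℝ) :
    δ ^ (m + 1) * (3 * ev (cscT 3) m (xδ a)) =
      Real.pi * ev (cosCsc 0 Real.pi) m (Real.log |a|) := by
  have h := pow_mul_ev_cosCsc 0 (b := 3) (by norm_num) δ_ne_zero m (Real.log |a|)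
  rw [zero_mul, show 3 * δ = Real.pi by rw [δ]; ring] at h
  rw [xδ, cscT_eq_cosCsc, mul_left_comm, h, δ]
  ring

theorem f1Rec_eq (a b : ℝ) (m : ℕ) : f1Rec a b m =
    (-((a + b) / (a ^ 3 - b ^ 3))) *
      (logRe (Real.pi / 3) m (Real.log |a|) - logRe (Real.pi / 3) m (Real.log |b|)) +
    1 / (√3 * (a ^ 2 + a * b + b ^ 2)) *
      (logIm (Real.pi / 3) m (Real.log |a|) + logIm (Real.pi / 3) m (Real.log |b|)) := by
  rw [f1Rec_eq_ev]
  simp only [logRe_eq, logIm_eq, mul_sub, mul_add, neg_sub, ← θ_pow_mul_cosCsc, ← θ_pow_mul_sinCsc]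
  ring

theorem f2Rec_eq (a b : ℝ) (m : ℕ) : f2Rec a b m =
    (-((a + b) / (a ^ 3 - b ^ 3))) *
      (logRe (2 * Real.pi / 3) m (Real.log |a|) - logRe (2 * Real.pi / 3) m (Real.log |b|)) -
    1 / (√3 * (a ^ 2 + a * b + b ^ 2)) *
      (logIm (2 * Real.pi / 3) m (Real.log |a|) + logIm (2 * Real.pi / 3) m (Real.log |b|)) := by
  rw [f2Rec_eq_ev]
  simp only [logRe_eq, logIm_eq, mul_sub, mul_add, neg_sub, ← δ_pow_mul_cosCsc, ← δ_pow_mul_sinCsc]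
  ring

theorem g1Rec_eq (a b : ℝ) (m : ℕ) : g1Rec a b m =
    2 / (3 * (a ^ 2 + a * b + b ^ 2)) * logRe Real.pi m (Real.log |a|) +
    (1 / (3 * (a ^ 2 + a * b + b ^ 2)) * logRe (Real.pi / 3) m (Real.log |a|) +
      (-(1 / (a ^ 2 + a * b + b ^ 2))) * logRe (Real.pi / 3) m (Real.log |b|) +
      (a + b) / (√3 * (a ^ 3 - b ^ 3)) *
        (logIm (Real.pi / 3) m (Real.log |a|) - logIm (Real.pi / 3) m (Real.log |b|))) := by
  rw [g1Rec_eq_ev]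
  generalize a ^ 2 + a * b + b ^ 2 = s
  simp only [logRe_eq, logIm_eq, mul_sub, mul_add, neg_sub, ← θ_pow_mul_cosCsc, ← θ_pow_mul_sinCsc,
    ← θ_pow_mul_cot]
  ring

theorem g2Rec_eq (a b : ℝ) (m : ℕ) : g2Rec a b m =
    2 / (3 * (a ^ 2 + a * b + b ^ 2)) * logRe 0 m (Real.log |a|) +
    (1 / (3 * (a ^ 2 + a * b + b ^ 2)) * logRe (2 * Real.pi / 3) m (Real.log |a|) +
      (-(1 / (a ^ 2 + a * b + b ^ 2))) * logRe (2 * Real.pi / 3) m (Real.log |b|) -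
      (a + b) / (√3 * (a ^ 3 - b ^ 3)) *
        (logIm (2 * Real.pi / 3) m (Real.log |a|) - logIm (2 * Real.pi / 3) m (Real.log |b|))) := by
  rw [g2Rec_eq_ev]
  generalize a ^ 2 + a * b + b ^ 2 = s
  simp only [logRe_eq, logIm_eq, mul_sub, mul_add, neg_sub, ← δ_pow_mul_cosCsc, ← δ_pow_mul_sinCsc,
    ← δ_pow_mul_csc]
  ring

theorem logRe_neg (φ : ℝ) (m : ℕ) (L : ℝ) : logRe (-φ) m L = logRe φ m L := by
  have : cosSeries (-φ) 0 = cosSeries φ 0 := by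
    ext n
    rw [coeff_cosSeries, coeff_cosSeries]
    split_ifs with h
    · rw [h.neg_pow]
    · rfl
  rw [logRe_eq, logRe_eq, cosCsc, cosCsc, this]

theorem logIm_neg (φ : ℝ) (m : ℕ) (L : ℝ) : logIm (-φ) m L = -logIm φ m L := by
  have : sinCsc (-φ) Real.pi = PowerSeries.C (-1) * sinCsc φ Real.pi := by
    ext n
    rw [sinCsc, sinCsc, mul_left_comm]
    congr 2
    ext n
    rw [PowerSeries.coeff_C_mul, coeff_sinSeries, coeff_sinSeries]
    split_ifs with h
    · rw [h.neg_pow]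
      ring
    · ring
  rw [logIm_eq, logIm_eq, this, ev_C_mul]
  ring

section Values

variable (m : ℕ) {a b : ℝ}

theorem reValue_of_pos (ha : 0 < a) : reValue m a = logRe (Real.pi / 3) m (Real.log |a|) := by
  rw [reValue, angle, if_pos ha]

theorem imValue_of_pos (ha : 0 < a) : imValue m a = logIm (Real.pi / 3) m (Real.log |a|) := by
  rw [imValue, angle, if_pos ha]

theorem poleValue_of_pos (ha : 0 < a) : poleValue m a = logRe Real.pi m (Real.log |a|) := by
  rw [poleValue, if_pos ha]

theorem reValue_of_neg (ha : a < 0) : reValue m a = logRe (2 * Real.pi / 3) m (Real.log |a|) := by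
  rw [reValue, angle, if_neg ha.not_gt, logRe_neg]

theorem imValue_of_neg (ha : a < 0) : imValue m a = -logIm (2 * Real.pi / 3) m (Real.log |a|) := by
  rw [imValue, angle, if_neg ha.not_gt, logIm_neg]

theorem poleValue_of_neg (ha : a < 0) : poleValue m a = logRe 0 m (Real.log |a|) := by
  rw [poleValue, if_neg ha.not_gt]

theorem reValue_add_neg (ha : a ≠ 0) : reValue m a + reValue m (-a) =
    logRe (Real.pi / 3) m (Real.log |a|) + logRe (2 * Real.pi / 3) m (Real.log |a|) := by
  rcases ha.lt_or_gt with h | h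
  · rw [reValue_of_neg m h, reValue_of_pos m (neg_pos.2 h), abs_neg, add_comm]
  · rw [reValue_of_pos m h, reValue_of_neg m (neg_neg_of_pos h), abs_neg]

theorem imValue_add_neg (ha : a ≠ 0) : imValue m a + imValue m (-a) =
    logIm (Real.pi / 3) m (Real.log |a|) - logIm (2 * Real.pi / 3) m (Real.log |a|) := by
  rcases ha.lt_or_gt with h | h
  · rw [imValue_of_neg m h, imValue_of_pos m (neg_pos.2 h), abs_neg]
    ring
  · rw [imValue_of_pos m h, imValue_of_neg m (neg_neg_of_pos h), abs_neg]
    ring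

theorem poleValue_add_neg (ha : a ≠ 0) : poleValue m a + poleValue m (-a) =
    logRe Real.pi m (Real.log |a|) + logRe 0 m (Real.log |a|) := by
  rcases ha.lt_or_gt with h | h
  · rw [poleValue_of_neg m h, poleValue_of_pos m (neg_pos.2 h), abs_neg, add_comm]
  · rw [poleValue_of_pos m h, poleValue_of_neg m (neg_neg_of_pos h), abs_neg]

theorem f1Value_neg : f1Value (-a) (-b) m =
    (-((a + b) / (a ^ 3 - b ^ 3))) * (reValue m (-a) - reValue m (-b)) +
      1 / (√3 * (a ^ 2 + a * b + b ^ 2)) * (imValue m (-a) + imValue m (-b)) := by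
  have h : (-a + -b) / ((-a) ^ 3 - (-b) ^ 3) = (a + b) / (a ^ 3 - b ^ 3) := by
    rw [← neg_div_neg_eq]
    ring_nf
  rw [f1Value, h]
  ring_nf

theorem g1Value_neg : g1Value (-a) (-b) m =
    2 / (3 * (a ^ 2 + a * b + b ^ 2)) * poleValue m (-a) +
      (1 / (3 * (a ^ 2 + a * b + b ^ 2)) * reValue m (-a) +
        (-(1 / (a ^ 2 + a * b + b ^ 2))) * reValue m (-b) +
        (a + b) / (√3 * (a ^ 3 - b ^ 3)) * (imValue m (-a) - imValue m (-b))) := by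
  have h : (-a + -b) / (√3 * ((-a) ^ 3 - (-b) ^ 3)) = (a + b) / (√3 * (a ^ 3 - b ^ 3)) := by
    rw [← neg_div_neg_eq]
    ring_nf
  rw [g1Value, h]
  ring_nf

theorem f1Value_eq (ha : 0 < a) (hb : 0 < b) : f1Value a b m = f1Rec a b m := by
  rw [f1Value, f1Rec_eq, reValue_of_pos m ha, reValue_of_pos m hb, imValue_of_pos m ha,
    imValue_of_pos m hb]

theorem g1Value_eq (ha : 0 < a) (hb : 0 < b) : g1Value a b m = g1Rec a b m := by
  rw [g1Value, g1Rec_eq, reValue_of_pos m ha, reValue_of_pos m hb, imValue_of_pos m ha,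
    imValue_of_pos m hb, poleValue_of_pos m ha]

theorem f1Value_add_neg (ha : a ≠ 0) (hb : b ≠ 0) :
    f1Value a b m + f1Value (-a) (-b) m = f1Rec a b m + f2Rec a b m := by
  rw [f1Value_neg, f1Value, f1Rec_eq, f2Rec_eq]
  linear_combination
    (-((a + b) / (a ^ 3 - b ^ 3))) * (reValue_add_neg m ha - reValue_add_neg m hb) +
    1 / (√3 * (a ^ 2 + a * b + b ^ 2)) * (imValue_add_neg m ha + imValue_add_neg m hb)

theorem g1Value_add_neg (ha : a ≠ 0) (hb : b ≠ 0) :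
    g1Value a b m + g1Value (-a) (-b) m = g1Rec a b m + g2Rec a b m := by
  rw [g1Value_neg, g1Value, g1Rec_eq, g2Rec_eq]
  linear_combination
    2 / (3 * (a ^ 2 + a * b + b ^ 2)) * poleValue_add_neg m ha +
    1 / (3 * (a ^ 2 + a * b + b ^ 2)) * reValue_add_neg m ha -
    1 / (a ^ 2 + a * b + b ^ 2) * reValue_add_neg m hb +
    (a + b) / (√3 * (a ^ 3 - b ^ 3)) * (imValue_add_neg m ha - imValue_add_neg m hb)

theorem f1Value_neg_eq (ha : 0 < a) (hb : 0 < b) : f1Value (-a) (-b) m = f2Rec a b m :=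
  add_left_cancel ((congrArg (· + f1Value (-a) (-b) m) (f1Value_eq m ha hb)).symm.trans
    (f1Value_add_neg m ha.ne' hb.ne'))

theorem g1Value_neg_eq (ha : 0 < a) (hb : 0 < b) : g1Value (-a) (-b) m = g2Rec a b m :=
  add_left_cancel ((congrArg (· + g1Value (-a) (-b) m) (g1Value_eq m ha hb)).symm.trans
    (g1Value_add_neg m ha.ne' hb.ne'))

theorem hasIntegral_f2Integrand (ha : a ≠ 0) (hb : b ≠ 0) (hab : a ≠ b) :
    HasIntegral (f2Integrand a b m) (f1Value (-a) (-b) m) := by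
  rw [f2Integrand_eq_neg]
  exact hasIntegral_f1Integrand m (neg_ne_zero.2 ha) (neg_ne_zero.2 hb) (neg_injective.ne hab)

theorem hasPVIntegral_g2Integrand (ha : a ≠ 0) (hb : b ≠ 0) (hab : a ≠ b) :
    HasPVIntegral (g2Integrand a b m) |a| (g1Value (-a) (-b) m) := by
  rw [g2Integrand_eq_neg, ← abs_neg]
  exact hasPVIntegral_g1Integrand m (neg_ne_zero.2 ha) (neg_ne_zero.2 hb) (neg_injective.ne hab)

theorem hasIntegral_g2Integrand (ha : 0 < a) (hb : b ≠ 0) (hab : a ≠ b) :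
    HasIntegral (g2Integrand a b m) (g1Value (-a) (-b) m) := by
  rw [g2Integrand_eq_neg]
  exact hasIntegral_g1Integrand m (neg_neg_of_pos ha) (neg_ne_zero.2 hb) (neg_injective.ne hab)

end Values

end

end LogIntegrals

theorem mainTheorem2 :
    -- evaluation of the four integrals, in two ways, for positive parameters
    (∀ (a b : ℝ), 0 < a → 0 < b → a ≠ b → ∀ m : ℕ,
      (HasIntegral (f1Integrand a b m) (f1Rec a b m) ∧ f1Rec a b m = f1Alt a b m) ∧
      (HasIntegral (f2Integrand a b m) (f2Rec a b m) ∧ f2Rec a b m = f2Alt a b m) ∧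
      (HasPVIntegral (g1Integrand a b m) a (g1Rec a b m) ∧ g1Rec a b m = g1Alt a b m) ∧
      (HasIntegral (g2Integrand a b m) (g2Rec a b m) ∧ g2Rec a b m = g2Alt a b m)) ∧
    -- the sums, for nonzero real parameters
    (∀ (a b : ℝ), a ≠ 0 → b ≠ 0 → a ≠ b → ∀ m : ℕ,
      (∃ u v : ℝ, HasIntegral (f1Integrand a b m) u ∧ HasIntegral (f2Integrand a b m) v ∧
        u + v = f1Rec a b m + f2Rec a b m ∧ u + v = f1Alt a b m + f2Alt a b m) ∧
      (∃ u v : ℝ, HasPVIntegral (g1Integrand a b m) |a| u ∧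
        HasPVIntegral (g2Integrand a b m) |a| v ∧
        u + v = g1Rec a b m + g2Rec a b m ∧ u + v = g1Alt a b m + g2Alt a b m)) ∧
    -- the second family consists of the coefficients of the generating functions
    (HasExpansion (fun x T => csc (T / 2 - θ / 2) * csc (T / 2) * Real.sinh (x * T)) polyA ∧
      HasExpansion (fun x T => csc (T / 2 - θ / 2) * csc (T / 2) * Real.cosh (x * T)) polyB ∧
      HasExpansion (fun x T => Real.sin (2 * T - θ) * csc (3 * T) * Real.sinh (x * T)) polyC ∧
      HasExpansion (fun x T => Real.sin (2 * T - θ) * csc (3 * T) * Real.cosh (x * T)) polyD ∧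
      HasExpansion
        (fun x T => csc (3 * T / 2) * Real.cos (T / 2 + θ) * Real.sinh (x * T)) polyE ∧
      HasExpansion
        (fun x T => csc (3 * T / 2) * Real.cos (T / 2 + θ) * Real.cosh (x * T)) polyF ∧
      HasExpansion (fun x T => Real.cot (3 * T / 2) * Real.exp (x * T)) polyG ∧
      HasExpansion
        (fun x T => csc (3 * T / 2) * Real.sin (T / 2 + θ / 2) * Real.sinh (x * T)) polyK ∧
      HasExpansion
        (fun x T => csc (3 * T / 2) * Real.sin (T / 2 + θ / 2) * Real.cosh (x * T)) polyL ∧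
      HasExpansion (fun x T => csc (3 * T) * Real.cos (2 * T - 2 * δ) * Real.sinh (x * T)) polyU ∧
      HasExpansion (fun x T => csc (3 * T) * Real.cos (2 * T - 2 * δ) * Real.cosh (x * T)) polyV ∧
      HasExpansion (fun x T => csc (3 * T) * Real.exp (x * T)) polyW ∧
      HasExpansion (fun x T => csc (3 * T) * Real.sin (2 * T - 2 * δ) * Real.sinh (x * T)) polyN ∧
      HasExpansion
        (fun x T => csc (3 * T) * Real.sin (2 * T - 2 * δ) * Real.cosh (x * T)) polyO) ∧
    -- explicit expressions
    (∀ m : ℕ, polyA m = explicitA m ∧ polyB m = explicitB m) ∧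
    -- the first family in terms of the second
    (∀ m : ℕ, Even m →
      ApproxMul (polyR m) (-(√3 / 4)) (polyA m) ∧ EqMul (polyS m) (3 / 4) (polyB m) ∧
      ApproxMul (polyP m) (-(2 * √3)) (polyC m) ∧ EqMul (polyQ m) (-6) (polyD m)) ∧
    (∀ m : ℕ, Odd m →
      ApproxMul (polyR m) (-(√3 / 4)) (polyB m) ∧ EqMul (polyS m) (3 / 4) (polyA m) ∧
      ApproxMul (polyP m) (-(2 * √3)) (polyD m) ∧ EqMul (polyQ m) (-6) (polyC m)) ∧
    (∀ m : ℕ, ApproxMul (polyY m) (-3) (polyG m) ∧ ApproxMul (polyZ m) (-6) (polyW m)) ∧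
    -- arithmetic nature of the coefficients (the first family is rational by construction)
    (∀ p ∈ [polyA, polyB, polyC, polyD, polyE, polyF, polyG, polyK, polyL, polyU, polyV, polyW,
        polyN, polyO], ∀ m : ℤ, CoeffsInQSqrt3 (p m)) := by
  refine ⟨fun a b ha hb hab m => ⟨⟨?_, f1Rec_eq_f1Alt a b m⟩, ⟨?_, f2Rec_eq_f2Alt a b m⟩,
    ⟨?_, g1Rec_eq_g1Alt a b m⟩, ⟨?_, g2Rec_eq_g2Alt a b m⟩⟩, fun a b ha hb hab m => ⟨?_, ?_⟩,
    ⟨hasExpansion_polyA, hasExpansion_polyB, hasExpansion_polyC, hasExpansion_polyD,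
      hasExpansion_polyE, hasExpansion_polyF, hasExpansion_polyG, hasExpansion_polyK,
      hasExpansion_polyL, hasExpansion_polyU, hasExpansion_polyV, hasExpansion_polyW,
      hasExpansion_polyN, hasExpansion_polyO⟩,
    fun m => ⟨polyA_eq_explicitA m, polyB_eq_explicitB m⟩,
    fun m hm => comparison_of_even hm, fun m hm => comparison_of_odd hm,
    fun m => ⟨approxMul_polyY m, approxMul_polyZ m⟩, coeffsInQSqrt3_secondFamily⟩
  · rw [← f1Value_eq m ha hb]
    exact hasIntegral_f1Integrand m ha.ne' hb.ne' hab
  · rw [← f1Value_neg_eq m ha hb]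
    exact hasIntegral_f2Integrand m ha.ne' hb.ne' hab
  · have h := hasPVIntegral_g1Integrand m ha.ne' hb.ne' hab
    rwa [abs_of_pos ha, g1Value_eq m ha hb] at h
  · rw [← g1Value_neg_eq m ha hb]
    exact hasIntegral_g2Integrand m ha hb.ne' hab
  · refine ⟨_, _, hasIntegral_f1Integrand m ha hb hab, hasIntegral_f2Integrand m ha hb hab,
      f1Value_add_neg m ha hb, ?_⟩
    rw [f1Value_add_neg m ha hb, f1Rec_eq_f1Alt, f2Rec_eq_f2Alt]
  · refine ⟨_, _, hasPVIntegral_g1Integrand m ha hb hab, hasPVIntegral_g2Integrand m ha hb hab,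
      g1Value_add_neg m ha hb, ?_⟩
    rw [g1Value_add_neg m ha hb, g1Rec_eq_g1Alt, g2Rec_eq_g2Alt]
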